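/- Fix $\chi\in C_c^\infty(\mathbb R;\mathbb R)$ with $\chi=1$ in a neighbourhood of $0$ and, for $k\in\mathbb Z$ and $f\in L^2(\mathbb R^2)$, let $\widehat{P_{\le k}f}(\xi)=\chi(2^{-k}|\xi|)\hat f(\xi)$ and $P_k=P_{\le k}-P_{\le k-1}$. Let $\mu_1=1$, $\mu_2=-1$. For an interval $I\subseteq\mathbb R$ (all norms are over $t\in I$, $x\in\mathbb R^2$; $I=\mathbb R$ is allowed) and a function $f:I\to L^2(\mathbb R^2)$, write $f^y(t,x)=f(t,x-y)$ and $\|f\|_G=\max\{\|f\|_{L^\infty_tL^2_x},\|f\|_{L^4_{t,x}}\}$; if $f\in L^1_{loc}(I^\circ;L^2(\mathbb R^2))$ and the distribution $(i\partial_t+\mu_l\partial_l^2)f$ on $I^\circ\times\mathbb R^2$ (sum over $l=1,2$) also belongs to $L^1_{loc}(I^\circ;L^2(\mathbb R^2))$, put $$\mathcal D(f)=\|f\|_{G}+\Big(\sup_{y\in\mathbb R^2}\big\|f^y\cdot(i\partial_t+\mu_l\partial_l^2)f\big\|_{L^1_{t,x}}\Big)^{1/2}\in[0,\infty].$$ Proposition.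 There is a constant $C<\infty$ depending only on $\chi$ such that, for every interval $I\subseteq\mathbb R$, all $k_1,k_2\in\mathbb Z$ and all $u,v:I\to L^2(\mathbb R^2)$ for which $P_{k_1}u$, $P_{k_2}v$, $(i\partial_t+\mu_l\partial_l^2)P_{k_1}u$ and $(i\partial_t+\mu_l\partial_l^2)P_{k_2}v$ belong to $L^1_{loc}(I^\circ;L^2(\mathbb R^2))$, $$\sup_{y\in\mathbb R^2}\|P_{k_1}u^y\,P_{k_2}v\|_{L^2_{t,x}}\le C\,2^{-\frac{|k_1-k_2|}{2}}\,\mathcal D(P_{k_1}u)\,\mathcal D(P_{k_2}v)$$ (with the convention $0\cdot\infty=0$ on the right). -/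

import Mathlib

open MeasureTheory Filter Topology
open scoped ENNReal NNReal FourierTransform ContDiff

noncomputable section

/-- The spatial domain `ℝ²` with its Euclidean structure. -/
abbrev Plane : Type := EuclideanSpace ℝ (Fin 2)

/-- The complex Hilbert space `L²(ℝ²)` of functions of the space variable. -/
abbrev L2x : Type := Lp ℂ 2 (volume : Measure Plane)

/-- A smooth radial cutoff profile `χ` used to build the Littlewood-Paley operators: smooth,
compactly supported, equal to `1` near the origin. -/
structure LPCutoff where
  /-- the profile, evaluated at `2^{-k}|ξ|` -/
  toFun : ℝ → ℝ
  smooth : ContDiff ℝ ∞ toFun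
  compact_support : HasCompactSupport toFun
  eq_one_near_zero : ∀ᶠ r in 𝓝 (0 : ℝ), toFun r = 1

/-- The symbol `ξ ↦ χ(2^{-k}|ξ|)`. -/
def lowSymbol (χ : LPCutoff) (k : ℤ) (ξ : Plane) : ℂ :=
  ((χ.toFun ((2 : ℝ) ^ (-k) * ‖ξ‖) : ℝ) : ℂ)

theorem lowSymbol_memLp (χ : LPCutoff) (k : ℤ) :
    MemLp (lowSymbol χ k) ∞ (volume : Measure Plane) := by
  have hc : Continuous (lowSymbol χ k) :=
    Complex.continuous_ofReal.comp
      (χ.smooth.continuous.comp (continuous_const.mul continuous_norm))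
  obtain ⟨M, hM⟩ := χ.compact_support.exists_bound_of_continuous χ.smooth.continuous
  refine memLp_top_of_bound hc.aestronglyMeasurable M (Eventually.of_forall fun ξ => ?_)
  simpa [lowSymbol] using hM ((2 : ℝ) ^ (-k) * ‖ξ‖)

/-- `P_{≤ k}` on `L²(ℝ²)`: the Fourier transform of `P_{≤ k} f` is `χ(2^{-k}|ξ|)` times that
of `f`. -/
def lpLow (χ : LPCutoff) (k : ℤ) (f : L2x) : L2x :=
  𝓕⁻ (((lowSymbol_memLp χ k).toLp (lowSymbol χ k) • (𝓕 f : L2x) : L2x))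

/-- The homogeneous Littlewood-Paley operator `P_k = P_{≤ k} - P_{≤ k-1}`. -/
def lpProj (χ : LPCutoff) (k : ℤ) (f : L2x) : L2x :=
  lpLow χ k f - lpLow χ (k - 1) f

/-- The signature `μ₁ = 1`, `μ₂ = -1`. -/
def uhSign : Fin 2 → ℝ := ![1, -1]

/-- The formal transpose `-i ∂_t + μ_l ∂_l²` of the hyperbolic Schrödinger operator
`i ∂_t + μ_l ∂_l²`, applied to a test function on space-time. -/
def uhTranspose (φ : ℝ × Plane → ℂ) (t : ℝ) (x : Plane) : ℂ :=
  -Complex.I * deriv (fun s : ℝ => φ (s, x)) t +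
    ∑ l : Fin 2, (uhSign l : ℂ) *
      iteratedDeriv 2 (fun s : ℝ => φ (t, x + s • EuclideanSpace.single l (1 : ℝ))) 0

/-- `(i ∂_t + μ_l ∂_l²) f = N` in the sense of distributions on `I° × ℝ²`, where `f` and `N`
both belong to `L¹_loc(I°; L²(ℝ²))`. -/
structure IsUHForcing (I : Set ℝ) (f N : ℝ → L2x) : Prop where
  locInt : LocallyIntegrableOn f (interior I)
  locInt_forcing : LocallyIntegrableOn N (interior I)
  eqn : ∀ φ : ℝ × Plane → ℂ, ContDiff ℝ ∞ φ → HasCompactSupport φ →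
    tsupport φ ⊆ interior I ×ˢ Set.univ →
    ∫ t in interior I, ∫ x : Plane, f t x * uhTranspose φ t x =
      ∫ t in interior I, ∫ x : Plane, N t x * φ (t, x)

/-- The norm of `G = L^∞_t L²_x ∩ L⁴_{t,x}` over `I × ℝ²`. -/
def strichartzNorm (I : Set ℝ) (f : ℝ → L2x) : ℝ≥0∞ :=
  max (eLpNorm f ∞ (volume.restrict I))
    ((∫⁻ t in I, ∫⁻ x : Plane, ‖f t x‖ₑ ^ 4) ^ (1 / 4 : ℝ))

/-- `I(f, N) = sup_y ‖f^y N‖_{L¹_{t,x}}` over `I × ℝ²`, where `f^y(t, x) = f(t, x - y)`. -/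
def interaction (I : Set ℝ) (f N : ℝ → L2x) : ℝ≥0∞ :=
  ⨆ y : Plane, ∫⁻ t in I, ∫⁻ x : Plane, ‖f t (x - y) * N t x‖ₑ

/-- The functional `𝓓(f) = ‖f‖_G + (sup_y ‖f^y · (i ∂_t + μ_l ∂_l²) f‖_{L¹_{t,x}})^{1/2}`, where
`N` stands for `(i ∂_t + μ_l ∂_l²) f`. -/
def dFunctional (I : Set ℝ) (f N : ℝ → L2x) : ℝ≥0∞ :=
  strichartzNorm I f + interaction I f N ^ (1 / 2 : ℝ)

/-- `sup_y ‖f^y g‖_{L²_{t,x}}` over `I × ℝ²`. -/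
def supTranslatedL2 (I : Set ℝ) (f g : ℝ → L2x) : ℝ≥0∞ :=
  ⨆ y : Plane, (∫⁻ t in I, ∫⁻ x : Plane, ‖f t (x - y) * g t x‖ₑ ^ 2) ^ (1 / 2 : ℝ)

end

/-! When the two frequencies are comparable the claimed gain is a constant, and Hölder with the two
L⁴ norms suffices (`UH.supTranslatedL2_le_mul`). The substance is the case of f at frequency λ and g
at frequency ν with ν much smaller than λ.

A smooth partition cuts f into four pieces. On the Fourier support of each piece θ ξ_j ≥ c with c of
size λ, for some coordinate j and sign θ, while θ ξ_j ≤ m with m of size ν on that of g. Consider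
the interaction ∫∫ |f(x)|² |g(y)|² W(x_j - y_j). Since W sees only the direction j, only μ_j
survives in its time derivative, as an overall sign, so the indefinite signature does no harm.
Integration in time bounds the integral, against w = W', of (momentum of f)(mass of g) - (mass of
f)(momentum of g) by ‖W‖ times masses and forcing interactions (`UH.abs_integral_virial_le`).

The momentum density is not pointwise comparable to the mass density, even for frequencies in a
half-plane. Analytic continuation replaces positivity. Let f_τ = e^{iθτ∂_j} f, g_τ = e^{-iθτ∂_j} g,
and let H(τ) be the time integral of the w-interaction of |f_τ|² and |g_τ|². These functions solve
equations of the same form, and H'(τ) is, up to sign, their momentum integral. On the given supports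
the two operators are averages of translations by a Poisson kernel, of total masses e^{-2πτc} and
e^{2πτm}. Averages of translations act on L² and, thanks to the supremum over y, on the forcing
interaction, at the cost of their mass. Hence |H'(τ)| ≤ K e^{-δτ} with δ of size λ, H tends to 0,
and H(0) ≤ K/δ (`UH.integral_form_le`).

With W(s) = arctan(νs), which is bounded uniformly in ν, the weight is w(s) = ν/(1+ν²s²). As g is
reproduced by a Schwartz kernel at scale 1/ν, the integral of |fg|² is at most a constant times ν
times the w-interaction (`UH.lintegral_enorm_mul_op_sq_le`). This gives ν/λ, whose square root is
the claim. The distributional equation enters through a continuous L²-valued representative that is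
a primitive of i(μ_l∂_l² f - N) (`UH.exists_primitive_of_isUHForcing`). -/

noncomputable section

namespace UH

/-! ### Translations of `L²` functions -/

/-- Translation `f ↦ f(· - z)` on `L²(ℝ²)`. -/
def trans (z : Plane) : L2x →ₗᵢ[ℂ] L2x :=
  Lp.compMeasurePreservingₗᵢ ℂ (fun x => x - z) (measurePreserving_sub_right volume z)

theorem coeFn_trans (z : Plane) (f : L2x) : trans z f =ᵐ[volume] fun x => f (x - z) :=
  Lp.coeFn_compMeasurePreserving f (measurePreserving_sub_right volume z)

theorem trans_toLp (z : Plane) {f : Plane → ℂ} (hf : MemLp f 2 volume) :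
    trans z (hf.toLp f) =
      (hf.comp_measurePreserving (measurePreserving_sub_right volume z)).toLp _ := rfl

theorem trans_trans (z w : Plane) (f : L2x) : trans z (trans w f) = trans (z + w) f := by
  apply Lp.ext
  filter_upwards [coeFn_trans z (trans w f), coeFn_trans (z + w) f,
    (measurePreserving_sub_right volume z).quasiMeasurePreserving.ae (coeFn_trans w f)]
    with x h1 h2 h3
  rw [h1, h2, h3, sub_sub]

theorem trans_zero (f : L2x) : trans 0 f = f := by
  apply Lp.ext
  filter_upwards [coeFn_trans 0 f] with x h1
  rw [h1, sub_zero]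

/-- Joint continuity is what makes superpositions of translations strongly measurable, also when the
translated function depends on time. -/
theorem continuous_trans : Continuous fun p : Plane × L2x => trans p.1 p.2 := by
  let g : C(Plane, C(Plane, Plane)) :=
    (ContinuousMap.mk (fun a : Plane × Plane => a.2 - a.1) (by fun_prop)).curry
  exact continuous_snd.compMeasurePreservingLp (p := 2)
    (g := fun p : Plane × L2x => g p.1) (g.continuous.comp continuous_fst)
    (fun p => measurePreserving_sub_right volume p.1) (by simp)

/-- The character `ξ ↦ e^{-2πi z·ξ}`. -/
def ph (z ξ : Plane) : ℂ := Complex.exp (((-(2 * Real.pi * inner ℝ z ξ) : ℝ) : ℂ) * Complex.I)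

theorem norm_ph (z ξ : Plane) : ‖ph z ξ‖ = 1 := Complex.norm_exp_ofReal_mul_I _

@[fun_prop]
theorem continuous_ph : Continuous fun p : Plane × Plane => ph p.1 p.2 := by
  unfold ph; fun_prop

theorem fourier_translate (f : SchwartzMap Plane ℂ) (z ξ : Plane) :
    (𝓕 (f.compSubConstCLM ℂ z)) ξ = ph z ξ * (𝓕 f) ξ := by
  have h := congrFun (VectorFourier.fourierIntegral_comp_add_right Real.fourierChar
    (volume : Measure Plane) (innerₗ Plane) f (-z)) ξ
  simp only [SchwartzMap.fourier_coe]
  rw [Real.fourier_eq', Real.fourier_eq']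
  simp only [VectorFourier.fourierIntegral, Circle.smul_def, Real.fourierChar_apply,
    Function.comp, ← sub_eq_add_neg] at h
  simp only [SchwartzMap.compSubConstCLM_apply]
  simp only [innerₗ_apply_apply, mul_neg, map_neg, LinearMap.neg_apply] at h
  simp only [ph, neg_mul] at h ⊢
  exact h

theorem fourier_trans (z : Plane) (f : L2x) :
    (𝓕 (trans z f) : L2x) =ᵐ[volume] fun ξ => ph z ξ * (𝓕 f : L2x) ξ := by
  have hb : MemLp (ph z) ∞ (volume : Measure Plane) :=
    memLp_top_of_bound (by fun_prop : Continuous fun ξ => ph z ξ).aestronglyMeasurable 1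
      (Eventually.of_forall fun ξ => (norm_ph z ξ).le)
  have key : (𝓕 (trans z f) : L2x) = (hb.toLp (ph z) • (𝓕 f : L2x) : L2x) := by
    refine DenseRange.induction_on
      (p := fun f : L2x => (𝓕 (trans z f) : L2x) = (hb.toLp (ph z) • (𝓕 f : L2x) : L2x))
      (SchwartzMap.denseRange_toLpCLM (F := ℂ) (μ := (volume : Measure Plane))
        (p := 2) ENNReal.ofNat_ne_top) f ?_ ?_
    · refine isClosed_eq ?_ ?_
      · exact (Lp.fourierTransformₗᵢ Plane ℂ).continuous.comp (trans z).continuous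
      · exact ((ContinuousLinearMap.mul ℂ ℂ).holderL volume ∞ 2 2 (hb.toLp (ph z))).continuous.comp
          (Lp.fourierTransformₗᵢ Plane ℂ).continuous
    · intro g
      have e1 : trans z (SchwartzMap.toLpCLM ℝ ℂ 2 volume g) = (g.compSubConstCLM ℂ z).toLp 2 :=
        trans_toLp z (g.memLp 2 volume)
      rw [e1]
      change (𝓕 ((g.compSubConstCLM ℂ z).toLp 2) : L2x) =
        (hb.toLp (ph z) • (𝓕 (g.toLp 2) : L2x) : L2x)
      rw [SchwartzMap.toLp_fourier_eq, SchwartzMap.toLp_fourier_eq]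
      apply Lp.ext
      filter_upwards [SchwartzMap.coeFn_toLp (𝓕 (g.compSubConstCLM ℂ z)) 2 volume,
        SchwartzMap.coeFn_toLp (𝓕 g) 2 volume, hb.coeFn_toLp,
        Lp.coeFn_lpSMul (r := 2) (hb.toLp (ph z)) ((𝓕 g).toLp 2)] with ξ h1 h2 h3 h4
      rw [h1, h4, Pi.smul_apply', h2, h3, fourier_translate, smul_eq_mul]
  rw [key]
  filter_upwards [hb.coeFn_toLp, Lp.coeFn_lpSMul (r := 2) (hb.toLp (ph z)) (𝓕 f : L2x)]
    with ξ h1 h2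
  rw [h2, Pi.smul_apply', h1, smul_eq_mul]

attribute [irreducible] trans ph

/-! ### Averages of translations -/

/-- A superposition of translations with an integrable complex density. -/
structure TransMean where
  /-- the parameter space -/
  S : Type
  [mS : MeasurableSpace S]
  /-- the reference measure -/
  ν : Measure S
  [sf : SFinite ν]
  /-- the density -/
  K : S → ℂ
  /-- the shift attached to a parameter -/
  γ : S → Plane
  hK : Integrable K ν
  hγ : Measurable γ

attribute [instance] TransMean.mS TransMean.sf

namespace TransMean

variable (A : TransMean)

/-- The total variation of the density. -/
def mass : ℝ := ∫ s, ‖A.K s‖ ∂A.ν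

theorem mass_nonneg : 0 ≤ A.mass := integral_nonneg fun _ => norm_nonneg _

/-- The Fourier symbol. -/
def symbol (ξ : Plane) : ℂ := ∫ s, A.K s * ph (A.γ s) ξ ∂A.ν

theorem stronglyMeasurable_trans (f : L2x) : StronglyMeasurable fun s => trans (A.γ s) f :=
  (continuous_trans.comp (by fun_prop : Continuous fun z : Plane => (z, f))).comp_stronglyMeasurable
    A.hγ.stronglyMeasurable

theorem integrable_smul_trans (f : L2x) : Integrable (fun s => A.K s • trans (A.γ s) f) A.ν := by
  refine (A.hK.norm.mul_const ‖f‖).mono'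
    (A.hK.aestronglyMeasurable.smul (A.stronglyMeasurable_trans f).aestronglyMeasurable)
    (Eventually.of_forall fun s => ?_)
  rw [norm_smul, LinearIsometry.norm_map]

/-- The averaging operator on `L²`. -/
def op : L2x →L[ℂ] L2x :=
  LinearMap.mkContinuous
    { toFun := fun f => ∫ s, A.K s • trans (A.γ s) f ∂A.ν
      map_add' := fun f g => by
        simp only [map_add, smul_add]
        exact integral_add (A.integrable_smul_trans f) (A.integrable_smul_trans g)
      map_smul' := fun c f => by
        simp only [map_smul, smul_comm _ c, RingHom.id_apply]
        exact integral_smul c _ }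
    A.mass fun f => by
      refine (norm_integral_le_integral_norm _).trans ?_
      simp only [norm_smul, LinearIsometry.norm_map]
      rw [integral_mul_const, mass]

theorem op_apply (f : L2x) : A.op f = ∫ s, A.K s • trans (A.γ s) f ∂A.ν := rfl

theorem norm_op_le (f : L2x) : ‖A.op f‖ ≤ A.mass * ‖f‖ :=
  (norm_integral_le_integral_norm _).trans (le_of_eq (by
    simp only [norm_smul, LinearIsometry.norm_map]
    rw [integral_mul_const, mass]))

/-- A bounded operator passes under the Bochner integral, so commuting with each translation is
enough. This is how averages commute with derivatives, multipliers and the equation. -/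
theorem op_comp_comm (L : L2x →L[ℂ] L2x) (hL : ∀ z f, L (trans z f) = trans z (L f)) (f : L2x) :
    L (A.op f) = A.op (L f) := by
  rw [op_apply, op_apply, ← ContinuousLinearMap.integral_comp_comm _ (A.integrable_smul_trans f)]
  simp [hL]

theorem trans_op (z : Plane) (f : L2x) : trans z (A.op f) = A.op (trans z f) :=
  A.op_comp_comm (trans z).toContinuousLinearMap
    (fun w f => by simp [trans_trans, add_comm]) f

theorem fourier_op (f : L2x) :
    (𝓕 (A.op f) : L2x) =ᵐ[volume] fun ξ => A.symbol ξ * (𝓕 f : L2x) ξ := by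
  have hph : Measurable fun p : Plane × A.S => ph (A.γ p.2) p.1 :=
    Measurable.comp (g := fun p : Plane × Plane => ph p.1 p.2) continuous_ph.measurable
      ((A.hγ.comp measurable_snd).prodMk measurable_fst)
  have hint : ∀ ξ, Integrable (fun s => A.K s * ph (A.γ s) ξ) A.ν := fun ξ =>
    A.hK.norm.mono' (A.hK.aestronglyMeasurable.mul
      (hph.comp (measurable_const.prodMk measurable_id)).aestronglyMeasurable)
      (Eventually.of_forall fun s => by rw [norm_mul, norm_ph, mul_one])
  have hmeas : AEStronglyMeasurable (fun p : Plane × A.S => A.K p.2 * ph (A.γ p.2) p.1)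
      (volume.prod A.ν) :=
    (A.hK.aestronglyMeasurable.comp_snd).mul hph.aestronglyMeasurable
  have hsm : AEStronglyMeasurable A.symbol volume := hmeas.integral_prod_right'
  have hb : MemLp A.symbol ∞ (volume : Measure Plane) :=
    memLp_top_of_bound hsm A.mass (Eventually.of_forall fun ξ => by
      refine (norm_integral_le_integral_norm _).trans (le_of_eq ?_)
      simp only [norm_mul, norm_ph, mul_one, mass])
  have key : (𝓕 (A.op f) : L2x) = (hb.toLp A.symbol • (𝓕 f : L2x) : L2x) := by
    -- A Bochner integral in L² has no direct pointwise meaning, so the identity is tested against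
    -- g, where Fubini exchanges the average with the ξ-integral.
    refine ext_inner_left ℂ fun g => ?_
    have e1 : (𝓕 (A.op f) : L2x) = ∫ s, A.K s • (𝓕 (trans (A.γ s) f) : L2x) ∂A.ν := by
      have := ContinuousLinearMap.integral_comp_comm
        (Lp.fourierTransformₗᵢ Plane ℂ).toContinuousLinearEquiv.toContinuousLinearMap
        (A.integrable_smul_trans f)
      simp only [map_smul] at this
      exact this.symm
    have hi : Integrable (fun s => A.K s • (𝓕 (trans (A.γ s) f) : L2x)) A.ν := by
      have := ContinuousLinearMap.integrable_comp
        (Lp.fourierTransformₗᵢ Plane ℂ).toContinuousLinearEquiv.toContinuousLinearMap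
        (A.integrable_smul_trans f)
      simp only [map_smul] at this
      exact this
    rw [e1, ← integral_inner hi g]
    have hgf : Integrable (fun ξ => inner ℂ (g ξ) ((𝓕 f : L2x) ξ)) volume :=
      L2.integrable_inner g _
    have e2 : ∀ s, inner ℂ g (A.K s • (𝓕 (trans (A.γ s) f) : L2x)) =
        ∫ ξ, (A.K s * ph (A.γ s) ξ) * inner ℂ (g ξ) ((𝓕 f : L2x) ξ) := fun s => by
      rw [inner_smul_right, L2.inner_def, ← integral_const_mul]
      refine integral_congr_ae ?_
      filter_upwards [fourier_trans (A.γ s) f] with ξ h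
      rw [h, ← smul_eq_mul (ph _ _), inner_smul_right, mul_assoc]
    simp only [e2]
    rw [integral_integral_swap]
    · rw [L2.inner_def]
      refine integral_congr_ae ?_
      filter_upwards [hb.coeFn_toLp, Lp.coeFn_lpSMul (r := 2) (hb.toLp A.symbol) (𝓕 f : L2x)]
        with ξ h1 h2
      rw [h2, Pi.smul_apply', h1, inner_smul_right, symbol, integral_mul_const]
    · have hm : AEStronglyMeasurable (fun p : A.S × Plane => A.K p.1 * ph (A.γ p.1) p.2)
          (A.ν.prod volume) := hmeas.prod_swap
      refine (A.hK.norm.mul_prod hgf.norm).mono' (hm.mul hgf.aestronglyMeasurable.comp_snd)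
        (Eventually.of_forall fun p => ?_)
      simp only [Function.uncurry, norm_mul, norm_ph, mul_one, le_refl]
  rw [key]
  filter_upwards [hb.coeFn_toLp, Lp.coeFn_lpSMul (r := 2) (hb.toLp A.symbol) (𝓕 f : L2x)]
    with ξ h1 h2
  rw [h2, Pi.smul_apply', h1, smul_eq_mul]

end TransMean

/-! ### Translation-invariant `L¹` interactions -/

/-- The pointwise product `L² × L² → L¹`. -/
def mulL : L2x →L[ℂ] L2x →L[ℂ] Lp ℂ 1 (volume : Measure Plane) :=
  (ContinuousLinearMap.mul ℂ ℂ).holderL volume 2 2 1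

theorem coeFn_mulL (p q : L2x) : mulL p q =ᵐ[volume] fun x => p x * q x :=
  (ContinuousLinearMap.mul ℂ ℂ).coeFn_holder p q

/-- The `L¹` norm of the product of two `L²` functions. -/
def pairL1 (p q : L2x) : ℝ≥0∞ := ∫⁻ x, ‖p x * q x‖ₑ

theorem pairL1_eq (p q : L2x) : pairL1 p q = ‖mulL p q‖ₑ := by
  rw [Lp.enorm_def, eLpNorm_one_eq_lintegral_enorm]
  refine lintegral_congr_ae ?_
  filter_upwards [coeFn_mulL p q] with x h
  rw [h]

attribute [irreducible] mulL pairL1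

theorem continuous_pairL1 : Continuous fun p : L2x × L2x => pairL1 p.1 p.2 := by
  simp only [pairL1_eq]
  exact continuous_enorm.comp (mulL.isBoundedBilinearMap.continuous)

theorem pairL1_comm (p q : L2x) : pairL1 p q = pairL1 q p := by
  unfold pairL1; simp only [mul_comm]

theorem pairL1_trans (z : Plane) (p q : L2x) : pairL1 (trans z p) (trans z q) = pairL1 p q := by
  unfold pairL1
  rw [← lintegral_sub_right_eq_self (fun x => ‖p x * q x‖ₑ) z]
  refine lintegral_congr_ae ?_
  filter_upwards [coeFn_trans z p, coeFn_trans z q] with x h1 h2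
  rw [h1, h2]

/-- The supremum over translations of the space-time `L¹` norm of a product. -/
def supPair (μ : Measure ℝ) (f g : ℝ → L2x) : ℝ≥0∞ :=
  ⨆ y : Plane, ∫⁻ t, pairL1 (trans y (f t)) (g t) ∂μ

/-- Translating both factors by -y turns the shift y of one factor into the shift -y of the other.
-/
theorem supPair_comm (μ : Measure ℝ) (f g : ℝ → L2x) : supPair μ f g = supPair μ g f := by
  have : ∀ f g : ℝ → L2x, supPair μ f g ≤ supPair μ g f := fun f g => by
    refine iSup_le fun y => ?_
    refine le_trans (le_of_eq (lintegral_congr fun t => ?_))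
      (le_iSup (fun y => ∫⁻ t, pairL1 (trans y (g t)) (f t) ∂μ) (-y))
    rw [← pairL1_trans (-y), trans_trans, neg_add_cancel, trans_zero, pairL1_comm]
  exact le_antisymm (this f g) (this g f)

theorem aemeasurable_pairL1 {μ : Measure ℝ} {f g : ℝ → L2x} (hf : AEStronglyMeasurable f μ)
    (hg : AEStronglyMeasurable g μ) : AEMeasurable (fun t => pairL1 (f t) (g t)) μ :=
  (continuous_pairL1.comp_aestronglyMeasurable (hf.prodMk hg)).aemeasurable

theorem TransMean.pairL1_op_le (A : TransMean) (p q : L2x) :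
    pairL1 (A.op p) q ≤ ∫⁻ s, ‖A.K s‖ₑ * pairL1 (trans (A.γ s) p) q ∂A.ν := by
  have e1 : mulL (A.op p) q = ∫ s, mulL (A.K s • trans (A.γ s) p) q ∂A.ν :=
    ((mulL.flip q).integral_comp_comm (A.integrable_smul_trans p)).symm
  rw [pairL1_eq, e1]
  refine (enorm_integral_le_lintegral_enorm _).trans (le_of_eq (lintegral_congr fun s => ?_))
  rw [pairL1_eq, map_smul, smul_apply, enorm_smul]

/-- This is the role of the supremum over y: a translation inside the average merely changes y, so
averaging costs only the mass of its density. -/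
theorem TransMean.supPair_op_left (A : TransMean) {μ : Measure ℝ} [SFinite μ] {f g : ℝ → L2x}
    (hf : AEStronglyMeasurable f μ) (hg : AEStronglyMeasurable g μ) :
    supPair μ (fun t => A.op (f t)) g ≤ ENNReal.ofReal A.mass * supPair μ f g := by
  refine iSup_le fun y => ?_
  have h1 : ∀ t, pairL1 (trans y (A.op (f t))) (g t) ≤
      ∫⁻ s, ‖A.K s‖ₑ * pairL1 (trans (A.γ s + y) (f t)) (g t) ∂A.ν := fun t => by
    rw [A.trans_op]
    refine (A.pairL1_op_le _ _).trans (le_of_eq (lintegral_congr fun s => ?_))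
    rw [trans_trans]
  refine (lintegral_mono h1).trans ?_
  have hm : AEMeasurable (Function.uncurry fun t s =>
      ‖A.K s‖ₑ * pairL1 (trans (A.γ s + y) (f t)) (g t)) (μ.prod A.ν) := by
    refine (A.hK.aestronglyMeasurable.enorm.comp_snd).mul ?_
    have hz : AEStronglyMeasurable (fun p : ℝ × A.S => A.γ p.2 + y) (μ.prod A.ν) :=
      ((A.hγ.comp measurable_snd).add_const y).aestronglyMeasurable
    have ht : AEStronglyMeasurable (fun p : ℝ × A.S => trans (A.γ p.2 + y) (f p.1))
        (μ.prod A.ν) :=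
      continuous_trans.comp_aestronglyMeasurable (hz.prodMk hf.comp_fst)
    exact (continuous_pairL1.comp_aestronglyMeasurable
      (ht.prodMk hg.comp_fst)).aemeasurable
  rw [lintegral_lintegral_swap hm]
  calc _ ≤ ∫⁻ s, ‖A.K s‖ₑ * supPair μ f g ∂A.ν := by
        refine lintegral_mono fun s => ?_
        have hm2 : AEMeasurable (fun t => pairL1 (trans (A.γ s + y) (f t)) (g t)) μ :=
          aemeasurable_pairL1 ((trans _).continuous.comp_aestronglyMeasurable hf) hg
        rw [lintegral_const_mul'' _ hm2]
        gcongr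
        exact le_iSup (fun y => ∫⁻ t, pairL1 (trans y (f t)) (g t) ∂μ) _
    _ = _ := by
        rw [lintegral_mul_const'' _ A.hK.aestronglyMeasurable.enorm, TransMean.mass,
          ofReal_integral_norm_eq_lintegral_enorm A.hK]

theorem TransMean.supPair_op_op (A : TransMean) {μ : Measure ℝ} [SFinite μ] {f g : ℝ → L2x}
    (hf : AEStronglyMeasurable f μ) (hg : AEStronglyMeasurable g μ) :
    supPair μ (fun t => A.op (f t)) (fun t => A.op (g t)) ≤
      ENNReal.ofReal A.mass ^ 2 * supPair μ f g := by
  have hg' := A.op.continuous.comp_aestronglyMeasurable hg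
  refine (A.supPair_op_left hf hg').trans ?_
  rw [supPair_comm, pow_two, mul_assoc, supPair_comm μ f]
  gcongr
  exact A.supPair_op_left hg hf

/-! ### Fourier multipliers and derivatives -/

/-- The Fourier multiplier with a bounded symbol. -/
def mop (m : Plane → ℂ) (hm : MemLp m ∞ (volume : Measure Plane)) : L2x →L[ℂ] L2x :=
  (Lp.fourierTransformₗᵢ Plane ℂ).symm.toContinuousLinearEquiv.toContinuousLinearMap ∘L
    ((ContinuousLinearMap.mul ℂ ℂ).holderL volume ∞ 2 2 (hm.toLp m)) ∘L
      (Lp.fourierTransformₗᵢ Plane ℂ).toContinuousLinearEquiv.toContinuousLinearMap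

theorem fourier_mop (m : Plane → ℂ) (hm : MemLp m ∞ (volume : Measure Plane)) (f : L2x) :
    (𝓕 (mop m hm f) : L2x) =ᵐ[volume] fun ξ => m ξ * (𝓕 f : L2x) ξ := by
  have e : (𝓕 (mop m hm f) : L2x) =
      (ContinuousLinearMap.mul ℂ ℂ).holder 2 (hm.toLp m) (𝓕 f : L2x) :=
    (Lp.fourierTransformₗᵢ Plane ℂ).apply_symm_apply _
  rw [e]
  filter_upwards [hm.coeFn_toLp,
    (ContinuousLinearMap.mul ℂ ℂ).coeFn_holder (r := 2) (hm.toLp m) (𝓕 f : L2x)] with ξ h1 h2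
  rw [h2, h1, ContinuousLinearMap.mul_apply']

theorem fourier_injective {f g : L2x} (h : (𝓕 f : L2x) =ᵐ[volume] (𝓕 g : L2x)) : f = g :=
  (Lp.fourierTransformₗᵢ Plane ℂ).injective (Lp.ext h)

/-- By |e^z - 1 - z| ≤ |z|² for |z| ≤ 1, a bounded generator on the Fourier support gives a
quadratic remainder in L². It serves both for real translations and for the imaginary ones of `eop`.
-/
theorem hasDerivAt_of_fourier {F : ℝ → L2x} {G : L2x} {s : Plane → ℂ} {C h₀ : ℝ}
    (hs : ∀ᵐ ξ, (𝓕 (F h₀) : L2x) ξ ≠ 0 → ‖s ξ‖ ≤ C)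
    (hF : ∀ h : ℝ, (𝓕 (F (h₀ + h)) : L2x) =ᵐ[volume]
      fun ξ => Complex.exp (h * s ξ) * (𝓕 (F h₀) : L2x) ξ)
    (hG : (𝓕 G : L2x) =ᵐ[volume] fun ξ => s ξ * (𝓕 (F h₀) : L2x) ξ) : HasDerivAt F G h₀ := by
  rw [hasDerivAt_iff_isLittleO_nhds_zero]
  have hO : (fun h : ℝ => F (h₀ + h) - F h₀ - h • G) =O[𝓝 0] fun h : ℝ => h ^ 2 := by
    refine Asymptotics.IsBigO.of_bound (C ^ 2 * ‖F h₀‖) ?_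
    have hsmall : ∀ᶠ h : ℝ in 𝓝 0, |h| * C < 1 := by
      have : Tendsto (fun h : ℝ => |h| * C) (𝓝 0) (𝓝 (|0| * C)) :=
        (continuous_abs.mul continuous_const).tendsto _
      rw [abs_zero, zero_mul] at this
      exact this.eventually_lt_const one_pos
    filter_upwards [hsmall] with h hh
    have e : (𝓕 (F (h₀ + h) - F h₀ - h • G) : L2x) =
        𝓕 (F (h₀ + h)) - 𝓕 (F h₀) - (h : ℂ) • (𝓕 G : L2x) := by
      have e2 : h • G = (h : ℂ) • G := rfl
      rw [e2, ← FourierTransform.fourier_smul]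
      exact ((Lp.fourierTransformₗᵢ Plane ℂ).map_sub _ _).trans
        (congrArg (· - _) ((Lp.fourierTransformₗᵢ Plane ℂ).map_sub _ _))
    rw [← Lp.norm_fourier_eq (F (h₀ + h) - F h₀ - h • G), e]
    have hb : ∀ᵐ ξ, ‖(𝓕 (F (h₀ + h)) - 𝓕 (F h₀) - (h : ℂ) • (𝓕 G : L2x) : L2x) ξ‖ ≤
        (C ^ 2 * h ^ 2) * ‖(𝓕 (F h₀) : L2x) ξ‖ := by
      filter_upwards [hs, hF h, hG,
        Lp.coeFn_sub (𝓕 (F (h₀ + h)) - 𝓕 (F h₀)) ((h : ℂ) • (𝓕 G : L2x)),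
        Lp.coeFn_sub (𝓕 (F (h₀ + h)) : L2x) (𝓕 (F h₀)), Lp.coeFn_smul (h : ℂ) (𝓕 G : L2x)]
        with ξ h1 h2 h3 h4 h5 h6
      rw [h4, Pi.sub_apply, h5, Pi.sub_apply, h6, Pi.smul_apply, h2, h3]
      by_cases h0 : (𝓕 (F h₀) : L2x) ξ = 0
      · simp [h0]
      have hsC := h1 h0
      have e3 : Complex.exp (h * s ξ) * (𝓕 (F h₀) : L2x) ξ - (𝓕 (F h₀) : L2x) ξ -
          (h : ℂ) • (s ξ * (𝓕 (F h₀) : L2x) ξ) =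
          (Complex.exp (h * s ξ) - 1 - h * s ξ) * (𝓕 (F h₀) : L2x) ξ := by
        rw [smul_eq_mul]; ring
      rw [e3, norm_mul]
      refine mul_le_mul_of_nonneg_right ?_ (norm_nonneg _)
      have hn : ‖(h : ℂ) * s ξ‖ ≤ |h| * C := by
        rw [norm_mul, Complex.norm_real, Real.norm_eq_abs]
        exact mul_le_mul_of_nonneg_left hsC (abs_nonneg h)
      refine (Complex.norm_exp_sub_one_sub_id_le (hn.trans hh.le)).trans ?_
      calc ‖(h : ℂ) * s ξ‖ ^ 2 ≤ (|h| * C) ^ 2 := by gcongr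
        _ = C ^ 2 * h ^ 2 := by rw [mul_pow, sq_abs, mul_comm]
    refine (Lp.norm_le_mul_norm_of_ae_le_mul hb).trans (le_of_eq ?_)
    rw [Lp.norm_fourier_eq, Real.norm_of_nonneg (sq_nonneg h)]
    ring
  exact hO.trans_isLittleO (by simpa using Asymptotics.isLittleO_pow_id (𝕜 := ℝ) one_lt_two)

/-- The Fourier transform vanishes outside of the ball of radius `R`. -/
def Band (R : ℝ) (f : L2x) : Prop := ∀ᵐ ξ, R < ‖ξ‖ → (𝓕 f : L2x) ξ = 0

/-- The symbol of `∂_l`, cut off to the ball of radius `R`. -/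
def derivSymbol (R : ℝ) (l : Fin 2) (ξ : Plane) : ℂ :=
  if ‖ξ‖ ≤ R then ((2 * Real.pi * ξ l : ℝ) : ℂ) * Complex.I else 0

/-- The symbol of `e^{-iτ∂_l}`, cut off to the ball of radius `R`. -/
def expSymbol (R : ℝ) (l : Fin 2) (τ : ℝ) (ξ : Plane) : ℂ :=
  if ‖ξ‖ ≤ R then Complex.exp (τ * (2 * Real.pi * ξ l : ℝ)) else 0

theorem abs_coord_le (ξ : Plane) (l : Fin 2) : |ξ l| ≤ ‖ξ‖ := by
  simpa using PiLp.norm_apply_le ξ l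

theorem memLp_derivSymbol (R : ℝ) (l : Fin 2) :
    MemLp (derivSymbol R l) ∞ (volume : Measure Plane) := by
  have hm : Measurable (derivSymbol R l) :=
    Measurable.ite (measurableSet_le measurable_norm measurable_const) (by fun_prop)
      measurable_const
  refine memLp_top_of_bound hm.aestronglyMeasurable (2 * Real.pi * |R|)
    (Eventually.of_forall fun ξ => ?_)
  unfold derivSymbol
  split_ifs with h
  · rw [norm_mul, Complex.norm_I, mul_one, Complex.norm_real, norm_mul, Real.norm_of_nonneg
      Real.two_pi_pos.le, Real.norm_eq_abs]
    exact mul_le_mul_of_nonneg_left ((abs_coord_le ξ l).trans (h.trans (le_abs_self R)))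
      Real.two_pi_pos.le
  · rw [norm_zero]; positivity

theorem norm_expSymbol_le (R : ℝ) (l : Fin 2) (τ : ℝ) (ξ : Plane) :
    ‖expSymbol R l τ ξ‖ ≤ Real.exp (|τ| * (2 * Real.pi * |R|)) := by
  unfold expSymbol
  split_ifs with h
  · rw [← Complex.ofReal_mul, ← Complex.ofReal_exp, Complex.norm_real, Real.norm_of_nonneg
      (Real.exp_pos _).le, Real.exp_le_exp]
    refine (le_abs_self _).trans ?_
    rw [abs_mul, abs_mul, abs_of_nonneg Real.two_pi_pos.le]
    exact mul_le_mul_of_nonneg_left (mul_le_mul_of_nonneg_left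
      ((abs_coord_le ξ l).trans (h.trans (le_abs_self R))) Real.two_pi_pos.le) (abs_nonneg τ)
  · rw [norm_zero]; positivity

theorem memLp_expSymbol (R : ℝ) (l : Fin 2) (τ : ℝ) :
    MemLp (expSymbol R l τ) ∞ (volume : Measure Plane) := by
  have hm : Measurable (expSymbol R l τ) :=
    Measurable.ite (measurableSet_le measurable_norm measurable_const) (by fun_prop)
      measurable_const
  exact memLp_top_of_bound hm.aestronglyMeasurable _
    (Eventually.of_forall (norm_expSymbol_le R l τ))

/-- The partial derivative of band-limited functions. -/
def dop (R : ℝ) (l : Fin 2) : L2x →L[ℂ] L2x := mop _ (memLp_derivSymbol R l)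

/-- The operator `e^{-iτ∂_l}` on band-limited functions: translation by `-iτ` in the `l`-th
coordinate. -/
def eop (R : ℝ) (l : Fin 2) (τ : ℝ) : L2x →L[ℂ] L2x := mop _ (memLp_expSymbol R l τ)

theorem band_mop {R : ℝ} {m : Plane → ℂ} (hm : MemLp m ∞ (volume : Measure Plane)) {f : L2x}
    (hf : Band R f) : Band R (mop m hm f) := by
  filter_upwards [hf, fourier_mop m hm f] with ξ h1 h2 h3
  rw [h2, h1 h3, mul_zero]

theorem band_dop {R : ℝ} (l : Fin 2) {f : L2x} (hf : Band R f) : Band R (dop R l f) :=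
  band_mop _ hf

theorem TransMean.band_op {R : ℝ} (A : TransMean) {f : L2x} (hf : Band R f) :
    Band R (A.op f) := by
  filter_upwards [hf, A.fourier_op f] with ξ h1 h2 h3
  rw [h2, h1 h3, mul_zero]

theorem band_trans {R : ℝ} (z : Plane) {f : L2x} (hf : Band R f) : Band R (trans z f) := by
  filter_upwards [hf, fourier_trans z f] with ξ h1 h2 h3
  rw [h2, h1 h3, mul_zero]

theorem mop_trans (m : Plane → ℂ) (hm : MemLp m ∞ (volume : Measure Plane)) (z : Plane)
    (f : L2x) : mop m hm (trans z f) = trans z (mop m hm f) := by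
  apply fourier_injective
  filter_upwards [fourier_mop m hm (trans z f), fourier_trans z f, fourier_trans z (mop m hm f),
    fourier_mop m hm f] with ξ h1 h2 h3 h4
  rw [h1, h2, h3, h4, mul_left_comm]

theorem mop_op (m : Plane → ℂ) (hm : MemLp m ∞ (volume : Measure Plane)) (A : TransMean)
    (f : L2x) : mop m hm (A.op f) = A.op (mop m hm f) :=
  A.op_comp_comm _ (mop_trans m hm) f

theorem eop_zero {R : ℝ} (l : Fin 2) {f : L2x} (hf : Band R f) : eop R l 0 f = f := by
  apply fourier_injective
  filter_upwards [hf, fourier_mop _ (memLp_expSymbol R l 0) f] with ξ h1 h2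
  rw [eop, h2, expSymbol]
  split_ifs with h
  · simp
  · rw [h1 (not_le.1 h), mul_zero]

theorem hasDerivAt_eop (R : ℝ) (l : Fin 2) (τ : ℝ) (f : L2x) :
    HasDerivAt (fun τ => eop R l τ f) (-(Complex.I • dop R l (eop R l τ f))) τ := by
  -- Inside the ball of radius R this generator is 2πξ_l, the logarithmic derivative of e^{2πτξ_l}
  -- in τ.
  refine hasDerivAt_of_fourier (s := fun ξ => -Complex.I * derivSymbol R l ξ)
    (C := 2 * Real.pi * |R|) ?_ ?_ ?_
  · filter_upwards [fourier_mop _ (memLp_expSymbol R l τ) f] with ξ h1 h2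
    rw [eop, h1, expSymbol] at h2
    split_ifs at h2 with h
    · rw [norm_mul, norm_neg, Complex.norm_I, one_mul, derivSymbol, if_pos h, norm_mul,
        Complex.norm_I, mul_one, Complex.norm_real, norm_mul, Real.norm_of_nonneg
        Real.two_pi_pos.le, Real.norm_eq_abs]
      exact mul_le_mul_of_nonneg_left ((abs_coord_le ξ l).trans (h.trans (le_abs_self R)))
        Real.two_pi_pos.le
    · simp at h2
  · intro h
    filter_upwards [fourier_mop _ (memLp_expSymbol R l τ) f,
      fourier_mop _ (memLp_expSymbol R l (τ + h)) f] with ξ h1 h2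
    rw [eop, eop, h1, h2, expSymbol, expSymbol, derivSymbol]
    split_ifs
    · rw [← mul_assoc, ← Complex.exp_add]
      congr 2
      push_cast
      linear_combination (2 * (h : ℂ) * Real.pi * ξ l) * Complex.I_sq
    · simp
  · have e : (𝓕 (-(Complex.I • dop R l (eop R l τ f))) : L2x) =
        (-Complex.I) • (𝓕 (dop R l (eop R l τ f)) : L2x) := by
      rw [← neg_smul, FourierTransform.fourier_smul]
    rw [e]
    filter_upwards [Lp.coeFn_smul (-Complex.I) (𝓕 (dop R l (eop R l τ f)) : L2x),
      fourier_mop _ (memLp_derivSymbol R l) (eop R l τ f)] with ξ h1 h2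
    rw [h1, Pi.smul_apply, dop, h2, smul_eq_mul, mul_assoc]

/-- The unit vectors of the plane. -/
def ev (l : Fin 2) : Plane := EuclideanSpace.single l (1 : ℝ)

theorem inner_smul_ev (h : ℝ) (l : Fin 2) (ξ : Plane) : inner ℝ (h • ev l) ξ = h * ξ l := by
  rw [inner_smul_left, ev, EuclideanSpace.inner_single_left]; simp

theorem hasDerivAt_trans {R : ℝ} (l : Fin 2) {f : L2x} (hf : Band R f) :
    HasDerivAt (fun h : ℝ => trans (h • ev l) f) (-dop R l f) 0 := by
  have h0 : trans ((0 : ℝ) • ev l) f = f := by rw [zero_smul, trans_zero]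
  refine hasDerivAt_of_fourier (s := fun ξ => -derivSymbol R l ξ)
    (C := 2 * Real.pi * |R|) ?_ ?_ ?_
  · rw [h0]
    filter_upwards [hf] with ξ h1 h2
    have h : ‖ξ‖ ≤ R := by
      by_contra h; exact h2 (h1 (not_le.1 h))
    rw [norm_neg, derivSymbol, if_pos h, norm_mul,
        Complex.norm_I, mul_one, Complex.norm_real, norm_mul, Real.norm_of_nonneg
        Real.two_pi_pos.le, Real.norm_eq_abs]
    exact mul_le_mul_of_nonneg_left ((abs_coord_le ξ l).trans (h.trans (le_abs_self R)))
        Real.two_pi_pos.le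
  · intro h
    rw [h0, zero_add]
    filter_upwards [hf, fourier_trans (h • ev l) f] with ξ h1 h2
    rw [h2]
    by_cases hξ : ‖ξ‖ ≤ R
    · rw [ph, inner_smul_ev, derivSymbol, if_pos hξ]
      congr 2
      push_cast
      ring
    · rw [h1 (not_le.1 hξ), mul_zero, mul_zero]
  · rw [h0]
    have e : (𝓕 (-dop R l f) : L2x) = -(𝓕 (dop R l f) : L2x) :=
      (Lp.fourierTransformₗᵢ Plane ℂ).map_neg _
    rw [e]
    filter_upwards [Lp.coeFn_neg (𝓕 (dop R l f) : L2x),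
      fourier_mop _ (memLp_derivSymbol R l) f] with ξ h1 h2
    rw [h1, Pi.neg_apply, dop, h2, neg_mul]

/-! ### Quadratic densities and interaction forms -/

/-- The density `Re(conj p q)`, as an element of `L¹`. -/
def dens : L2x →L[ℝ] L2x →L[ℝ] Lp ℝ 1 (volume : Measure Plane) :=
  (innerSL ℝ : ℂ →L[ℝ] ℂ →L[ℝ] ℝ).holderL volume 2 2 1

theorem coeFn_dens (p q : L2x) : dens p q =ᵐ[volume] fun x => inner ℝ (p x) (q x) :=
  (innerSL ℝ : ℂ →L[ℝ] ℂ →L[ℝ] ℝ).coeFn_holder p q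

theorem dens_comm (p q : L2x) : dens p q = dens q p := by
  apply Lp.ext
  filter_upwards [coeFn_dens p q, coeFn_dens q p] with x h1 h2
  rw [h1, h2, real_inner_comm]

/-- The numbers p and ip are orthogonal in ℂ over ℝ. This removes the term of ∂p against i∂p when
the momentum density is differentiated. -/
theorem dens_I_smul (p : L2x) : dens p (Complex.I • p) = 0 := by
  apply Lp.ext
  filter_upwards [coeFn_dens p (Complex.I • p), Lp.coeFn_smul Complex.I p,
    Lp.coeFn_zero ℝ 1 (volume : Measure Plane)] with x h1 h2 h3
  rw [h1, h2, h3, Pi.smul_apply, Complex.inner]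
  simp
  ring

theorem enorm_dens_le (p q : L2x) : ‖dens p q‖ₑ ≤ pairL1 p q := by
  unfold pairL1
  rw [Lp.enorm_def, eLpNorm_one_eq_lintegral_enorm]
  refine lintegral_mono_ae ?_
  filter_upwards [coeFn_dens p q] with x h
  rw [h, enorm_mul, ← enorm_mul, ← ofReal_norm, ← ofReal_norm, norm_mul]
  exact ENNReal.ofReal_le_ofReal (norm_inner_le_norm _ _)

theorem norm_dens_le (p q : L2x) : ‖dens p q‖ ≤ ‖p‖ * ‖q‖ := by
  refine ((innerSL ℝ : ℂ →L[ℝ] ℂ →L[ℝ] ℝ).norm_holder_apply_apply_le (r := 1) p q).trans ?_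
  have : ‖(innerSL ℝ : ℂ →L[ℝ] ℂ →L[ℝ] ℝ)‖ ≤ 1 := norm_innerSL_le ℝ
  calc _ ≤ 1 * ‖p‖ * ‖q‖ := by gcongr
    _ = _ := by rw [one_mul]

attribute [irreducible] dens

/-- Abbreviation for the real space `L¹(ℝ²)`. -/
abbrev L1x : Type := Lp ℝ 1 (volume : Measure Plane)

theorem integrable_form (j : Fin 2) (W : BoundedContinuousFunction ℝ ℝ) (P Q : L1x) :
    Integrable (fun z : Plane × Plane => P z.1 * Q z.2 * W (z.1 j - z.2 j))
      (volume.prod volume) := by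
  refine ((L1.integrable_coeFn P).mul_prod (L1.integrable_coeFn Q)).mul_bdd (c := ‖W‖) ?_ ?_
  · exact (W.continuous.comp (by fun_prop)).aestronglyMeasurable
  · exact Eventually.of_forall fun z => W.norm_coe_le_norm _

theorem ae_prod_fst {P P' : Plane → ℝ} (h : P =ᵐ[volume] P') :
    ∀ᵐ z : Plane × Plane ∂(volume.prod volume), P z.1 = P' z.1 :=
  Measure.quasiMeasurePreserving_fst.ae h

theorem ae_prod_snd {P P' : Plane → ℝ} (h : P =ᵐ[volume] P') :
    ∀ᵐ z : Plane × Plane ∂(volume.prod volume), P z.2 = P' z.2 :=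
  Measure.quasiMeasurePreserving_snd.ae h

/-- The form `∫∫ P(x) Q(x') W(x_j - x'_j) dx dx'`. -/
def form (j : Fin 2) (W : BoundedContinuousFunction ℝ ℝ) : L1x →L[ℝ] L1x →L[ℝ] ℝ :=
  LinearMap.mkContinuous₂
    (LinearMap.mk₂ ℝ
      (fun P Q : L1x => ∫ z : Plane × Plane, P z.1 * Q z.2 * W (z.1 j - z.2 j)
        ∂(volume.prod volume))
      (fun P P' Q => by
        rw [← integral_add (integrable_form j W P Q) (integrable_form j W P' Q)]
        refine integral_congr_ae ?_
        filter_upwards [ae_prod_fst (Lp.coeFn_add P P')] with z h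
        rw [h, Pi.add_apply]; ring)
      (fun c P Q => by
        rw [← integral_smul]
        refine integral_congr_ae ?_
        filter_upwards [ae_prod_fst (Lp.coeFn_smul c P)] with z h
        rw [h, Pi.smul_apply, smul_eq_mul, smul_eq_mul]; ring)
      (fun P Q Q' => by
        rw [← integral_add (integrable_form j W P Q) (integrable_form j W P Q')]
        refine integral_congr_ae ?_
        filter_upwards [ae_prod_snd (Lp.coeFn_add Q Q')] with z h
        rw [h, Pi.add_apply]; ring)
      (fun c P Q => by
        rw [← integral_smul]
        refine integral_congr_ae ?_
        filter_upwards [ae_prod_snd (Lp.coeFn_smul c Q)] with z h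
        rw [h, Pi.smul_apply, smul_eq_mul, smul_eq_mul]; ring))
    ‖W‖ (fun P Q => by
      refine (norm_integral_le_integral_norm _).trans ?_
      have hPQ := (L1.integrable_coeFn P).norm.mul_prod (L1.integrable_coeFn Q).norm
      calc _ ≤ ∫ z : Plane × Plane, ‖W‖ * (‖P z.1‖ * ‖Q z.2‖) ∂(volume.prod volume) := by
            refine integral_mono (integrable_form j W P Q).norm (hPQ.const_mul _) fun z => ?_
            simp only [norm_mul]
            rw [mul_comm]
            exact mul_le_mul_of_nonneg_right (W.norm_coe_le_norm _) (by positivity)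
        _ = ‖W‖ * ‖P‖ * ‖Q‖ := by
            rw [integral_const_mul, integral_prod_mul (fun x => ‖P x‖) fun x => ‖Q x‖,
              L1.norm_eq_integral_norm, L1.norm_eq_integral_norm, mul_assoc])

theorem form_apply (j : Fin 2) (W : BoundedContinuousFunction ℝ ℝ) (P Q : L1x) :
    form j W P Q =
      ∫ z : Plane × Plane, P z.1 * Q z.2 * W (z.1 j - z.2 j) ∂(volume.prod volume) := rfl

theorem abs_form_le (j : Fin 2) (W : BoundedContinuousFunction ℝ ℝ) (P Q : L1x) :
    |form j W P Q| ≤ ‖W‖ * ‖P‖ * ‖Q‖ := by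
  refine (form j W).le_opNorm₂ P Q |>.trans ?_
  gcongr
  exact LinearMap.mkContinuous₂_norm_le _ (norm_nonneg _) _

attribute [irreducible] form

theorem form_sub_smul (j : Fin 2) (W W₀ w : BoundedContinuousFunction ℝ ℝ) (h : ℝ) (P Q : L1x) :
    form j (W - W₀ - h • w) P Q = form j W P Q - form j W₀ P Q - h • form j w P Q := by
  simp only [form_apply]
  have h12 : Integrable (fun z : Plane × Plane => P z.1 * Q z.2 * W (z.1 j - z.2 j) -
      P z.1 * Q z.2 * W₀ (z.1 j - z.2 j)) (volume.prod volume) :=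
    (integrable_form j W P Q).sub (integrable_form j W₀ P Q)
  have h3 : Integrable (fun z : Plane × Plane => h • (P z.1 * Q z.2 * w (z.1 j - z.2 j)))
      (volume.prod volume) := (integrable_form j w P Q).smul h
  rw [← integral_smul, ← integral_sub (integrable_form j W P Q) (integrable_form j W₀ P Q),
    ← integral_sub h12 h3]
  refine integral_congr_ae (Eventually.of_forall fun z => ?_)
  simp only [BoundedContinuousFunction.coe_sub, BoundedContinuousFunction.coe_smul, Pi.sub_apply,
    smul_eq_mul]
  ring

/-- The translate `W(· + a)` of a weight. -/
def shift (W : BoundedContinuousFunction ℝ ℝ) (a : ℝ) : BoundedContinuousFunction ℝ ℝ :=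
  W.compContinuous ⟨fun s => s + a, by fun_prop⟩

theorem shift_zero (W : BoundedContinuousFunction ℝ ℝ) : shift W 0 = W := by
  ext s; simp [shift]

/-- Moving the density is the same as moving the weight, by a change of variables. Integration by
parts is obtained by differentiating this identity, so no pointwise derivative of p is needed. -/
theorem form_dens_trans_left (j : Fin 2) (W : BoundedContinuousFunction ℝ ℝ) (z : Plane)
    (p q : L2x) (Q : L1x) :
    form j W (dens (trans z p) (trans z q)) Q = form j (shift W (z j)) (dens p q) Q := by
  have hmp : MeasurePreserving (fun y : Plane × Plane => (y.1 - z, y.2))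
      (volume.prod volume) (volume.prod volume) :=
    (measurePreserving_sub_right volume z).prod (MeasurePreserving.id volume)
  have hme : MeasurableEmbedding (fun y : Plane × Plane => (y.1 - z, y.2)) :=
    (MeasurableEquiv.prodCongr (MeasurableEquiv.subRight z) (MeasurableEquiv.refl Plane))
      |>.measurableEmbedding
  rw [form_apply, form_apply, ← hmp.integral_comp hme
    (fun y => dens p q y.1 * Q y.2 * shift W (z j) (y.1 j - y.2 j))]
  refine integral_congr_ae ?_
  filter_upwards [ae_prod_fst (coeFn_dens (trans z p) (trans z q)),
    hmp.quasiMeasurePreserving.ae (ae_prod_fst (coeFn_dens p q)),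
    Measure.quasiMeasurePreserving_fst.ae (coeFn_trans z p),
    Measure.quasiMeasurePreserving_fst.ae (coeFn_trans z q)] with y h1 h2 h3 h4
  rw [h1, h2, h3, h4]
  simp only [shift, BoundedContinuousFunction.compContinuous_apply, ContinuousMap.coe_mk,
    PiLp.sub_apply]
  congr 2
  ring

theorem form_dens_trans_right (j : Fin 2) (W : BoundedContinuousFunction ℝ ℝ) (z : Plane)
    (p q : L2x) (P : L1x) :
    form j W P (dens (trans z p) (trans z q)) = form j (shift W (-z j)) P (dens p q) := by
  have hmp : MeasurePreserving (fun y : Plane × Plane => (y.1, y.2 - z))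
      (volume.prod volume) (volume.prod volume) :=
    (MeasurePreserving.id volume).prod (measurePreserving_sub_right volume z)
  have hme : MeasurableEmbedding (fun y : Plane × Plane => (y.1, y.2 - z)) :=
    (MeasurableEquiv.prodCongr (MeasurableEquiv.refl Plane) (MeasurableEquiv.subRight z))
      |>.measurableEmbedding
  rw [form_apply, form_apply, ← hmp.integral_comp hme
    (fun y => P y.1 * dens p q y.2 * shift W (-z j) (y.1 j - y.2 j))]
  refine integral_congr_ae ?_
  filter_upwards [ae_prod_snd (coeFn_dens (trans z p) (trans z q)),
    hmp.quasiMeasurePreserving.ae (ae_prod_snd (coeFn_dens p q)),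
    Measure.quasiMeasurePreserving_snd.ae (coeFn_trans z p),
    Measure.quasiMeasurePreserving_snd.ae (coeFn_trans z q)] with y h1 h2 h3 h4
  rw [h1, h2, h3, h4]
  simp only [shift, BoundedContinuousFunction.compContinuous_apply, ContinuousMap.coe_mk,
    PiLp.sub_apply]
  congr 2
  ring

/-- `w` is the derivative of `W`, with a uniform quadratic Taylor remainder. -/
def IsWeightDeriv (W w : BoundedContinuousFunction ℝ ℝ) : Prop :=
  ∃ L : ℝ, ∀ s h : ℝ, |W (s + h) - W s - h * w s| ≤ L * h ^ 2

/-- The Taylor remainder is uniform in s, hence quadratic in h in the sup norm, and the form is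
bounded by the sup norm of its weight. -/
theorem IsWeightDeriv.hasDerivAt_form {W w : BoundedContinuousFunction ℝ ℝ}
    (hW : IsWeightDeriv W w) (j : Fin 2) (P Q : L1x) :
    HasDerivAt (fun h => form j (shift W h) P Q) (form j w P Q) 0 := by
  obtain ⟨L, hL⟩ := hW
  have hL0 : 0 ≤ L := by simpa using (abs_nonneg _).trans (hL 0 1)
  rw [hasDerivAt_iff_isLittleO_nhds_zero]
  have hO : (fun h : ℝ => form j (shift W (0 + h)) P Q - form j (shift W 0) P Q -
      h • form j w P Q) =O[𝓝 0] fun h : ℝ => h ^ 2 := by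
    refine Asymptotics.IsBigO.of_bound (L * ‖P‖ * ‖Q‖) (Eventually.of_forall fun h => ?_)
    rw [zero_add, shift_zero, ← form_sub_smul]
    refine (abs_form_le j _ P Q).trans ?_
    have : ‖shift W h - W - h • w‖ ≤ L * h ^ 2 := by
      rw [BoundedContinuousFunction.norm_le (by positivity)]
      exact fun s => hL s h
    calc _ ≤ L * h ^ 2 * ‖P‖ * ‖Q‖ := by gcongr
      _ = _ := by rw [Real.norm_of_nonneg (sq_nonneg h)]; ring
  exact hO.trans_isLittleO (by simpa using Asymptotics.isLittleO_pow_id (𝕜 := ℝ) one_lt_two)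

theorem hasDerivAt_dens {F G : ℝ → L2x} {F' G' : L2x} {t : ℝ} (hF : HasDerivAt F F' t)
    (hG : HasDerivAt G G' t) :
    HasDerivAt (fun h => dens (F h) (G h)) (dens (F t) G' + dens F' (G t)) t :=
  (dens.hasFDerivAt_of_bilinear hF.hasFDerivAt hG.hasFDerivAt).hasDerivAt.congr_deriv (by simp)

/-- Integration by parts in the interaction form, first factor. -/
theorem form_dens_I_left {W w : BoundedContinuousFunction ℝ ℝ} (hW : IsWeightDeriv W w)
    (j l : Fin 2) {R : ℝ} {p : L2x} (hp : Band R p) (Q : L1x) :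
    form j W (dens p (Complex.I • dop R l (dop R l p))) Q =
      -(if l = j then form j w (dens p (Complex.I • dop R l p)) Q else 0) := by
  have h1 := hasDerivAt_trans l hp
  have h2 : HasDerivAt (fun h : ℝ => trans (h • ev l) (Complex.I • dop R l p))
      (-(Complex.I • dop R l (dop R l p))) 0 := by
    have : HasDerivAt (fun h : ℝ => Complex.I • trans (h • ev l) (dop R l p)) _ 0 :=
      (hasDerivAt_trans l (band_dop l hp)).const_smul Complex.I
    simpa only [map_smul, smul_neg] using this
  have h3 := hasDerivAt_dens h1 h2
  -- The form of the jointly translated pair is differentiated at h = 0 in two ways: by the product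
  -- rule, where one term dies by `dens_I_smul`, and by shifting the weight. The latter gives w when
  -- l = j and a constant function otherwise.
  have h4 : HasDerivAt (fun h : ℝ => form j W (dens (trans (h • ev l) p)
      (trans (h • ev l) (Complex.I • dop R l p))) Q) _ 0 :=
    (((form j W).flip Q).hasFDerivAt.comp_hasDerivAt 0 h3)
  simp only [zero_smul, trans_zero, map_neg, dens_I_smul, neg_zero, add_zero,
    neg_apply, ContinuousLinearMap.flip_apply] at h4
  simp only [form_dens_trans_left] at h4
  by_cases hlj : l = j
  · subst hlj
    have h5 := hW.hasDerivAt_form l (dens p (Complex.I • dop R l p)) Q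
    simp only [ev, PiLp.smul_apply, PiLp.single_apply, if_true, smul_eq_mul, mul_one] at h4
    rw [if_pos rfl, ← h4.unique h5, neg_neg]
  · have e : ∀ h : ℝ, (h • ev l : Plane) j = 0 := fun h => by
      simp [ev, Ne.symm hlj]
    simp only [e] at h4
    rw [if_neg hlj, neg_zero, ← neg_eq_zero]
    exact h4.unique (hasDerivAt_const _ _)

/-- Integration by parts in the interaction form, second factor. -/
theorem form_dens_I_right {W w : BoundedContinuousFunction ℝ ℝ} (hW : IsWeightDeriv W w)
    (j l : Fin 2) {R : ℝ} {p : L2x} (hp : Band R p) (P : L1x) :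
    form j W P (dens p (Complex.I • dop R l (dop R l p))) =
      if l = j then form j w P (dens p (Complex.I • dop R l p)) else 0 := by
  have h1 := hasDerivAt_trans l hp
  have h2 : HasDerivAt (fun h : ℝ => trans (h • ev l) (Complex.I • dop R l p))
      (-(Complex.I • dop R l (dop R l p))) 0 := by
    have : HasDerivAt (fun h : ℝ => Complex.I • trans (h • ev l) (dop R l p)) _ 0 :=
      (hasDerivAt_trans l (band_dop l hp)).const_smul Complex.I
    simpa only [map_smul, smul_neg] using this
  have h3 := hasDerivAt_dens h1 h2
  have h4 : HasDerivAt (fun h : ℝ => form j W P (dens (trans (h • ev l) p)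
      (trans (h • ev l) (Complex.I • dop R l p)))) _ 0 :=
    ((form j W P).hasFDerivAt.comp_hasDerivAt 0 h3)
  simp only [zero_smul, trans_zero, map_neg, dens_I_smul, neg_zero, add_zero,
    neg_apply] at h4
  simp only [form_dens_trans_right] at h4
  by_cases hlj : l = j
  · subst hlj
    -- In the second factor the weight is shifted by -h, which is where the sign differs from the
    -- first factor.
    have h5 := (HasDerivAt.comp
      (h₂ := fun h => form l (shift W h) P (dens p (Complex.I • dop R l p)))
      (h := fun h : ℝ => -h) (0 : ℝ)
      (by rw [neg_zero]; exact hW.hasDerivAt_form l P (dens p (Complex.I • dop R l p)))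
      (hasDerivAt_neg _))
    simp only [ev, PiLp.smul_apply, PiLp.single_apply, if_true, smul_eq_mul, mul_one] at h4
    have := h4.unique h5
    rw [if_pos rfl]
    linarith
  · have e : ∀ h : ℝ, (h • ev l : Plane) j = 0 := fun h => by
      simp [ev, Ne.symm hlj]
    simp only [e] at h4
    rw [if_neg hlj, ← neg_eq_zero]
    exact h4.unique (hasDerivAt_const _ _)

/-! ### Primitives of Banach-valued integrable functions -/

section Primitive

variable {E F G : Type*} [NormedAddCommGroup E] [NormedSpace ℝ E]
  [NormedAddCommGroup F] [NormedSpace ℝ F]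
  [NormedAddCommGroup G] [NormedSpace ℝ G]

/-- `f` is a primitive of the integrable function `f'` on `[a, b]`. -/
structure IsPrim (f f' : ℝ → E) (a b : ℝ) : Prop where
  int : IntegrableOn f' (Set.Icc a b)
  eq : ∀ t ∈ Set.Icc a b, f t = f a + ∫ s in a..t, f' s

theorem IsPrim.continuousOn {f f' : ℝ → E} {a b : ℝ} (h : IsPrim f f' a b) :
    ContinuousOn f (Set.Icc a b) :=
  (continuousOn_const.add (intervalIntegral.continuousOn_primitive_Icc h.int)).congr fun t ht => by
    rw [h.eq t ht, intervalIntegral.integral_of_le ht.1, ← integral_Icc_eq_integral_Ioc]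
    rfl

theorem IsPrim.intervalIntegrable {f f' : ℝ → E} {a b t : ℝ} (h : IsPrim f f' a b)
    (ht : t ∈ Set.Icc a b) : IntervalIntegrable f' volume a t :=
  (intervalIntegrable_iff_integrableOn_Icc_of_le ht.1).2
    (h.int.mono_set (Set.Icc_subset_Icc_right ht.2))

theorem IsPrim.clm [CompleteSpace E] [CompleteSpace F] {f f' : ℝ → E} {a b : ℝ}
    (h : IsPrim f f' a b) (L : E →L[ℝ] F) :
    IsPrim (fun t => L (f t)) (fun t => L (f' t)) a b :=
  ⟨L.integrable_comp h.int, fun t ht => by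
    rw [h.eq t ht, map_add, L.intervalIntegral_comp_comm (h.intervalIntegrable ht)]⟩

/-- The left side is a double integral over a square. Cutting it along the diagonal and integrating
each triangle in the suitable order gives the right side, so the product rule needs no pointwise
differentiability. -/
theorem integral_bilin_prod_eq [CompleteSpace G] [CompleteSpace E] [CompleteSpace F]
    (B : E →L[ℝ] F →L[ℝ] G) {f : ℝ → E} {g : ℝ → F} {a t : ℝ}
    (hat : a ≤ t) (hf : IntegrableOn f (Set.Ioc a t)) (hg : IntegrableOn g (Set.Ioc a t)) :
    B (∫ s in a..t, f s) (∫ s in a..t, g s) =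
      ∫ r in a..t, (B (∫ s in a..r, f s) (g r) + B (f r) (∫ s in a..r, g s)) := by
  set μ := (volume : Measure ℝ).restrict (Set.Ioc a t) with hμ
  have hB : ∀ {p : ℝ × ℝ → E} {q : ℝ × ℝ → F}, AEStronglyMeasurable p (μ.prod μ) →
      AEStronglyMeasurable q (μ.prod μ) →
      AEStronglyMeasurable (fun z => B (p z) (q z)) (μ.prod μ) := fun hp hq =>
    B.aestronglyMeasurable_comp₂ hp hq
  have hH : Integrable (fun z : ℝ × ℝ => B (f z.1) (g z.2)) (μ.prod μ) := by
    refine ((hf.norm.mul_prod hg.norm).const_mul ‖B‖).mono'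
      (hB hf.aestronglyMeasurable.comp_fst hg.aestronglyMeasurable.comp_snd)
      (Eventually.of_forall fun z => ?_)
    rw [← mul_assoc]
    exact B.le_opNorm₂ _ _
  have hlt : MeasurableSet {z : ℝ × ℝ | z.1 ≤ z.2} := measurableSet_le measurable_fst measurable_snd
  have e0 : B (∫ s in a..t, f s) (∫ s in a..t, g s) =
      ∫ z, B (f z.1) (g z.2) ∂(μ.prod μ) := by
    rw [intervalIntegral.integral_of_le hat, intervalIntegral.integral_of_le hat,
      integral_prod _ hH]
    have : ∀ s, ∫ r, B (f s) (g r) ∂μ = B (f s) (∫ r, g r ∂μ) := fun s =>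
      (B (f s)).integral_comp_comm hg
    simp only [this]
    exact ((B.flip (∫ r, g r ∂μ)).integral_comp_comm hf).symm
  have h1 : Integrable ({z : ℝ × ℝ | z.1 ≤ z.2}.indicator fun z => B (f z.1) (g z.2))
      (μ.prod μ) := hH.indicator hlt
  have h2 : Integrable ({z : ℝ × ℝ | z.1 ≤ z.2}ᶜ.indicator fun z => B (f z.1) (g z.2))
      (μ.prod μ) := hH.indicator hlt.compl
  have e1 : ∫ z, B (f z.1) (g z.2) ∂(μ.prod μ) =
      (∫ z, {z : ℝ × ℝ | z.1 ≤ z.2}.indicator (fun z => B (f z.1) (g z.2)) z ∂(μ.prod μ)) +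
      ∫ z, {z : ℝ × ℝ | z.1 ≤ z.2}ᶜ.indicator (fun z => B (f z.1) (g z.2)) z ∂(μ.prod μ) := by
    rw [← integral_add h1 h2]
    congr 1
    ext z
    exact (congrFun (Set.indicator_self_add_compl {z : ℝ × ℝ | z.1 ≤ z.2}
      (fun z => B (f z.1) (g z.2))) z).symm
  have e2 : ∀ r ∈ Set.Ioc a t, ∫ s, {z : ℝ × ℝ | z.1 ≤ z.2}.indicator
      (fun z => B (f z.1) (g z.2)) (s, r) ∂μ = B (∫ s in a..r, f s) (g r) := fun r hr => by
    have hfr : IntegrableOn f (Set.Ioc a r) := hf.mono_set (Set.Ioc_subset_Ioc_right hr.2)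
    rw [intervalIntegral.integral_of_le hr.1.le, ← B.flip_apply,
      ← ContinuousLinearMap.integral_comp_comm _ hfr]
    have : ∀ s, {z : ℝ × ℝ | z.1 ≤ z.2}.indicator (fun z => B (f z.1) (g z.2)) (s, r) =
        (Set.Iic r).indicator (fun s => B.flip (g r) (f s)) s := fun s => by
      simp only [Set.indicator, Set.mem_ofPred_eq, Set.mem_Iic, ContinuousLinearMap.flip_apply]
    simp only [this]
    rw [integral_indicator measurableSet_Iic, hμ, Measure.restrict_restrict measurableSet_Iic,
      Set.inter_comm, Set.Ioc_inter_Iic, inf_eq_right.2 hr.2]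
  -- The complementary triangle is strict, so the inner integral runs over an open interval; its
  -- endpoint is null.
  have e3 : ∀ s ∈ Set.Ioc a t, ∫ r, {z : ℝ × ℝ | z.1 ≤ z.2}ᶜ.indicator
      (fun z => B (f z.1) (g z.2)) (s, r) ∂μ = B (f s) (∫ r in a..s, g r) := fun s hs => by
    have hgs : IntegrableOn g (Set.Ioc a s) := hg.mono_set (Set.Ioc_subset_Ioc_right hs.2)
    rw [intervalIntegral.integral_of_le hs.1.le,
      ← ContinuousLinearMap.integral_comp_comm _ hgs]
    have : ∀ r, {z : ℝ × ℝ | z.1 ≤ z.2}ᶜ.indicator (fun z => B (f z.1) (g z.2)) (s, r) =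
        (Set.Iio s).indicator (fun r => B (f s) (g r)) r := fun r => by
      simp only [Set.indicator, Set.mem_compl_iff, Set.mem_ofPred_eq, Set.mem_Iio, not_le]
    simp only [this]
    rw [integral_indicator measurableSet_Iio, hμ, Measure.restrict_restrict measurableSet_Iio,
      integral_Ioc_eq_integral_Ioo]
    congr 2
    ext r
    simp only [Set.mem_inter_iff, Set.mem_Iio, Set.mem_Ioc, Set.mem_Ioo]
    exact ⟨fun h => ⟨h.2.1, h.1⟩, fun h => ⟨h.2, h.1, h.2.le.trans hs.2⟩⟩
  have i1 := h1.integral_prod_right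
  have i2 := h2.integral_prod_left
  rw [e0, e1, integral_prod_symm _ h1, integral_prod _ h2, ← integral_add i1 i2,
    intervalIntegral.integral_of_le hat]
  refine setIntegral_congr_fun measurableSet_Ioc fun r hr => ?_
  simp only [e2 r hr, e3 r hr]

/-- The product rule for primitives: `integral_bilin_prod_eq` is applied to f - f(a) and g - g(a),
and the boundary terms are put back. -/
theorem IsPrim.bilin [CompleteSpace G] [CompleteSpace E] [CompleteSpace F]
    {f f' : ℝ → E} {g g' : ℝ → F} {a b : ℝ} (hf : IsPrim f f' a b)
    (hg : IsPrim g g' a b) (B : E →L[ℝ] F →L[ℝ] G) :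
    IsPrim (fun t => B (f t) (g t)) (fun t => B (f t) (g' t) + B (f' t) (g t)) a b := by
  have hcpt : IsCompact (Set.Icc a b) := isCompact_Icc
  have i1 : IntegrableOn (fun t => B (f t) (g' t)) (Set.Icc a b) := by
    obtain ⟨C, hC⟩ := hcpt.exists_bound_of_continuousOn hf.continuousOn
    exact B.integrable_of_bilin_of_bdd_left C
      (hf.continuousOn.aestronglyMeasurable measurableSet_Icc)
      ((ae_restrict_iff' measurableSet_Icc).2 (Eventually.of_forall hC)) hg.int
  have i2 : IntegrableOn (fun t => B (f' t) (g t)) (Set.Icc a b) := by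
    obtain ⟨C, hC⟩ := hcpt.exists_bound_of_continuousOn hg.continuousOn
    exact B.integrable_of_bilin_of_bdd_right C hf.int
      (hg.continuousOn.aestronglyMeasurable measurableSet_Icc)
      ((ae_restrict_iff' measurableSet_Icc).2 (Eventually.of_forall hC))
  have i12 : IntegrableOn (fun t => B (f t) (g' t) + B (f' t) (g t)) (Set.Icc a b) := i1.add i2
  refine ⟨i12, fun t ht => ?_⟩
  have hsub : Set.Ioc a t ⊆ Set.Icc a b :=
    Set.Ioc_subset_Icc_self.trans (Set.Icc_subset_Icc_right ht.2)
  have key := integral_bilin_prod_eq B ht.1 (hf.int.mono_set hsub) (hg.int.mono_set hsub)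
  have e : ∫ r in a..t, (B (∫ s in a..r, f' s) (g' r) + B (f' r) (∫ s in a..r, g' s)) =
      ∫ r in a..t, ((B (f r) (g' r) + B (f' r) (g r)) -
        (B (f a) (g' r) + B.flip (g a) (f' r))) := by
    refine intervalIntegral.integral_congr fun r hr => ?_
    rw [Set.uIcc_of_le ht.1] at hr
    have hr' : r ∈ Set.Icc a b := ⟨hr.1, hr.2.trans ht.2⟩
    simp only [hf.eq r hr', hg.eq r hr', map_add, add_apply,
      ContinuousLinearMap.flip_apply]
    abel
  have hIcc : ∀ {H : ℝ → G}, IntegrableOn H (Set.Icc a b) → IntervalIntegrable H volume a t :=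
    fun h => (intervalIntegrable_iff_integrableOn_Icc_of_le ht.1).2
      (h.mono_set (Set.Icc_subset_Icc_right ht.2))
  have j1 : IntervalIntegrable (fun r => B (f a) (g' r)) volume a t :=
    hIcc ((B (f a)).integrable_comp hg.int)
  have j2 : IntervalIntegrable (fun r => B.flip (g a) (f' r)) volume a t :=
    hIcc ((B.flip (g a)).integrable_comp hf.int)
  rw [e, intervalIntegral.integral_sub (hIcc i12) (j1.add j2),
    intervalIntegral.integral_add j1 j2,
    (B (f a)).intervalIntegral_comp_comm (hg.intervalIntegrable ht),
    (B.flip (g a)).intervalIntegral_comp_comm (hf.intervalIntegrable ht),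
    ContinuousLinearMap.flip_apply] at key
  simp only [hf.eq t ht, hg.eq t ht, map_add, add_apply] at *
  rw [key]
  abel

end Primitive

/-! ### The bilinear virial identity -/

theorem norm_mop_le {m : Plane → ℂ} (hm : MemLp m ∞ (volume : Measure Plane)) {C : ℝ}
    (hC : ∀ ξ, ‖m ξ‖ ≤ C) (f : L2x) : ‖mop m hm f‖ ≤ C * ‖f‖ := by
  rw [← Lp.norm_fourier_eq (mop m hm f), ← Lp.norm_fourier_eq f]
  refine Lp.norm_le_mul_norm_of_ae_le_mul ?_
  filter_upwards [fourier_mop m hm f] with ξ h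
  rw [h, norm_mul]
  exact mul_le_mul_of_nonneg_right (hC ξ) (norm_nonneg _)

theorem norm_eop_le (R : ℝ) (l : Fin 2) (τ : ℝ) (f : L2x) :
    ‖eop R l τ f‖ ≤ Real.exp (|τ| * (2 * Real.pi * |R|)) * ‖f‖ :=
  norm_mop_le _ (norm_expSymbol_le R l τ) f

/-- The operator `μ_l ∂_l²` on band-limited functions. -/
def schr (R : ℝ) : L2x →L[ℂ] L2x := ∑ l : Fin 2, (uhSign l : ℂ) • (dop R l ∘L dop R l)

theorem schr_apply (R : ℝ) (f : L2x) :
    schr R f = ∑ l : Fin 2, uhSign l • dop R l (dop R l f) := by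
  simp only [schr, sum_apply, smul_apply, ContinuousLinearMap.comp_apply]
  rfl

theorem dop_op (R : ℝ) (l : Fin 2) (A : TransMean) (f : L2x) :
    dop R l (A.op f) = A.op (dop R l f) := mop_op _ _ A f

theorem schr_op (R : ℝ) (A : TransMean) (f : L2x) : schr R (A.op f) = A.op (schr R f) := by
  simp only [schr, sum_apply, smul_apply, ContinuousLinearMap.comp_apply, dop_op, map_sum,
    map_smul]

theorem schr_trans (R : ℝ) (z : Plane) (f : L2x) : schr R (trans z f) = trans z (schr R f) := by
  simp only [schr, sum_apply, smul_apply, ContinuousLinearMap.comp_apply, dop, mop_trans, map_sum,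
    map_smul]

/-- Only the second derivative in the direction j survives, since W does not vary in the other
direction; its sign μ_j comes out as a factor. -/
theorem form_schr_left {W w : BoundedContinuousFunction ℝ ℝ} (hW : IsWeightDeriv W w)
    (j : Fin 2) {R : ℝ} {p : L2x} (hp : Band R p) (Q : L1x) :
    form j W (dens p (Complex.I • schr R p)) Q =
      -(uhSign j * form j w (dens p (Complex.I • dop R j p)) Q) := by
  have e : Complex.I • schr R p =
      ∑ l : Fin 2, uhSign l • (Complex.I • dop R l (dop R l p)) := by
    rw [schr_apply, Finset.smul_sum]
    exact Finset.sum_congr rfl fun l _ => smul_comm _ _ _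
  rw [e, map_sum, map_sum, sum_apply]
  simp only [map_smul, smul_apply, form_dens_I_left hW j _ hp Q, smul_eq_mul]
  fin_cases j <;> simp

theorem form_schr_right {W w : BoundedContinuousFunction ℝ ℝ} (hW : IsWeightDeriv W w)
    (j : Fin 2) {R : ℝ} {p : L2x} (hp : Band R p) (P : L1x) :
    form j W P (dens p (Complex.I • schr R p)) =
      uhSign j * form j w P (dens p (Complex.I • dop R j p)) := by
  have e : Complex.I • schr R p =
      ∑ l : Fin 2, uhSign l • (Complex.I • dop R l (dop R l p)) := by
    rw [schr_apply, Finset.smul_sum]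
    exact Finset.sum_congr rfl fun l _ => smul_comm _ _ _
  rw [e, map_sum, map_sum]
  simp only [map_smul, form_dens_I_right hW j _ hp P, smul_eq_mul]
  fin_cases j <;> simp

theorem continuousOn_dens {f g : ℝ → L2x} {s : Set ℝ} (hf : ContinuousOn f s)
    (hg : ContinuousOn g s) : ContinuousOn (fun t => dens (f t) (g t)) s :=
  dens.isBoundedBilinearMap.continuous.comp_continuousOn (hf.prodMk hg)

theorem continuousOn_form {j : Fin 2} {W : BoundedContinuousFunction ℝ ℝ} {P Q : ℝ → L1x}
    {s : Set ℝ} (hP : ContinuousOn P s) (hQ : ContinuousOn Q s) :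
    ContinuousOn (fun t => form j W (P t) (Q t)) s :=
  (form j W).isBoundedBilinearMap.continuous.comp_continuousOn (hP.prodMk hQ)

/-- The interaction density of the analytic continuations of two functions. -/
def contForm (R : ℝ) (j : Fin 2) (θ : ℝ) (w : BoundedContinuousFunction ℝ ℝ) (f g : L2x)
    (τ : ℝ) : ℝ :=
  form j w (dens (eop R j (-θ * τ) f) (eop R j (-θ * τ) f))
    (dens (eop R j (θ * τ) g) (eop R j (θ * τ) g))

/-- The derivative of `contForm` in the continuation parameter. -/
def contFormDeriv (R : ℝ) (j : Fin 2) (θ : ℝ) (w : BoundedContinuousFunction ℝ ℝ) (f g : L2x)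
    (τ : ℝ) : ℝ :=
  2 * θ * (form j w (dens (eop R j (-θ * τ) f) (Complex.I • dop R j (eop R j (-θ * τ) f)))
      (dens (eop R j (θ * τ) g) (eop R j (θ * τ) g)) -
    form j w (dens (eop R j (-θ * τ) f) (eop R j (-θ * τ) f))
      (dens (eop R j (θ * τ) g) (Complex.I • dop R j (eop R j (θ * τ) g))))

theorem hasDerivAt_eop_mul (R : ℝ) (j : Fin 2) (θ τ : ℝ) (f : L2x) :
    HasDerivAt (fun τ => eop R j (θ * τ) f) (-θ • (Complex.I • dop R j (eop R j (θ * τ) f))) τ := by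
  have h := HasDerivAt.scomp τ (hasDerivAt_eop R j (θ * τ) f) ((hasDerivAt_id τ).const_mul θ)
  refine h.congr_deriv ?_
  rw [mul_one, smul_neg, neg_smul]

/-- Differentiating in the imaginary direction turns mass densities into momentum densities. The
result is exactly the quantity that the virial identity controls; the factor 2 comes from the
symmetry of `dens`. -/
theorem hasDerivAt_contForm (R : ℝ) (j : Fin 2) (θ : ℝ) (w : BoundedContinuousFunction ℝ ℝ)
    (f g : L2x) (τ : ℝ) :
    HasDerivAt (contForm R j θ w f g) (contFormDeriv R j θ w f g τ) τ := by
  have hf := hasDerivAt_eop_mul R j (-θ) τ f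
  have hg := hasDerivAt_eop_mul R j θ τ g
  have h := ((form j w).hasFDerivAt_of_bilinear (hasDerivAt_dens hf hf).hasFDerivAt
    (hasDerivAt_dens hg hg).hasFDerivAt).hasDerivAt
  refine h.congr_deriv ?_
  rw [dens_comm (_ • _) (eop R j (-θ * τ) f), dens_comm (_ • _) (eop R j (θ * τ) g)]
  simp [contFormDeriv]
  ring

/-- A crude bound that depends on the band limit R. It only justifies differentiation under the time
integral and leaves no trace in the final constant. -/
theorem abs_contFormDeriv_le (R : ℝ) (j : Fin 2) {θ : ℝ} (hθ : |θ| = 1)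
    (w : BoundedContinuousFunction ℝ ℝ) {f g : L2x} {A B T τ : ℝ} (hf : ‖f‖ ≤ A) (hg : ‖g‖ ≤ B)
    (hτ : |τ| ≤ T) :
    |contFormDeriv R j θ w f g τ| ≤
      4 * ‖w‖ * ‖dop R j‖ * Real.exp (T * (2 * Real.pi * |R|)) ^ 4 * A ^ 2 * B ^ 2 := by
  have hA : 0 ≤ A := (norm_nonneg f).trans hf
  have hB : 0 ≤ B := (norm_nonneg g).trans hg
  set e := Real.exp (T * (2 * Real.pi * |R|)) with he
  have key : ∀ {s : ℝ} {h : L2x} {D : ℝ}, |s| = 1 → ‖h‖ ≤ D → 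
      ‖eop R j (s * τ) h‖ ≤ e * D := fun {s h D} hs hD => by
    refine (norm_eop_le R j _ h).trans (mul_le_mul ?_ hD (norm_nonneg _) (Real.exp_pos _).le)
    rw [he, Real.exp_le_exp, abs_mul, hs, one_mul]
    gcongr
  have hu := key (s := -θ) (by rwa [abs_neg]) hf
  have hv := key (s := θ) hθ hg
  set u := eop R j (-θ * τ) f
  set v := eop R j (θ * τ) g
  have hd : ∀ {x : L2x} {D : ℝ}, ‖x‖ ≤ D → ‖dens x x‖ ≤ D * D := fun {x D} hx =>
    (norm_dens_le x x).trans (mul_le_mul hx hx (norm_nonneg _) ((norm_nonneg _).trans hx))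
  have hd' : ∀ {x : L2x} {D : ℝ}, ‖x‖ ≤ D →
      ‖dens x (Complex.I • dop R j x)‖ ≤ D * (‖dop R j‖ * D) := fun {x D} hx => by
    have hD : 0 ≤ D := (norm_nonneg _).trans hx
    refine (norm_dens_le x _).trans (mul_le_mul hx ?_ (norm_nonneg _) hD)
    rw [norm_smul, Complex.norm_I, one_mul]
    exact ((dop R j).le_opNorm x).trans (mul_le_mul_of_nonneg_left hx (norm_nonneg _))
  have h1 : |form j w (dens u (Complex.I • dop R j u)) (dens v v)| ≤
      ‖w‖ * (e * A * (‖dop R j‖ * (e * A))) * (e * B * (e * B)) := by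
    refine (abs_form_le j w _ _).trans ?_
    gcongr
    · exact hd' hu
    · exact hd hv
  have h2 : |form j w (dens u u) (dens v (Complex.I • dop R j v))| ≤
      ‖w‖ * (e * A * (e * A)) * (e * B * (‖dop R j‖ * (e * B))) := by
    refine (abs_form_le j w _ _).trans ?_
    gcongr
    · exact hd hu
    · exact hd' hv
  rw [contFormDeriv, abs_mul, abs_mul, hθ, mul_one, abs_two]
  refine (mul_le_mul_of_nonneg_left ((abs_sub _ _).trans (add_le_add h1 h2)) zero_le_two).trans
    (le_of_eq ?_)
  ring

theorem continuousOn_contForm {R : ℝ} {j : Fin 2} {θ : ℝ} {w : BoundedContinuousFunction ℝ ℝ}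
    {f g : ℝ → L2x} {s : Set ℝ} (hf : ContinuousOn f s) (hg : ContinuousOn g s) (τ : ℝ) :
    ContinuousOn (fun t => contForm R j θ w (f t) (g t) τ) s := by
  have h1 : ContinuousOn (fun t => eop R j (-θ * τ) (f t)) s :=
    (eop R j (-θ * τ)).continuous.comp_continuousOn hf
  have h2 : ContinuousOn (fun t => eop R j (θ * τ) (g t)) s :=
    (eop R j (θ * τ)).continuous.comp_continuousOn hg
  exact continuousOn_form (continuousOn_dens h1 h1) (continuousOn_dens h2 h2)

theorem continuousOn_contFormDeriv {R : ℝ} {j : Fin 2} {θ : ℝ}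
    {w : BoundedContinuousFunction ℝ ℝ} {f g : ℝ → L2x} {s : Set ℝ} (hf : ContinuousOn f s)
    (hg : ContinuousOn g s) (τ : ℝ) :
    ContinuousOn (fun t => contFormDeriv R j θ w (f t) (g t) τ) s := by
  have h1 : ContinuousOn (fun t => eop R j (-θ * τ) (f t)) s :=
    (eop R j (-θ * τ)).continuous.comp_continuousOn hf
  have h2 : ContinuousOn (fun t => eop R j (θ * τ) (g t)) s :=
    (eop R j (θ * τ)).continuous.comp_continuousOn hg
  have h1' : ContinuousOn (fun t => Complex.I • dop R j (eop R j (-θ * τ) (f t))) s :=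
    (continuous_const_smul Complex.I).comp_continuousOn ((dop R j).continuous.comp_continuousOn h1)
  have h2' : ContinuousOn (fun t => Complex.I • dop R j (eop R j (θ * τ) (g t))) s :=
    (continuous_const_smul Complex.I).comp_continuousOn ((dop R j).continuous.comp_continuousOn h2)
  exact continuousOn_const.mul ((continuousOn_form (continuousOn_dens h1 h1')
    (continuousOn_dens h2 h2)).sub (continuousOn_form (continuousOn_dens h1 h1)
    (continuousOn_dens h2 h2')))

theorem hasDerivAt_integral_contForm (R : ℝ) (j : Fin 2) {θ : ℝ} (hθ : |θ| = 1)
    (w : BoundedContinuousFunction ℝ ℝ) {f g : ℝ → L2x} {a b A B : ℝ} (hab : a ≤ b)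
    (hf : ContinuousOn f (Set.Icc a b)) (hg : ContinuousOn g (Set.Icc a b))
    (hA : ∀ t ∈ Set.Icc a b, ‖f t‖ ≤ A) (hB : ∀ t ∈ Set.Icc a b, ‖g t‖ ≤ B) (τ : ℝ) :
    HasDerivAt (fun τ => ∫ t in a..b, contForm R j θ w (f t) (g t) τ)
      (∫ t in a..b, contFormDeriv R j θ w (f t) (g t) τ) τ := by
  have huI : Set.uIoc a b ⊆ Set.Icc a b := by
    rw [Set.uIoc_of_le hab]; exact Set.Ioc_subset_Icc_self
  have hm : ∀ {h : ℝ → ℝ}, ContinuousOn h (Set.Icc a b) →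
      AEStronglyMeasurable h (volume.restrict (Set.uIoc a b)) := fun h =>
    (h.mono huI).aestronglyMeasurable measurableSet_uIoc
  refine (intervalIntegral.hasDerivAt_integral_of_dominated_loc_of_deriv_le
    (s := Metric.ball τ 1) (F' := fun τ t => contFormDeriv R j θ w (f t) (g t) τ)
    (bound := fun _ => 4 * ‖w‖ * ‖dop R j‖ * Real.exp ((|τ| + 1) * (2 * Real.pi * |R|)) ^ 4 *
      A ^ 2 * B ^ 2) (Metric.ball_mem_nhds τ one_pos)
    (Eventually.of_forall fun x => hm (continuousOn_contForm hf hg x)) ?_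
    (hm (continuousOn_contFormDeriv hf hg τ)) ?_ (intervalIntegrable_const) ?_).2
  · refine ContinuousOn.intervalIntegrable ?_
    rw [Set.uIcc_of_le hab]
    exact continuousOn_contForm hf hg τ
  · refine Eventually.of_forall fun t ht x hx => ?_
    refine abs_contFormDeriv_le R j hθ w (hA t (huI ht)) (hB t (huI ht)) ?_
    rw [Metric.mem_ball, Real.dist_eq] at hx
    have := abs_sub_abs_le_abs_sub x τ
    linarith
  · exact Eventually.of_forall fun t _ x _ => hasDerivAt_contForm R j θ w (f t) (g t) x

/-! ### The interaction estimate for separated frequencies -/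

/-- A solution of `(i∂_t + μ_l ∂_l²) f = N` on `[a, b]` with frequencies in the ball of radius `R`,
together with bounds for its mass and its self-interaction. -/
structure BandSolution (R a b : ℝ) (f N : ℝ → L2x) (A X : ℝ) : Prop where
  prim : IsPrim f (fun t => Complex.I • (schr R (f t) - N t)) a b
  forcing : IntegrableOn N (Set.Icc a b)
  band : ∀ t ∈ Set.Icc a b, Band R (f t)
  norm_le : ∀ t ∈ Set.Icc a b, ‖f t‖ ≤ A
  nonneg : 0 ≤ X
  pair_le : supPair (volume.restrict (Set.Icc a b)) f N ≤ ENNReal.ofReal X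

namespace BandSolution

variable {R a b : ℝ} {f N : ℝ → L2x} {A X : ℝ}

theorem aestronglyMeasurable (h : BandSolution R a b f N A X) :
    AEStronglyMeasurable f (volume.restrict (Set.Icc a b)) :=
  h.prim.continuousOn.aestronglyMeasurable measurableSet_Icc

/-- Averages of translations commute with the equation, so they map solutions to solutions. The two
quantitative bounds scale by the mass and its square. -/
theorem op (h : BandSolution R a b f N A X) (U : TransMean) :
    BandSolution R a b (fun t => U.op (f t)) (fun t => U.op (N t)) (U.mass * A)
      (U.mass ^ 2 * X) where
  prim := by
    have := h.prim.clm (U.op.restrictScalars ℝ)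
    simp only [ContinuousLinearMap.coe_restrictScalars', map_smul, map_sub] at this
    simpa only [schr_op] using this
  forcing := U.op.integrable_comp h.forcing
  band t ht := U.band_op (h.band t ht)
  norm_le t ht := (U.norm_op_le _).trans
    (mul_le_mul_of_nonneg_left (h.norm_le t ht) U.mass_nonneg)
  nonneg := mul_nonneg (sq_nonneg _) h.nonneg
  pair_le := by
    rw [ENNReal.ofReal_mul (sq_nonneg _), ENNReal.ofReal_pow U.mass_nonneg]
    exact (U.supPair_op_op h.aestronglyMeasurable h.forcing.aestronglyMeasurable).trans
      (mul_le_mul_right h.pair_le _)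

theorem norm_dens_le (h : BandSolution R a b f N A X) {t : ℝ} (ht : t ∈ Set.Icc a b) :
    ‖dens (f t) (f t)‖ ≤ A ^ 2 := by
  refine (UH.norm_dens_le _ _).trans ?_
  rw [← pow_two]
  exact pow_le_pow_left₀ (norm_nonneg _) (h.norm_le t ht) 2

theorem dens_forcing (h : BandSolution R a b f N A X) :
    IntegrableOn (fun t => dens (f t) (Complex.I • N t)) (Set.Icc a b) ∧
      ∫ t in Set.Icc a b, ‖dens (f t) (Complex.I • N t)‖ ≤ X := by
  obtain ⟨C, hC⟩ := isCompact_Icc.exists_bound_of_continuousOn h.prim.continuousOn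
  have hN : IntegrableOn (fun t => Complex.I • N t) (Set.Icc a b) := h.forcing.smul Complex.I
  have hi : IntegrableOn (fun t => dens (f t) (Complex.I • N t)) (Set.Icc a b) :=
    dens.integrable_of_bilin_of_bdd_left C h.aestronglyMeasurable
      ((ae_restrict_iff' measurableSet_Icc).2 (Eventually.of_forall hC)) hN
  refine ⟨hi, ?_⟩
  rw [← ENNReal.ofReal_le_ofReal_iff h.nonneg, ofReal_integral_norm_eq_lintegral_enorm hi]
  -- Only the shift y = 0 is used here. The other shifts are needed because this is later applied to
  -- averages of translates of the original solution.
  refine le_trans (lintegral_mono fun t => ?_)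
    ((le_iSup (fun y => ∫⁻ t in Set.Icc a b, pairL1 (trans y (f t)) (N t)) 0).trans h.pair_le)
  refine (enorm_dens_le _ _).trans (le_of_eq ?_)
  have hI : ‖Complex.I‖ₑ = 1 := by rw [← ofReal_norm, Complex.norm_I, ENNReal.ofReal_one]
  rw [trans_zero, pairL1_eq, pairL1_eq, map_smul, enorm_smul, hI, one_mul]

theorem dens_virial (p s n : L2x) :
    dens p (Complex.I • (s - n)) + dens (Complex.I • (s - n)) p =
      (2 : ℝ) • (dens p (Complex.I • s) - dens p (Complex.I • n)) := by
  rw [dens_comm _ p, ← two_smul ℝ, smul_sub Complex.I, map_sub]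

/-- The primitive of the quadratic density. -/
theorem prim_dens (h : BandSolution R a b f N A X) :
    IsPrim (fun t => dens (f t) (f t))
      (fun t => (2 : ℝ) • (dens (f t) (Complex.I • schr R (f t)) -
        dens (f t) (Complex.I • N t))) a b := by
  have := h.prim.bilin h.prim dens
  refine ⟨this.int.congr_fun (fun t _ => ?_) measurableSet_Icc, fun t ht => ?_⟩
  · exact dens_virial _ _ _
  · rw [this.eq t ht]
    congr 1
    exact intervalIntegral.integral_congr fun s _ => dens_virial _ _ _

/-- With W bounded by its sup norm the double integral decouples into the mass of p and the L¹ norm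
of q times its forcing. -/
theorem form_forcing_right {p N q M : ℝ → L2x} {B Y : ℝ}
    (hp : BandSolution R a b p N A X) (hq : BandSolution R a b q M B Y)
    (W : BoundedContinuousFunction ℝ ℝ) (j : Fin 2) :
    IntegrableOn (fun t => form j W (dens (p t) (p t)) (dens (q t) (Complex.I • M t)))
      (Set.Icc a b) ∧
    |∫ t in Set.Icc a b, form j W (dens (p t) (p t)) (dens (q t) (Complex.I • M t))| ≤
      ‖W‖ * A ^ 2 * Y := by
  obtain ⟨hMi, hM⟩ := hq.dens_forcing
  have hpc := hp.prim.continuousOn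
  have b1 : ∀ t ∈ Set.Icc a b, ‖form j W (dens (p t) (p t)) (dens (q t) (Complex.I • M t))‖ ≤
      ‖W‖ * A ^ 2 * ‖dens (q t) (Complex.I • M t)‖ := fun t ht =>
    (abs_form_le j W _ _).trans (mul_le_mul_of_nonneg_right
      (mul_le_mul_of_nonneg_left (hp.norm_dens_le ht) (norm_nonneg _)) (norm_nonneg _))
  have b2 := (ae_restrict_iff' (μ := volume) measurableSet_Icc).2 (Eventually.of_forall b1)
  refine ⟨(hMi.norm.const_mul _).mono' ((form j W).aestronglyMeasurable_comp₂
      ((continuousOn_dens hpc hpc).aestronglyMeasurable measurableSet_Icc)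
      hMi.aestronglyMeasurable) b2, ?_⟩
  refine (norm_integral_le_of_norm_le (hMi.norm.const_mul (‖W‖ * A ^ 2)) b2).trans ?_
  rw [integral_const_mul]
  exact mul_le_mul_of_nonneg_left hM (mul_nonneg (norm_nonneg _) (sq_nonneg _))

theorem form_forcing_left {p N q M : ℝ → L2x} {B Y : ℝ}
    (hp : BandSolution R a b p N A X) (hq : BandSolution R a b q M B Y)
    (W : BoundedContinuousFunction ℝ ℝ) (j : Fin 2) :
    IntegrableOn (fun t => form j W (dens (p t) (Complex.I • N t)) (dens (q t) (q t)))
      (Set.Icc a b) ∧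
    |∫ t in Set.Icc a b, form j W (dens (p t) (Complex.I • N t)) (dens (q t) (q t))| ≤
      ‖W‖ * B ^ 2 * X := by
  obtain ⟨hNi, hN⟩ := hp.dens_forcing
  have hqc := hq.prim.continuousOn
  have b1 : ∀ t ∈ Set.Icc a b, ‖form j W (dens (p t) (Complex.I • N t)) (dens (q t) (q t))‖ ≤
      ‖W‖ * B ^ 2 * ‖dens (p t) (Complex.I • N t)‖ := fun t ht => by
    refine (abs_form_le j W _ _).trans ?_
    rw [mul_right_comm]
    exact mul_le_mul_of_nonneg_right
      (mul_le_mul_of_nonneg_left (hq.norm_dens_le ht) (norm_nonneg _)) (norm_nonneg _)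
  have b2 := (ae_restrict_iff' (μ := volume) measurableSet_Icc).2 (Eventually.of_forall b1)
  refine ⟨(hNi.norm.const_mul _).mono' ((form j W).aestronglyMeasurable_comp₂
      hNi.aestronglyMeasurable
      ((continuousOn_dens hqc hqc).aestronglyMeasurable measurableSet_Icc)) b2, ?_⟩
  refine (norm_integral_le_of_norm_le (hNi.norm.const_mul (‖W‖ * B ^ 2)) b2).trans ?_
  rw [integral_const_mul]
  exact mul_le_mul_of_nonneg_left hN (mul_nonneg (norm_nonneg _) (sq_nonneg _))

end BandSolution

/-! ### Virial balance and decay in the continuation parameter -/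

theorem abs_uhSign (j : Fin 2) : |uhSign j| = 1 := by
  fin_cases j <;> simp [uhSign]

theorem form_two_sub_add (j : Fin 2) (W : BoundedContinuousFunction ℝ ℝ)
    (P Q Ps Pn Qs Qm : L1x) :
    form j W P ((2 : ℝ) • (Qs - Qm)) + form j W ((2 : ℝ) • (Ps - Pn)) Q =
      2 * form j W P Qs + 2 * form j W Ps Q - (2 * form j W P Qm + 2 * form j W Pn Q) := by
  rw [map_smul, map_sub, map_smul (form j W) 2 (Ps - Pn), map_sub (form j W) Ps Pn, smul_apply,
    sub_apply, smul_eq_mul, smul_eq_mul]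
  ring

/-- The integrand of the time derivative of the interaction. Both dispersive terms carry the same
sign μ_j, so they combine into a difference of momenta and the signature disappears once absolute
values are taken. -/
theorem form_virial {W w : BoundedContinuousFunction ℝ ℝ} (hW : IsWeightDeriv W w) (j : Fin 2)
    {R : ℝ} {p q : L2x} (hp : Band R p) (hq : Band R q) (n m : L2x) :
    form j W (dens p p) ((2 : ℝ) • (dens q (Complex.I • schr R q) - dens q (Complex.I • m))) +
      form j W ((2 : ℝ) • (dens p (Complex.I • schr R p) - dens p (Complex.I • n))) (dens q q) =
    -uhSign j * (2 * (form j w (dens p (Complex.I • dop R j p)) (dens q q) -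
        form j w (dens p p) (dens q (Complex.I • dop R j q)))) -
      (2 * form j W (dens p p) (dens q (Complex.I • m)) +
        2 * form j W (dens p (Complex.I • n)) (dens q q)) := by
  have e1 := form_schr_left hW j hp (dens q q)
  have e2 := form_schr_right hW j hq (dens p p)
  refine (form_two_sub_add j W _ _ _ _ _ _).trans ?_
  linear_combination 2 * e1 + 2 * e2

theorem abs_integral_le_of_balance {F D m e₁ e₂ : ℝ → ℝ} {a b μ C C₁ C₂ : ℝ} (hab : a ≤ b)
    (hF : F b = F a + ∫ t in a..b, D t) (hμ : |μ| = 1)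
    (hD : ∀ t ∈ Set.Icc a b, D t = -μ * m t - (2 * e₁ t + 2 * e₂ t))
    (hm : ContinuousOn m (Set.Icc a b)) (h₁ : IntegrableOn e₁ (Set.Icc a b))
    (h₂ : IntegrableOn e₂ (Set.Icc a b)) (hFa : |F a| ≤ C) (hFb : |F b| ≤ C)
    (hC₁ : |∫ t in Set.Icc a b, e₁ t| ≤ C₁) (hC₂ : |∫ t in Set.Icc a b, e₂ t| ≤ C₂) :
    |∫ t in a..b, m t| ≤ 2 * C + 2 * C₁ + 2 * C₂ := by
  have hii : ∀ {H : ℝ → ℝ}, IntegrableOn H (Set.Icc a b) → IntervalIntegrable H volume a b :=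
    fun h => (intervalIntegrable_iff_integrableOn_Icc_of_le hab).2 h
  have e : ∫ t in a..b, D t = ∫ t in a..b, (-μ * m t - (2 * e₁ t + 2 * e₂ t)) :=
    intervalIntegral.integral_congr fun t ht => hD t (Set.uIcc_of_le hab ▸ ht)
  rw [e, intervalIntegral.integral_sub ((hii hm.integrableOn_Icc).const_mul _)
    (((hii h₁).const_mul 2).add ((hii h₂).const_mul 2)),
    intervalIntegral.integral_add ((hii h₁).const_mul 2) ((hii h₂).const_mul 2),
    intervalIntegral.integral_const_mul, intervalIntegral.integral_const_mul,
    intervalIntegral.integral_const_mul] at hF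
  rw [integral_Icc_eq_integral_Ioc, ← intervalIntegral.integral_of_le hab] at hC₁ hC₂
  have hs : |∫ t in a..b, m t| = |μ * ∫ t in a..b, m t| := by rw [abs_mul, hμ, one_mul]
  rw [hs]
  rw [abs_le] at *
  constructor <;> linarith

/-- The interaction at the two endpoints costs the masses, and the forcing costs X and Y. No
positivity of the momentum difference is claimed or needed, only its size. -/
theorem abs_integral_virial_le {R a b A B X Y : ℝ} (hab : a ≤ b) {p N q M : ℝ → L2x}
    (hp : BandSolution R a b p N A X) (hq : BandSolution R a b q M B Y)
    {W w : BoundedContinuousFunction ℝ ℝ} (hW : IsWeightDeriv W w) (j : Fin 2) :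
    |∫ t in a..b, 2 * (form j w (dens (p t) (Complex.I • dop R j (p t))) (dens (q t) (q t)) -
      form j w (dens (p t) (p t)) (dens (q t) (Complex.I • dop R j (q t))))| ≤
      2 * ‖W‖ * (A ^ 2 * B ^ 2 + X * B ^ 2 + A ^ 2 * Y) := by
  have ha : a ∈ Set.Icc a b := Set.left_mem_Icc.2 hab
  have hb : b ∈ Set.Icc a b := Set.right_mem_Icc.2 hab
  have h := hp.prim_dens.bilin hq.prim_dens (form j W)
  have hpc := hp.prim.continuousOn
  have hqc := hq.prim.continuousOn
  obtain ⟨i1, n1⟩ := hp.form_forcing_right hq W j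
  obtain ⟨i2, n2⟩ := hp.form_forcing_left hq W j
  have hpI : ContinuousOn (fun t => Complex.I • dop R j (p t)) (Set.Icc a b) :=
    (continuous_const_smul Complex.I).comp_continuousOn ((dop R j).continuous.comp_continuousOn hpc)
  have hqI : ContinuousOn (fun t => Complex.I • dop R j (q t)) (Set.Icc a b) :=
    (continuous_const_smul Complex.I).comp_continuousOn ((dop R j).continuous.comp_continuousOn hqc)
  have hmc : ContinuousOn (fun t => 2 * (form j w (dens (p t) (Complex.I • dop R j (p t)))
      (dens (q t) (q t)) -
      form j w (dens (p t) (p t)) (dens (q t) (Complex.I • dop R j (q t))))) (Set.Icc a b) :=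
    continuousOn_const.mul ((continuousOn_form (continuousOn_dens hpc hpI)
      (continuousOn_dens hqc hqc)).sub (continuousOn_form (continuousOn_dens hpc hpc)
      (continuousOn_dens hqc hqI)))
  have hend : ∀ t ∈ Set.Icc a b, |form j W (dens (p t) (p t)) (dens (q t) (q t))| ≤
      ‖W‖ * A ^ 2 * B ^ 2 := fun t ht => (abs_form_le j W _ _).trans (mul_le_mul
        (mul_le_mul_of_nonneg_left (hp.norm_dens_le ht) (norm_nonneg _)) (hq.norm_dens_le ht)
        (norm_nonneg _) (mul_nonneg (norm_nonneg _) (sq_nonneg _)))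
  refine (abs_integral_le_of_balance
    (F := fun t => form j W (dens (p t) (p t)) (dens (q t) (q t))) hab (h.eq b hb) (abs_uhSign j)
    (fun t ht => form_virial hW j (hp.band t ht) (hq.band t ht) (N t) (M t)) hmc i1 i2
    (hend a ha) (hend b hb) n1 n2).trans (le_of_eq ?_)
  ring

/-- The bound on H' makes H(τ) - (K/δ)e^{-δτ} nondecreasing on τ ≥ 0. Comparing τ = 0 with τ = T and
letting T tend to infinity removes C. -/
theorem le_of_hasDerivAt_exp_bound {H H' : ℝ → ℝ} {K δ C : ℝ} (hδ : 0 < δ) (hK : 0 ≤ K)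
    (hd : ∀ τ, HasDerivAt H (H' τ) τ) (hH' : ∀ τ > 0, |H' τ| ≤ K * Real.exp (-δ * τ))
    (hT : ∀ T > 0, H T ≤ C * Real.exp (-δ * T)) : H 0 ≤ K / δ := by
  have hmono : MonotoneOn (fun τ => H τ - K / δ * Real.exp (-δ * τ)) (Set.Ici 0) := by
    have hd' : ∀ τ, HasDerivAt (fun τ => H τ - K / δ * Real.exp (-δ * τ))
        (H' τ + K * Real.exp (-δ * τ)) τ := by
      intro τ
      have h1 := (((hasDerivAt_id τ).const_mul (-δ)).exp).const_mul (K / δ)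
      refine ((hd τ).sub h1).congr_deriv ?_
      simp only [id, mul_one]
      field_simp
      ring
    refine monotoneOn_of_deriv_nonneg (convex_Ici 0)
      (fun τ _ => (hd' τ).continuousAt.continuousWithinAt)
      (fun τ _ => (hd' τ).differentiableAt.differentiableWithinAt) fun τ hτ => ?_
    rw [interior_Ici, Set.mem_Ioi] at hτ
    rw [(hd' τ).deriv]
    have := (abs_le.1 (hH' τ hτ)).1
    linarith
  have hle : ∀ T > 0, H 0 ≤ C * Real.exp (-δ * T) + K / δ := by
    intro T hT0
    have h1 := hmono (Set.mem_Ici.2 le_rfl) (Set.mem_Ici.2 hT0.le) hT0.le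
    simp only [mul_zero, Real.exp_zero, mul_one] at h1
    have h2 := hT T hT0
    have h3 : 0 ≤ K / δ * Real.exp (-δ * T) := by positivity
    linarith
  have hlim : Tendsto (fun T => C * Real.exp (-δ * T) + K / δ) atTop (𝓝 (C * 0 + K / δ)) := by
    refine ((Real.tendsto_exp_atBot.comp ?_).const_mul _).add_const _
    exact tendsto_id.const_mul_atTop_of_neg (by linarith)
  rw [mul_zero, zero_add] at hlim
  exact ge_of_tendsto hlim (eventually_gt_atTop 0 |>.mono hle)

/-- The continued functions coincide with averages of translates, hence are solutions with rescaled
bounds, and the virial estimate applies to them. -/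
theorem abs_integral_contFormDeriv_le_of_op {R a b A B X Y θ τ : ℝ} (hab : a ≤ b)
    (hθ : |θ| = 1) {f N g M : ℝ → L2x} (hf : BandSolution R a b f N A X)
    (hg : BandSolution R a b g M B Y) {W w : BoundedContinuousFunction ℝ ℝ}
    (hW : IsWeightDeriv W w) (j : Fin 2) (U V : TransMean)
    (hU : ∀ t ∈ Set.Icc a b, U.op (f t) = eop R j (-θ * τ) (f t))
    (hV : ∀ t ∈ Set.Icc a b, V.op (g t) = eop R j (θ * τ) (g t)) :
    |∫ t in a..b, contFormDeriv R j θ w (f t) (g t) τ| ≤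
      2 * ‖W‖ * (A ^ 2 * B ^ 2 + X * B ^ 2 + A ^ 2 * Y) * (U.mass ^ 2 * V.mass ^ 2) := by
  have h := abs_integral_virial_le hab (hf.op U) (hg.op V) hW j
  have e : ∫ t in a..b, contFormDeriv R j θ w (f t) (g t) τ =
      θ * ∫ t in a..b, 2 * (form j w (dens (U.op (f t)) (Complex.I • dop R j (U.op (f t))))
        (dens (V.op (g t)) (V.op (g t))) -
        form j w (dens (U.op (f t)) (U.op (f t)))
        (dens (V.op (g t)) (Complex.I • dop R j (V.op (g t))))) := by
    rw [← intervalIntegral.integral_const_mul]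
    refine intervalIntegral.integral_congr fun t ht => ?_
    rw [Set.uIcc_of_le hab] at ht
    simp only [contFormDeriv]
    rw [hU t ht, hV t ht]
    ring
  rw [e, abs_mul, hθ, one_mul]
  refine h.trans (le_of_eq ?_)
  ring

theorem abs_contForm_le_of_op {R a b A B X Y θ τ t : ℝ} {f N g M : ℝ → L2x}
    (hf : BandSolution R a b f N A X) (hg : BandSolution R a b g M B Y)
    (w : BoundedContinuousFunction ℝ ℝ) (j : Fin 2) (U V : TransMean) (ht : t ∈ Set.Icc a b)
    (hU : U.op (f t) = eop R j (-θ * τ) (f t)) (hV : V.op (g t) = eop R j (θ * τ) (g t)) :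
    |contForm R j θ w (f t) (g t) τ| ≤
      ‖w‖ * (A ^ 2 * B ^ 2) * (U.mass ^ 2 * V.mass ^ 2) := by
  rw [contForm, ← hU, ← hV]
  have h1 := (hf.op U).norm_dens_le ht
  have h2 := (hg.op V).norm_dens_le ht
  calc _ ≤ ‖w‖ * ‖dens (U.op (f t)) (U.op (f t))‖ * ‖dens (V.op (g t)) (V.op (g t))‖ :=
        abs_form_le j w _ _
    _ ≤ ‖w‖ * (U.mass * A) ^ 2 * (V.mass * B) ^ 2 :=
        mul_le_mul (mul_le_mul_of_nonneg_left h1 (norm_nonneg _)) h2 (norm_nonneg _)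
          (mul_nonneg (norm_nonneg _) (sq_nonneg _))
    _ = _ := by ring

/-- Interaction estimate: if `f` has large frequencies in the direction `j` compared to `g`, then
the interaction form with the bounded weight `w` is controlled. The hypotheses on the operators
`U τ` and `V τ` say that they realize the analytic continuations of `f` and `g` and that their
total variations decay. -/
theorem integral_form_le {R a b A B X Y δ θ : ℝ} (hab : a ≤ b) (hδ : 0 < δ) (hθ : |θ| = 1)
    {f N g M : ℝ → L2x} (hf : BandSolution R a b f N A X) (hg : BandSolution R a b g M B Y)
    {W w : BoundedContinuousFunction ℝ ℝ} (hW : IsWeightDeriv W w) (j : Fin 2)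
    (U V : ℝ → TransMean)
    (hU : ∀ τ > 0, ∀ t ∈ Set.Icc a b, (U τ).op (f t) = eop R j (-θ * τ) (f t))
    (hV : ∀ τ > 0, ∀ t ∈ Set.Icc a b, (V τ).op (g t) = eop R j (θ * τ) (g t))
    (hUV : ∀ τ > 0, (U τ).mass ^ 2 * (V τ).mass ^ 2 ≤ Real.exp (-δ * τ)) :
    ∫ t in a..b, form j w (dens (f t) (f t)) (dens (g t) (g t)) ≤
      2 * ‖W‖ * (A ^ 2 * B ^ 2 + X * B ^ 2 + A ^ 2 * Y) / δ := by
  have hX := hf.nonneg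
  have hY := hg.nonneg
  have hK0 : 0 ≤ 2 * ‖W‖ * (A ^ 2 * B ^ 2 + X * B ^ 2 + A ^ 2 * Y) := by positivity
  have hH0 : ∫ t in a..b, contForm R j θ w (f t) (g t) 0 =
      ∫ t in a..b, form j w (dens (f t) (f t)) (dens (g t) (g t)) := by
    refine intervalIntegral.integral_congr fun t ht => ?_
    rw [Set.uIcc_of_le hab] at ht
    simp only [contForm, mul_zero, eop_zero j (hf.band t ht), eop_zero j (hg.band t ht)]
  rw [← hH0]
  -- The constant at large τ may depend on the length b - a and on ‖w‖: it disappears in the limit.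
  -- Only ‖W‖ and δ enter the conclusion.
  refine le_of_hasDerivAt_exp_bound (H := fun τ => ∫ t in a..b, contForm R j θ w (f t) (g t) τ)
    (C := ‖w‖ * (A ^ 2 * B ^ 2) * (b - a)) hδ hK0
    (hasDerivAt_integral_contForm R j hθ w hab hf.prim.continuousOn hg.prim.continuousOn
      hf.norm_le hg.norm_le) (fun τ hτ => ?_) fun T hT => ?_
  · exact (abs_integral_contFormDeriv_le_of_op hab hθ hf hg hW j (U τ) (V τ) (hU τ hτ)
      (hV τ hτ)).trans (mul_le_mul_of_nonneg_left (hUV τ hτ) hK0)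
  · have hb : ∀ t ∈ Set.uIoc a b, ‖contForm R j θ w (f t) (g t) T‖ ≤
        ‖w‖ * (A ^ 2 * B ^ 2) * Real.exp (-δ * T) := fun t ht => by
      rw [Set.uIoc_of_le hab] at ht
      have ht' := Set.Ioc_subset_Icc_self ht
      exact (abs_contForm_le_of_op hf hg w j (U T) (V T) ht' (hU T hT t ht')
        (hV T hT t ht')).trans (mul_le_mul_of_nonneg_left (hUV T hT) (by positivity))
    have := (le_abs_self _).trans (intervalIntegral.norm_integral_le_of_norm_le_const hb)
    rw [abs_of_nonneg (sub_nonneg.2 hab)] at this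
    refine this.trans (le_of_eq ?_)
    ring

/-! ### Weak derivatives of Banach-valued functions on an interval -/

theorem exists_Icc_of_isCompact {J K : Set ℝ} (hJ : J.OrdConnected) (hK : IsCompact K)
    (hKJ : K ⊆ J) (hne : K.Nonempty) : ∃ a b, a ≤ b ∧ K ⊆ Set.Icc a b ∧ Set.Icc a b ⊆ J := by
  obtain ⟨a, ha⟩ := hK.exists_isLeast hne
  obtain ⟨b, hb⟩ := hK.exists_isGreatest hne
  exact ⟨a, b, ha.2 hb.1, fun x hx => ⟨ha.2 hx, hb.2 hx⟩, hJ.out (hKJ ha.1) (hKJ hb.1)⟩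

theorem exists_Icc_tsupport {J : Set ℝ} (hJ : J.OrdConnected) {η : ℝ → ℝ} {t₀ : ℝ} (ht₀ : t₀ ∈ J)
    (hc : HasCompactSupport η) (hs : tsupport η ⊆ J) :
    ∃ a b, a ≤ b ∧ tsupport η ∪ {t₀} ⊆ Set.Icc a b ∧ Set.Icc a b ⊆ J :=
  exists_Icc_of_isCompact hJ (hc.isCompact.union isCompact_singleton)
    (Set.union_subset hs (Set.singleton_subset_iff.2 ht₀)) ⟨t₀, Or.inr rfl⟩

section WeakDeriv

variable {E : Type*} [NormedAddCommGroup E] [NormedSpace ℝ E]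

theorem integrable_smul_of_tsupport {J : Set ℝ} {η : ℝ → ℝ} {f : ℝ → E}
    (hη : Continuous η) (hc : HasCompactSupport η) (hs : tsupport η ⊆ J)
    (hf : LocallyIntegrableOn f J) : Integrable (fun t => η t • f t) := by
  have h1 : IntegrableOn f (tsupport η) := hf.integrableOn_compact_subset hs hc.isCompact
  have h2 : IntegrableOn (fun t => η t • f t) (tsupport η) :=
    h1.continuousOn_smul hη.continuousOn hc.isCompact
  refine (integrableOn_iff_integrable_of_support_subset ?_).1 h2
  exact (Function.support_smul_subset_left η f).trans (subset_tsupport η)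

/-- The du Bois-Reymond lemma. A test function minus its mean times a fixed normalized bump has
integral zero, hence is the derivative of a test function. -/
theorem exists_primitive_of_weak_deriv_zero [CompleteSpace E] {J : Set ℝ}
    (hJo : IsOpen J) (hJ : J.OrdConnected)
    {t₀ : ℝ} (ht₀ : t₀ ∈ J) {k : ℝ → E} (hk : LocallyIntegrableOn k J)
    (hw : ∀ η : ℝ → ℝ, ContDiff ℝ ∞ η → HasCompactSupport η → tsupport η ⊆ J →
      ∫ t, deriv η t • k t = 0) : ∃ c : E, ∀ᵐ t, t ∈ J → k t = c := by
  obtain ⟨ε, hε, hball⟩ := Metric.isOpen_iff.1 hJo t₀ ht₀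
  let φ : ContDiffBump t₀ := ⟨ε / 4, ε / 2, by positivity, by linarith⟩
  set η₀ : ℝ → ℝ := φ.normed volume with hη₀
  have hη₀d : ContDiff ℝ ∞ η₀ := φ.contDiff_normed
  have hη₀c : HasCompactSupport η₀ := φ.hasCompactSupport_normed
  have hη₀s : tsupport η₀ ⊆ J := by
    rw [hη₀, φ.tsupport_normed_eq]
    refine (Metric.closedBall_subset_ball ?_).trans hball
    change ε / 2 < ε
    linarith
  have hη₀i : ∫ t, η₀ t = 1 := φ.integral_normed
  refine ⟨∫ t, η₀ t • k t, ?_⟩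
  set c := ∫ t, η₀ t • k t with hc
  have key : ∀ᵐ t, t ∈ J → k t - c = 0 := by
    refine hJo.ae_eq_zero_of_integral_contDiff_smul_eq_zero
      (hk.sub ((locallyIntegrable_const c).locallyIntegrableOn J)) fun η hηd hηc hηs => ?_
    have hηi : Integrable η := hηd.continuous.integrable_of_hasCompactSupport hηc
    have hη₀int : Integrable η₀ := hη₀d.continuous.integrable_of_hasCompactSupport hη₀c
    set m := ∫ t, η t with hm
    obtain ⟨a, b, hab, hsub, hIJ⟩ := exists_Icc_of_isCompact hJ (hηc.isCompact.union hη₀c.isCompact)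
      (Set.union_subset hηs hη₀s) ⟨t₀, Or.inr (by
        rw [hη₀, φ.tsupport_normed_eq]
        exact Metric.mem_closedBall_self φ.rOut_pos.le)⟩
    set ρ : ℝ → ℝ := fun t => η t - m * η₀ t with hρ
    have hρd : ContDiff ℝ ∞ ρ := hηd.sub (contDiff_const.mul hη₀d)
    have hρz : ∀ t, t ∉ Set.Icc a b → ρ t = 0 := fun t ht => by
      have h1 : η t = 0 := image_eq_zero_of_notMem_tsupport fun h => ht (hsub (Or.inl h))
      have h2 : η₀ t = 0 := image_eq_zero_of_notMem_tsupport fun h => ht (hsub (Or.inr h))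
      simp [hρ, h1, h2]
    have hρi : Integrable ρ := hηi.sub (hη₀int.const_mul m)
    have hρ0 : ∫ t, ρ t = 0 := by
      rw [hρ, integral_sub hηi (hη₀int.const_mul m), integral_const_mul, hη₀i, mul_one, sub_self]
    -- The primitive vanishes to the left of a because ρ does, and to the right of b because ρ has
    -- total integral zero.
    set ζ : ℝ → ℝ := fun t => ∫ s in a..t, ρ s with hζ
    have hζd : ∀ t, HasDerivAt ζ (ρ t) t := fun t =>
      intervalIntegral.integral_hasDerivAt_right (hρi.intervalIntegrable)
        hρd.continuous.aestronglyMeasurable.stronglyMeasurableAtFilter hρd.continuous.continuousAt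
    have hζderiv : deriv ζ = ρ := funext fun t => (hζd t).deriv
    have hζsm : ContDiff ℝ ∞ ζ := by
      rw [contDiff_infty_iff_deriv, hζderiv]
      exact ⟨fun t => (hζd t).differentiableAt, hρd⟩
    have hζz : ∀ t, t ∉ Set.Icc a b → ζ t = 0 := fun t ht => by
      rw [Set.mem_Icc, not_and_or, not_le, not_le] at ht
      rcases ht with ht | ht
      · rw [hζ]
        simp only
        rw [intervalIntegral.integral_symm, intervalIntegral.integral_of_le ht.le, neg_eq_zero,
          integral_Ioc_eq_integral_Ioo]
        exact setIntegral_eq_zero_of_forall_eq_zero fun s hs => hρz s fun h => by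
          linarith [h.1, hs.2]
      · rw [hζ]
        simp only
        rw [intervalIntegral.integral_of_le (hab.trans ht.le), ← integral_Icc_eq_integral_Ioc,
          setIntegral_eq_integral_of_forall_compl_eq_zero, hρ0]
        exact fun s hs => hρz s fun h => hs ⟨h.1, h.2.trans ht.le⟩
    have hζsupp : tsupport ζ ⊆ Set.Icc a b :=
      closure_minimal (fun t ht => by
        by_contra h
        exact ht (hζz t h)) isClosed_Icc
    have hζc : HasCompactSupport ζ := isCompact_Icc.of_isClosed_subset (isClosed_tsupport ζ) hζsupp
    have h0 := hw ζ hζsm hζc (hζsupp.trans hIJ)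
    rw [hζderiv] at h0
    have i1 := integrable_smul_of_tsupport hηd.continuous hηc hηs hk
    have i2 := integrable_smul_of_tsupport hη₀d.continuous hη₀c hη₀s hk
    have e1 : ∫ t, ρ t • k t = (∫ t, η t • k t) - m • c := by
      have i3 : Integrable (fun t => m • η₀ t • k t) := i2.smul m
      rw [hc, ← integral_smul, ← integral_sub i1 i3]
      refine integral_congr_ae (Eventually.of_forall fun t => ?_)
      simp only [hρ, sub_smul, mul_smul]
    have e2 : ∫ t, η t • (k t - c) = (∫ t, η t • k t) - m • c := by
      rw [hm, ← integral_smul_const, ← integral_sub i1 (hηi.smul_const c)]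
      simp only [smul_sub]
    exact e2.trans (e1.symm.trans h0)
  filter_upwards [key] with t ht hJt
  exact sub_eq_zero.1 (ht hJt)

/-- A function with a locally integrable weak derivative is almost everywhere equal to a primitive
of it. -/
theorem exists_primitive_of_weak_deriv [CompleteSpace E] {J : Set ℝ}
    (hJo : IsOpen J) (hJ : J.OrdConnected)
    {t₀ : ℝ} (ht₀ : t₀ ∈ J) {f h : ℝ → E} (hf : LocallyIntegrableOn f J)
    (hh : LocallyIntegrableOn h J)
    (hw : ∀ η : ℝ → ℝ, ContDiff ℝ ∞ η → HasCompactSupport η → tsupport η ⊆ J →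
      ∫ t, (deriv η t • f t + η t • h t) = 0) :
    ∃ F : ℝ → E, (∀ᵐ t, t ∈ J → f t = F t) ∧
      ∀ a b, Set.Icc a b ⊆ J → IsPrim F h a b := by
  set g : ℝ → E := fun t => ∫ s in t₀..t, h s with hg
  have hii : ∀ {s t}, s ∈ J → t ∈ J → IntervalIntegrable h volume s t := fun {s t} hs ht =>
    (hh.integrableOn_compact_subset (hJ.uIcc_subset hs ht) isCompact_uIcc).intervalIntegrable
  have hprim : ∀ a b, Set.Icc a b ⊆ J → IsPrim g h a b := fun a b hab => by
    refine ⟨hh.integrableOn_compact_subset hab isCompact_Icc, fun t ht => ?_⟩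
    have haJ : a ∈ J := hab ⟨le_rfl, ht.1.trans ht.2⟩
    exact (intervalIntegral.integral_add_adjacent_intervals (hii ht₀ haJ)
      (hii haJ (hab ht))).symm
  have hgc : ContinuousOn g J := fun t ht => by
    obtain ⟨ε, hε, hball⟩ := Metric.isOpen_iff.1 hJo t ht
    have hsub : Set.Icc (t - ε / 2) (t + ε / 2) ⊆ J := by
      refine Set.Subset.trans (fun s hs => ?_) hball
      rw [Metric.mem_ball, Real.dist_eq, abs_lt]
      constructor <;> linarith [hs.1, hs.2]
    exact ((hprim _ _ hsub).continuousOn.continuousAt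
      (Icc_mem_nhds (by linarith) (by linarith))).continuousWithinAt
  have hgl : LocallyIntegrableOn g J := hgc.locallyIntegrableOn hJo.measurableSet
  -- The primitive g of h has weak derivative h, so f - g has weak derivative zero and is a
  -- constant.
  obtain ⟨c, hc⟩ := exists_primitive_of_weak_deriv_zero hJo hJ ht₀ (hf.sub hgl)
    fun η hηd hηc hηs => by
      have hd : ContDiff ℝ ∞ (deriv η) := (contDiff_infty_iff_deriv.1 hηd).2
      have hdc : HasCompactSupport (deriv η) := hηc.deriv
      have hds : tsupport (deriv η) ⊆ J := (tsupport_deriv_subset).trans hηs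
      obtain ⟨a, b, hab, hsub, hIJ⟩ := exists_Icc_tsupport hJ ht₀ hηc hηs
      have j1 := integrable_smul_of_tsupport hd.continuous hdc hds hf
      have j2 := integrable_smul_of_tsupport hd.continuous hdc hds hgl
      have j3 := integrable_smul_of_tsupport hηd.continuous hηc hηs hh
      have h0 := hw η hηd hηc hηs
      rw [integral_add j1 j3] at h0
      have hz : ∀ t, t ∉ Set.Icc a b → η t = 0 := fun t ht =>
        image_eq_zero_of_notMem_tsupport fun h => ht (hsub (Or.inl h))
      have hz' : ∀ t, t ∉ Set.Icc a b → deriv η t = 0 := fun t ht =>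
        image_eq_zero_of_notMem_tsupport fun h =>
          ht (hsub (Or.inl (tsupport_deriv_subset h)))
      have hηprim' : IsPrim η (deriv η) a b := by
        refine ⟨hd.continuous.continuousOn.integrableOn_Icc, fun t ht => ?_⟩
        rw [intervalIntegral.integral_deriv_eq_sub
          (fun x _ => (hηd.differentiable (by simp)).differentiableAt)
          (hd.continuous.intervalIntegrable _ _)]
        abel
      -- The support may touch the endpoints of [a, b], so η vanishes there by continuity from
      -- outside; this kills the boundary terms.
      have hend : ∀ x ∈ ({a, b} : Set ℝ), η x = 0 := by
        have hlim : ∀ x, (∃ᶠ y in 𝓝 x, η y = 0) → η x = 0 := fun x hx => by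
          have hcl : IsClosed {y | η y = 0} := isClosed_eq hηd.continuous continuous_const
          have h : x ∈ closure {y | η y = 0} := mem_closure_iff_frequently.2 hx
          rw [hcl.closure_eq] at h
          exact h
        rintro x (rfl | rfl)
        · refine hlim x ?_
          have : ∀ᶠ y in 𝓝[<] x, η y = 0 :=
            eventually_nhdsWithin_of_forall fun y hy => hz y fun h => not_lt.2 h.1 hy
          exact this.frequently.filter_mono nhdsWithin_le_nhds
        · refine hlim x ?_
          have : ∀ᶠ y in 𝓝[>] x, η y = 0 :=
            eventually_nhdsWithin_of_forall fun y hy => hz y fun h => not_lt.2 h.2 hy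
          exact this.frequently.filter_mono nhdsWithin_le_nhds
      have hp := hηprim'.bilin (hprim a b hIJ) (ContinuousLinearMap.lsmul ℝ ℝ)
      have h1 := hp.eq b ⟨hab, le_rfl⟩
      simp only [ContinuousLinearMap.lsmul_apply, hend a (by simp), hend b (by simp), zero_smul,
        zero_add] at h1
      have h2 : ∫ t, (η t • h t + deriv η t • g t) = 0 := by
        rw [h1, intervalIntegral.integral_of_le hab, ← integral_Icc_eq_integral_Ioc,
          setIntegral_eq_integral_of_forall_compl_eq_zero]
        intro t ht
        rw [hz t ht, hz' t ht, zero_smul, zero_smul, add_zero]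
      rw [integral_add j3 j2] at h2
      have e : ∫ t, deriv η t • (f - g) t =
          (∫ t, deriv η t • f t) - ∫ t, deriv η t • g t := by
        rw [← integral_sub j1 j2]
        simp only [Pi.sub_apply, smul_sub]
      rw [e, sub_eq_zero]
      rw [add_comm] at h0
      exact add_left_cancel (h0.trans h2.symm)
  refine ⟨fun t => c + g t, ?_, fun a b hab => ?_⟩
  · filter_upwards [hc] with t ht hJt
    rw [← ht hJt, Pi.sub_apply, sub_add_cancel]
  · refine ⟨(hprim a b hab).int, fun t ht => ?_⟩
    rw [(hprim a b hab).eq t ht, add_assoc]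

end WeakDeriv

/-! ### From the distributional equation to the evolution equation in `L²` -/

/-- Pairing with a square integrable function. -/
def pairing (ψ : Plane → ℂ) (hψ : MemLp ψ 2 volume) : L2x →L[ℂ] ℂ :=
  ((ContinuousLinearMap.mul ℂ ℂ).lpPairing volume 2 2).flip (hψ.toLp ψ)

theorem pairing_apply (ψ : Plane → ℂ) (hψ : MemLp ψ 2 volume) (p : L2x) :
    pairing ψ hψ p = ∫ x, p x * ψ x := by
  rw [pairing, ContinuousLinearMap.flip_apply, ContinuousLinearMap.lpPairing_eq_integral]
  refine integral_congr_ae ?_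
  filter_upwards [hψ.coeFn_toLp] with x h
  rw [h, ContinuousLinearMap.mul_apply']

theorem contDiff_fderiv_apply {ψ : Plane → ℂ} (hψ : ContDiff ℝ ∞ ψ) (v : Plane) :
    ContDiff ℝ ∞ fun x => fderiv ℝ ψ x v :=
  (hψ.fderiv_right (m := ∞) (by simp)).clm_apply contDiff_const

theorem hasCompactSupport_fderiv_apply {ψ : Plane → ℂ} (hc : HasCompactSupport ψ) (v : Plane) :
    HasCompactSupport fun x => fderiv ℝ ψ x v :=
  (hc.fderiv (𝕜 := ℝ)).comp_left (g := fun L : Plane →L[ℝ] ℂ => L v) (by simp)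

theorem memLp_of_contDiff {ψ : Plane → ℂ} (hψ : ContDiff ℝ ∞ ψ) (hc : HasCompactSupport ψ) :
    MemLp ψ 2 (volume : Measure Plane) :=
  hψ.continuous.memLp_of_hasCompactSupport hc

theorem hasDerivAt_comp_line {ψ : Plane → ℂ} (hψ : ContDiff ℝ ∞ ψ) (x v : Plane) (h : ℝ) :
    HasDerivAt (fun h : ℝ => ψ (x + h • v)) (fderiv ℝ ψ (x + h • v) v) h := by
  have h1 : HasDerivAt (fun h : ℝ => x + h • v) v h := by
    simpa using ((hasDerivAt_id h).smul_const v).const_add x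
  exact ((hψ.differentiable (by simp)) (x + h • v)).hasFDerivAt.comp_hasDerivAt h h1

/-- The function h ↦ ∫ p(x) ψ(x + h e_l) dx is differentiated at 0 twice: with the shift on ψ, by
dominated convergence, and with the shift on p, by the L² derivative of translations. -/
theorem integral_mul_fderiv {R : ℝ} {p : L2x} (hp : Band R p) {ψ : Plane → ℂ}
    (hψ : ContDiff ℝ ∞ ψ) (hc : HasCompactSupport ψ) (l : Fin 2) :
    ∫ x, p x * fderiv ℝ ψ x (ev l) = -∫ x, dop R l p x * ψ x := by
  have hψ2 := memLp_of_contDiff hψ hc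
  have hd : HasDerivAt (fun h : ℝ => ∫ x, p x * ψ (x + h • ev l))
      (-∫ x, dop R l p x * ψ x) 0 := by
    have h1 := (pairing ψ hψ2).restrictScalars ℝ |>.hasFDerivAt.comp_hasDerivAt 0
      (hasDerivAt_trans l hp)
    have e : ((pairing ψ hψ2).restrictScalars ℝ ∘ fun h : ℝ => trans (h • ev l) p) =
        fun h : ℝ => ∫ x, p x * ψ (x + h • ev l) := by
      funext h
      rw [Function.comp_apply, ContinuousLinearMap.coe_restrictScalars', pairing_apply,
        ← integral_add_right_eq_self _ (h • ev l)]
      refine integral_congr_ae ?_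
      filter_upwards [(measurePreserving_add_right volume (h • ev l)).quasiMeasurePreserving.ae
        (coeFn_trans (h • ev l) p)] with x hx
      rw [hx, add_sub_cancel_right]
    rw [e] at h1
    refine h1.congr_deriv ?_
    rw [ContinuousLinearMap.coe_restrictScalars', map_neg, pairing_apply]
  have hcont := (contDiff_fderiv_apply hψ (ev l)).continuous
  have hcs := hasCompactSupport_fderiv_apply hc (ev l)
  obtain ⟨C, hC⟩ := hcs.exists_bound_of_continuous hcont
  obtain ⟨r, hr⟩ := hcs.isCompact.isBounded.subset_closedBall (0 : Plane)
  -- For |h| < 1 the shifted derivative of ψ is supported in the ball of radius r + 1, where p is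
  -- integrable.
  have hp1 : Integrable ((Metric.closedBall (0 : Plane) (r + 1)).indicator fun x => ‖p x‖ * C) := by
    refine IntegrableOn.integrable_indicator ?_ measurableSet_closedBall
    have : LocallyIntegrable p := (Lp.memLp p).locallyIntegrable (by norm_num)
    exact (this.integrableOn_isCompact (isCompact_closedBall _ _)).norm.mul_const C
  have hi : Integrable (fun x => p x * ψ x) := (Lp.memLp p).integrable_mul hψ2
  have hnorm : ‖ev l‖ = 1 := by simp [ev]
  have hd2 := hasDerivAt_integral_of_dominated_loc_of_deriv_le (x₀ := (0 : ℝ))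
    (s := Metric.ball 0 1) (μ := (volume : Measure Plane))
    (F := fun (h : ℝ) x => p x * ψ (x + h • ev l))
    (F' := fun (h : ℝ) x => p x * fderiv ℝ ψ (x + h • ev l) (ev l)) 
    (Metric.ball_mem_nhds 0 one_pos)
    (Eventually.of_forall fun h => (Lp.aestronglyMeasurable p).mul
      (hψ.continuous.comp (by fun_prop)).aestronglyMeasurable)
    (by simpa only [zero_smul, add_zero] using hi)
    ((Lp.aestronglyMeasurable p).mul (hcont.comp (by fun_prop)).aestronglyMeasurable)
    (Eventually.of_forall fun x h hh => by
      rw [norm_mul]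
      by_cases hx : x ∈ Metric.closedBall (0 : Plane) (r + 1)
      · rw [Set.indicator_of_mem hx]
        exact mul_le_mul_of_nonneg_left (hC _) (norm_nonneg _)
      · rw [Set.indicator_of_notMem hx]
        have : fderiv ℝ ψ (x + h • ev l) (ev l) = 0 := by
          by_contra hne
          have h1 := hr (subset_tsupport _ (Function.mem_support.2 hne))
          rw [mem_closedBall_zero_iff] at h1 hx
          rw [mem_ball_zero_iff, Real.norm_eq_abs] at hh
          have h2 : ‖x‖ ≤ ‖x + h • ev l‖ + ‖h • ev l‖ := by
            simpa using norm_sub_le (x + h • ev l) (h • ev l)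
          rw [norm_smul, hnorm, mul_one, Real.norm_eq_abs] at h2
          linarith
        rw [this, norm_zero, mul_zero])
    hp1
    (Eventually.of_forall fun x h _ => (hasDerivAt_comp_line hψ x (ev l) h).const_mul (p x))
  have := hd2.2.unique hd
  simpa only [zero_smul, add_zero] using this

theorem iteratedDeriv_two_line {ψ : Plane → ℂ} (hψ : ContDiff ℝ ∞ ψ) (x v : Plane) :
    iteratedDeriv 2 (fun s : ℝ => ψ (x + s • v)) 0 =
      fderiv ℝ (fun x => fderiv ℝ ψ x v) x v := by
  have h1 : deriv (fun s : ℝ => ψ (x + s • v)) = fun s => fderiv ℝ ψ (x + s • v) v :=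
    funext fun s => (hasDerivAt_comp_line hψ x v s).deriv
  rw [iteratedDeriv_succ, iteratedDeriv_one, h1,
    (hasDerivAt_comp_line (contDiff_fderiv_apply hψ v) x v 0).deriv, zero_smul, add_zero]

theorem uhTranspose_mul {η : ℝ → ℝ} (hη : ContDiff ℝ ∞ η) {ψ : Plane → ℂ} (hψ : ContDiff ℝ ∞ ψ)
    (t : ℝ) (x : Plane) :
    uhTranspose (fun z => (η z.1 : ℂ) * ψ z.2) t x =
      -Complex.I * (deriv η t * ψ x) + ∑ l : Fin 2, (uhSign l : ℂ) *
        (η t * fderiv ℝ (fun x => fderiv ℝ ψ x (ev l)) x (ev l)) := by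
  unfold uhTranspose
  congr 2
  · have h := ((hη.differentiable (by simp)) t).hasDerivAt.ofReal_comp.mul_const (ψ x)
    exact h.deriv
  · funext l
    congr 1
    rw [← iteratedDeriv_two_line hψ]
    exact iteratedDeriv_const_mul_field (n := 2) (x := (0 : ℝ)) (η t : ℂ)
      (fun s : ℝ => ψ (x + s • ev l))

/-- Two integrations by parts move ∂_l² from ψ to the band-limited p. The x-integral thus becomes a
bounded functional of an L² vector and can be exchanged with the time integral. -/
theorem integral_mul_uhTranspose {R : ℝ} {p : L2x} (hp : Band R p) {η : ℝ → ℝ}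
    (hη : ContDiff ℝ ∞ η) {ψ : Plane → ℂ} (hψ : ContDiff ℝ ∞ ψ) (hc : HasCompactSupport ψ)
    (t : ℝ) :
    ∫ x, p x * uhTranspose (fun z => (η z.1 : ℂ) * ψ z.2) t x =
      pairing ψ (memLp_of_contDiff hψ hc) (-Complex.I • deriv η t • p + η t • schr R p) := by
  have hψ2 := memLp_of_contDiff hψ hc
  have hl2 : ∀ l, MemLp (fun x => fderiv ℝ (fun x => fderiv ℝ ψ x (ev l)) x (ev l)) 2
      (volume : Measure Plane) := fun l =>
    memLp_of_contDiff (contDiff_fderiv_apply (contDiff_fderiv_apply hψ _) _)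
      (hasCompactSupport_fderiv_apply (hasCompactSupport_fderiv_apply hc _) _)
  have i1 : Integrable (fun x => p x * ψ x) := (Lp.memLp p).integrable_mul hψ2
  have i2 : ∀ l, Integrable (fun x =>
      p x * fderiv ℝ (fun x => fderiv ℝ ψ x (ev l)) x (ev l)) := fun l =>
    (Lp.memLp p).integrable_mul (hl2 l)
  have e : ∀ x, p x * uhTranspose (fun z => (η z.1 : ℂ) * ψ z.2) t x =
      (-Complex.I * deriv η t) * (p x * ψ x) + ∑ l : Fin 2, ((uhSign l : ℂ) * η t) *
        (p x * fderiv ℝ (fun x => fderiv ℝ ψ x (ev l)) x (ev l)) := fun x => by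
    rw [uhTranspose_mul hη hψ, mul_add, Finset.mul_sum]
    congr 1
    · ring
    · exact Finset.sum_congr rfl fun l _ => by ring
  simp only [e]
  rw [integral_add (i1.const_mul _) (integrable_finsetSum _ fun l _ => (i2 l).const_mul _),
    integral_finsetSum _ fun l _ => (i2 l).const_mul _]
  simp only [integral_const_mul]
  have e3 : ∀ l, ∫ x, p x * fderiv ℝ (fun x => fderiv ℝ ψ x (ev l)) x (ev l) =
      pairing ψ hψ2 (dop R l (dop R l p)) := fun l => by
    rw [integral_mul_fderiv hp (contDiff_fderiv_apply hψ _) (hasCompactSupport_fderiv_apply hc _),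
      integral_mul_fderiv (band_dop l hp) hψ hc, neg_neg, pairing_apply]
  simp only [e3, ← pairing_apply ψ hψ2]
  have hr : ∀ (r : ℝ) (q : L2x), r • q = (r : ℂ) • q := fun _ _ => rfl
  simp only [schr_apply, hr, map_add, map_smul, map_sum, Finset.mul_sum, smul_eq_mul]
  congr 1
  · ring
  · exact Finset.sum_congr rfl fun l _ => by ring

theorem eq_zero_of_pairing {q : L2x}
    (h : ∀ (ψ : Plane → ℝ) (hψ : MemLp (fun x => (ψ x : ℂ)) 2 volume), ContDiff ℝ ∞ ψ →
      HasCompactSupport ψ → pairing _ hψ q = 0) : q = 0 := by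
  have hloc : LocallyIntegrable q := (Lp.memLp q).locallyIntegrable (by norm_num)
  have := ae_eq_zero_of_integral_contDiff_smul_eq_zero hloc fun ψ hψ hc => by
    have hψ2 : MemLp (fun x => (ψ x : ℂ)) 2 volume :=
      memLp_of_contDiff (Complex.ofRealCLM.contDiff.comp hψ)
        (hc.comp_left (g := fun r : ℝ => (r : ℂ)) (by simp))
    have h1 := h ψ hψ2 hψ hc
    rw [pairing_apply] at h1
    rw [← h1]
    refine integral_congr_ae (Eventually.of_forall fun x => ?_)
    simp only [Complex.real_smul, mul_comm]
  exact (Lp.eq_zero_iff_ae_eq_zero).2 this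

/-- Testing with products η(t)ψ(x) and letting ψ vary gives a weak differential equation for an
L²-valued function of time. Band limitation makes μ_l∂_l² bounded, so its right-hand side is locally
integrable. -/
theorem exists_primitive_of_isUHForcing {I : Set ℝ} (hI : I.OrdConnected) {t₀ : ℝ}
    (ht₀ : t₀ ∈ interior I) {R : ℝ} {f N : ℝ → L2x} (h : IsUHForcing I f N)
    (hf : ∀ t, Band R (f t)) :
    ∃ F : ℝ → L2x, (∀ᵐ t, t ∈ interior I → f t = F t) ∧
      ∀ a b, Set.Icc a b ⊆ interior I →
        IsPrim F (fun t => Complex.I • (schr R (f t) - N t)) a b := by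
  have hsf : LocallyIntegrableOn (fun t => schr R (f t)) (interior I) := fun t ht => by
    obtain ⟨s, hs, hi⟩ := h.locInt t ht
    exact ⟨s, hs, (schr R).integrable_comp hi⟩
  have hg : LocallyIntegrableOn (fun t => Complex.I • (schr R (f t) - N t)) (interior I) :=
    (hsf.sub h.locInt_forcing).smul Complex.I
  have hIo : (interior I).OrdConnected := hI.interior
  refine exists_primitive_of_weak_deriv isOpen_interior hIo ht₀ h.locInt hg
    fun η hη hηc hηs => ?_
  have hd : ContDiff ℝ ∞ (deriv η) := (contDiff_infty_iff_deriv.1 hη).2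
  have hds : tsupport (deriv η) ⊆ interior I := tsupport_deriv_subset.trans hηs
  have j1 := integrable_smul_of_tsupport hd.continuous hηc.deriv hds h.locInt
  have j2 := integrable_smul_of_tsupport hη.continuous hηc hηs hg
  have j3 := integrable_smul_of_tsupport hη.continuous hηc hηs hsf
  have j4 := integrable_smul_of_tsupport hη.continuous hηc hηs h.locInt_forcing
  have hres : ∀ {G : Type} [NormedAddCommGroup G] [NormedSpace ℝ G] (u : ℝ → G),
      (∀ t, η t = 0 → deriv η t = 0 → u t = 0) →
      ∫ t in interior I, u t = ∫ t, u t := fun u hu => by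
    refine setIntegral_eq_integral_of_forall_compl_eq_zero fun t ht => hu t ?_ ?_
    · exact image_eq_zero_of_notMem_tsupport fun h => ht (hηs h)
    · exact image_eq_zero_of_notMem_tsupport fun h => ht (hds h)
  have i0 : Integrable fun t => deriv η t • f t + η t • (Complex.I • (schr R (f t) - N t)) :=
    j1.add j2
  refine eq_zero_of_pairing fun ψ hψ2 hψ hc => ?_
  have hψ' : ContDiff ℝ ∞ fun x => (ψ x : ℂ) := Complex.ofRealCLM.contDiff.comp hψ
  have hc' : HasCompactSupport fun x => (ψ x : ℂ) :=
    hc.comp_left (g := fun r : ℝ => (r : ℂ)) (by simp)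
  set φ : ℝ × Plane → ℂ := fun z => (η z.1 : ℂ) * (ψ z.2 : ℂ) with hφ
  have hφd : ContDiff ℝ ∞ φ :=
    ((Complex.ofRealCLM.contDiff.comp hη).comp contDiff_fst).mul (hψ'.comp contDiff_snd)
  have hφsub : tsupport φ ⊆ tsupport η ×ˢ tsupport ψ := by
    refine closure_minimal (fun z hz => ?_) ((isClosed_tsupport η).prod (isClosed_tsupport ψ))
    rw [Function.mem_support] at hz
    refine ⟨subset_tsupport η fun h0 => hz ?_, subset_tsupport ψ fun h0 => hz ?_⟩
    · simp [hφ, h0]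
    · simp [hφ, h0]
  have hφc : HasCompactSupport φ :=
    (hηc.isCompact.prod hc.isCompact).of_isClosed_subset (isClosed_tsupport φ) hφsub
  have heq := h.eqn φ hφd hφc (hφsub.trans (Set.prod_mono hηs (Set.subset_univ _)))
  have e1 : ∀ t, ∫ x, f t x * uhTranspose φ t x =
      pairing _ hψ2 (-Complex.I • deriv η t • f t + η t • schr R (f t)) := fun t =>
    integral_mul_uhTranspose (hf t) hη hψ' hc' t
  have e2 : ∀ t, ∫ x, N t x * φ (t, x) = pairing _ hψ2 (η t • N t) := fun t => by
    have hr : η t • N t = (η t : ℂ) • N t := rfl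
    rw [hr, map_smul, pairing_apply, smul_eq_mul, ← integral_const_mul]
    refine integral_congr_ae (Eventually.of_forall fun x => ?_)
    simp only [hφ]
    ring
  simp only [e1, e2] at heq
  rw [hres _ fun t h1 h2 => by rw [h1, h2, zero_smul, zero_smul, smul_zero, zero_add, map_zero],
    hres _ fun t h1 h2 => by rw [h1, zero_smul, map_zero]] at heq
  have i1 : Integrable fun t => -Complex.I • deriv η t • f t + η t • schr R (f t) :=
    (j1.smul (-Complex.I)).add j3
  rw [(pairing _ hψ2).integral_comp_comm i1, (pairing _ hψ2).integral_comp_comm j4,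
    ← sub_eq_zero, ← map_sub, ← integral_sub i1 j4] at heq
  -- Multiplication by i turns -iη'f + η(μ_l∂_l² f - N) into η'f + iη(μ_l∂_l² f - N), the weak form
  -- of f' = i(μ_l∂_l² f - N).
  have e3 : ∫ t, (deriv η t • f t + η t • (Complex.I • (schr R (f t) - N t))) =
      Complex.I • ∫ t, (-Complex.I • deriv η t • f t + η t • schr R (f t) - η t • N t) := by
    rw [← integral_smul]
    refine integral_congr_ae (Eventually.of_forall fun t => ?_)
    simp only [smul_sub, smul_add, smul_smul]
    rw [smul_comm Complex.I (η t), smul_comm Complex.I (η t), mul_neg, Complex.I_mul_I, neg_neg,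
      one_smul, add_sub_assoc]
  rw [e3, map_smul, heq, smul_zero]

/-! ### Explicit averaging kernels -/

/-- The averaging operator with a rescaled Schwartz kernel. -/
@[reducible]
def schwartzMean (K : SchwartzMap Plane ℂ) (c : ℝ) : TransMean where
  S := Plane
  ν := volume
  K := K
  γ z := c • z
  hK := K.integrable
  hγ := by fun_prop

theorem symbol_schwartzMean (K : SchwartzMap Plane ℂ) (c : ℝ) (ξ : Plane) :
    (schwartzMean K c).symbol ξ = (𝓕 K : SchwartzMap Plane ℂ) (c • ξ) := by
  rw [SchwartzMap.fourier_coe, Real.fourier_eq']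
  refine integral_congr_ae (Eventually.of_forall fun z => ?_)
  simp only [ph, inner_smul_left, inner_smul_right, smul_eq_mul]
  rw [mul_comm]
  congr 3
  simp

theorem integrable_exp_neg_abs :
    Integrable (fun x : ℝ => Complex.exp ((-(2 * Real.pi * |x|) : ℝ) : ℂ)) := by
  have h1 : IntegrableOn (fun x : ℝ => Complex.exp ((-(2 * Real.pi * |x|) : ℝ) : ℂ))
      (Set.Iic 0) := by
    refine (integrableOn_exp_mul_complex_Iic (a := ((2 * Real.pi : ℝ) : ℂ))
      (by rw [Complex.ofReal_re]; exact Real.two_pi_pos) 0).congr_fun (fun x hx => ?_)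
      measurableSet_Iic
    rw [abs_of_nonpos hx]; push_cast; congr 1; ring
  have h2 : IntegrableOn (fun x : ℝ => Complex.exp ((-(2 * Real.pi * |x|) : ℝ) : ℂ))
      (Set.Ioi 0) := by
    refine (integrableOn_exp_mul_complex_Ioi (a := ((-(2 * Real.pi) : ℝ) : ℂ))
      (by rw [Complex.ofReal_re]; linarith [Real.two_pi_pos]) 0).congr_fun (fun x hx => ?_)
      measurableSet_Ioi
    rw [abs_of_pos hx]; push_cast; congr 1; ring
  simpa using h1.union h2

theorem fourier_exp_neg_abs (w : ℝ) :
    𝓕 (fun x : ℝ => Complex.exp ((-(2 * Real.pi * |x|) : ℝ) : ℂ)) w =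
      ((Real.pi⁻¹ * (1 + w ^ 2)⁻¹ : ℝ) : ℂ) := by
  have hpi : (Real.pi : ℂ) ≠ 0 := Complex.ofReal_ne_zero.2 Real.pi_ne_zero
  set a : ℂ := (2 * Real.pi : ℝ) + ((-(2 * Real.pi * w) : ℝ) : ℂ) * Complex.I with ha
  set b : ℂ := (-(2 * Real.pi) : ℝ) + ((-(2 * Real.pi * w) : ℝ) : ℂ) * Complex.I with hb
  have hare : 0 < a.re := by
    simp only [ha, Complex.add_re, Complex.ofReal_re, Complex.re_ofReal_mul, Complex.I_re,
      mul_zero, add_zero]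
    exact Real.two_pi_pos
  have hbre : b.re < 0 := by
    simp only [hb, Complex.add_re, Complex.ofReal_re, Complex.re_ofReal_mul, Complex.I_re,
      mul_zero, add_zero]
    linarith [Real.two_pi_pos]
  have e1 : ∀ x ∈ Set.Iic (0 : ℝ), Complex.exp (((-2 * Real.pi * x * w : ℝ) : ℂ) * Complex.I) •
      Complex.exp ((-(2 * Real.pi * |x|) : ℝ) : ℂ) = Complex.exp (a * x) := fun x hx => by
    rw [abs_of_nonpos hx, smul_eq_mul, ← Complex.exp_add, ha]
    congr 1; push_cast; ring
  have e2 : ∀ x ∈ Set.Ioi (0 : ℝ), Complex.exp (((-2 * Real.pi * x * w : ℝ) : ℂ) * Complex.I) •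
      Complex.exp ((-(2 * Real.pi * |x|) : ℝ) : ℂ) = Complex.exp (b * x) := fun x hx => by
    rw [abs_of_pos hx, smul_eq_mul, ← Complex.exp_add, hb]
    congr 1; push_cast; ring
  rw [Real.fourier_real_eq_integral_exp_smul,
    ← intervalIntegral.integral_Iic_add_Ioi (b := 0)
      ((integrableOn_exp_mul_complex_Iic hare 0).congr_fun (fun x hx => (e1 x hx).symm)
        measurableSet_Iic)
      ((integrableOn_exp_mul_complex_Ioi hbre 0).congr_fun (fun x hx => (e2 x hx).symm)
        measurableSet_Ioi),
    setIntegral_congr_fun measurableSet_Iic e1, setIntegral_congr_fun measurableSet_Ioi e2,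
    integral_exp_mul_complex_Iic hare, integral_exp_mul_complex_Ioi hbre]
  have ha0 : a ≠ 0 := fun h => by rw [h] at hare; simp at hare
  have hb0 : b ≠ 0 := fun h => by rw [h] at hbre; simp at hbre
  have hw : (1 + (w : ℂ) ^ 2) ≠ 0 := by
    have : (1 + w ^ 2 : ℝ) ≠ 0 := by positivity
    exact_mod_cast this
  simp only [Complex.ofReal_zero, mul_zero, Complex.exp_zero]
  have hab : a * b = -4 * Real.pi ^ 2 * (1 + w ^ 2) := by
    rw [ha, hb]; push_cast
    linear_combination (4 * (Real.pi : ℂ) ^ 2 * w ^ 2) * Complex.I_sq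
  have hba : b - a = -4 * Real.pi := by rw [ha, hb]; push_cast; ring
  have : 1 / a + -1 / b = (b - a) / (a * b) := by field_simp; ring
  rw [this, hab, hba]
  push_cast
  field_simp

/-- Fourier inversion for the pair e^{-2π|x|} and π⁻¹(1+w²)⁻¹. Positivity and unit mass of the
second make the total variation of the averages exact. -/
theorem integral_poisson (x : ℝ) :
    ∫ s : ℝ, ((Real.pi⁻¹ * (1 + s ^ 2)⁻¹ : ℝ) : ℂ) *
      Complex.exp (((-(2 * Real.pi * (s * x)) : ℝ) : ℂ) * Complex.I) =
      Complex.exp ((-(2 * Real.pi * |x|) : ℝ) : ℂ) := by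
  have hF : 𝓕 (fun x : ℝ => Complex.exp ((-(2 * Real.pi * |x|) : ℝ) : ℂ)) =
      fun w => ((Real.pi⁻¹ * (1 + w ^ 2)⁻¹ : ℝ) : ℂ) := funext fourier_exp_neg_abs
  have h := congrFun (Continuous.fourierInv_fourier_eq (by fun_prop) integrable_exp_neg_abs
    (by rw [hF]; exact (integrable_inv_one_add_sq.const_mul _).ofReal)) (-x)
  rw [hF, Real.fourierInv_eq', abs_neg] at h
  rw [← h]
  refine integral_congr_ae (Eventually.of_forall fun s => ?_)
  simp only [smul_eq_mul]
  rw [mul_comm]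
  congr 3
  simp
  ring

/-- The averaging operator with symbol `κ e^{-2πτ|ξ_j - a|}`. -/
@[reducible]
def poissonMean (j : Fin 2) (a τ κ : ℝ) : TransMean where
  S := ℝ
  ν := volume
  K s := (κ : ℂ) * (((Real.pi⁻¹ * (1 + s ^ 2)⁻¹ : ℝ) : ℂ) *
    Complex.exp (((2 * Real.pi * (s * (τ * a)) : ℝ) : ℂ) * Complex.I))
  γ s := (s * τ) • ev j
  hK := by
    refine Integrable.const_mul ?_ _
    refine Integrable.mul_bdd (c := 1) (integrable_inv_one_add_sq.const_mul _).ofReal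
      (Continuous.aestronglyMeasurable (by fun_prop)) (Eventually.of_forall fun s => ?_)
    exact (Complex.norm_exp_ofReal_mul_I _).le
  hγ := by fun_prop

theorem mass_poissonMean (j : Fin 2) (a τ : ℝ) {κ : ℝ} (hκ : 0 ≤ κ) :
    (poissonMean j a τ κ).mass = κ := by
  unfold TransMean.mass
  have : ∀ s : ℝ, ‖(κ : ℂ) * (((Real.pi⁻¹ * (1 + s ^ 2)⁻¹ : ℝ) : ℂ) *
      Complex.exp (((2 * Real.pi * (s * (τ * a)) : ℝ) : ℂ) * Complex.I))‖ =
      κ * (Real.pi⁻¹ * (1 + s ^ 2)⁻¹) := fun s => by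
    rw [norm_mul, norm_mul, Complex.norm_exp_ofReal_mul_I, mul_one, Complex.norm_real,
      Complex.norm_real, Real.norm_of_nonneg hκ, Real.norm_of_nonneg]
    have := Real.pi_pos
    positivity
  simp only [this]
  rw [integral_const_mul, integral_const_mul, integral_univ_inv_one_add_sq,
    inv_mul_cancel₀ Real.pi_ne_zero, mul_one]

theorem symbol_poissonMean (j : Fin 2) (a τ κ : ℝ) (ξ : Plane) :
    (poissonMean j a τ κ).symbol ξ =
      ((κ * Real.exp (-(2 * Real.pi * |τ * (ξ j - a)|)) : ℝ) : ℂ) := by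
  rw [Complex.ofReal_mul, Complex.ofReal_exp, ← integral_poisson, ← integral_const_mul]
  refine integral_congr_ae (Eventually.of_forall fun s => ?_)
  simp only [ph, inner_smul_ev]
  rw [mul_assoc, mul_assoc, ← Complex.exp_add]
  congr 3
  push_cast
  ring

theorem op_eq_eop {R τ : ℝ} {j : Fin 2} {f : L2x} (hf : Band R f) (U : TransMean)
    (hU : ∀ᵐ ξ, (𝓕 f : L2x) ξ ≠ 0 → U.symbol ξ = Complex.exp (τ * (2 * Real.pi * ξ j : ℝ))) :
    U.op f = eop R j τ f := by
  apply fourier_injective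
  filter_upwards [hf, hU, U.fourier_op f, fourier_mop _ (memLp_expSymbol R j τ) f]
    with ξ h1 h2 h3 h4
  rw [eop, h3, h4]
  by_cases h0 : (𝓕 f : L2x) ξ = 0
  · rw [h0, mul_zero, mul_zero]
  · rw [h2 h0, expSymbol, if_pos]
    by_contra h
    exact h0 (h1 (not_le.1 h))

/-- On functions with frequencies in the half-plane `{θ ξ_j ≥ c}`, the operator `e^{iθτ∂_j}` is
an average of translations of total mass `e^{-2πτc}`. -/
theorem poissonMean_op_eq_of_le {R c τ θ : ℝ} {j : Fin 2} {f : L2x} (hf : Band R f)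
    (hθ : θ * θ = 1) (hτ : 0 ≤ τ) (hc : ∀ᵐ ξ, (𝓕 f : L2x) ξ ≠ 0 → c ≤ θ * ξ j) :
    (poissonMean j (θ * c) τ (Real.exp (-(2 * Real.pi * (τ * c))))).op f =
      eop R j (-θ * τ) f := by
  refine op_eq_eop hf _ ?_
  filter_upwards [hc] with ξ h1 h2
  -- On the half-plane the absolute value opens with a fixed sign, and the prefactor e^{-2πτc}
  -- cancels the shift, leaving e^{-2πτθξ_j}.
  have h3 : |τ * (ξ j - θ * c)| = τ * (θ * ξ j - c) := by
    have : ξ j - θ * c = θ * (θ * ξ j - c) := by linear_combination (-ξ j) * hθ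
    rw [this, abs_mul, abs_mul, abs_of_nonneg hτ, abs_of_nonneg (sub_nonneg.2 (h1 h2))]
    have : |θ| = 1 := by
      have := abs_mul_abs_self θ
      nlinarith [abs_nonneg θ]
    rw [this, one_mul]
  rw [symbol_poissonMean, h3, ← Real.exp_add, Complex.ofReal_exp]
  congr 1
  push_cast
  ring

/-- On functions with frequencies in the strip `{|ξ_j| ≤ M}`, the operator `e^{-iθτ∂_j}` is
an average of translations of total mass `e^{2πτM}`. -/
theorem poissonMean_op_eq_of_abs_le {R M τ θ : ℝ} {j : Fin 2} {f : L2x} (hf : Band R f)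
    (hθ : θ * θ = 1) (hτ : 0 ≤ τ) (hM : ∀ᵐ ξ, (𝓕 f : L2x) ξ ≠ 0 → θ * ξ j ≤ M) :
    (poissonMean j (θ * M) τ (Real.exp (2 * Real.pi * (τ * M)))).op f =
      eop R j (θ * τ) f := by
  -- The one-sided bound θξ_j ≤ M is the half-plane condition for the sign -θ and the level -M.
  have h := poissonMean_op_eq_of_le (R := R) (c := -M) (τ := τ) (θ := -θ) (j := j) hf
    (by rw [neg_mul_neg, hθ]) hτ (by
      filter_upwards [hM] with ξ h1 h2
      have := h1 h2
      linarith)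
  simpa using h

/-! ### Pointwise bounds for averages of translations -/

theorem measurable_coeFn (f : L2x) : Measurable (f : Plane → ℂ) :=
  (Lp.stronglyMeasurable f).measurable

theorem pairL1_indicator {s : Set Plane} (hs : MeasurableSet s) (hsf : volume s ≠ ⊤) (p : L2x) :
    pairL1 p (indicatorConstLp 2 hs hsf (1 : ℂ)) = ∫⁻ x in s, ‖p x‖ₑ := by
  unfold pairL1
  rw [← lintegral_indicator hs]
  refine lintegral_congr_ae ?_
  filter_upwards [indicatorConstLp_coeFn (p := 2) (hs := hs) (hμs := hsf) (c := (1 : ℂ))]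
    with x hx
  rw [hx]
  by_cases h : x ∈ s <;> simp [h]

theorem TransMean.measurable_shift (A : TransMean) (f : L2x) :
    Measurable fun z : Plane × A.S => ‖f (z.1 - A.γ z.2)‖ₑ :=
  ((measurable_coeFn f).comp
    (measurable_fst.sub (A.hγ.comp measurable_snd))).enorm

/-- The pointwise bound follows from its integrals over sets of finite measure; each of these is the
L¹ pairing bound against an indicator. -/
theorem TransMean.enorm_op_le (A : TransMean) (f : L2x) :
    ∀ᵐ x, ‖A.op f x‖ₑ ≤ ∫⁻ s, ‖A.K s‖ₑ * ‖f (x - A.γ s)‖ₑ ∂A.ν := by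
  refine ae_le_of_forall_setLIntegral_le_of_sigmaFinite (measurable_coeFn _).enorm
    fun s hs hsf => ?_
  have h := A.pairL1_op_le f (indicatorConstLp 2 hs hsf.ne (1 : ℂ))
  rw [pairL1_indicator] at h
  refine h.trans ?_
  have hm : AEMeasurable (Function.uncurry fun (x : Plane) (a : A.S) =>
      ‖A.K a‖ₑ * ‖f (x - A.γ a)‖ₑ) ((volume.restrict s).prod A.ν) := by
    have h1 : AEMeasurable (fun z : Plane × A.S => ‖A.K z.2‖ₑ) ((volume.restrict s).prod A.ν) :=
      A.hK.aestronglyMeasurable.enorm.comp_snd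
    have h2 : AEMeasurable (fun z : Plane × A.S => ‖f (z.1 - A.γ z.2)‖ₑ)
        ((volume.restrict s).prod A.ν) := (A.measurable_shift f).aemeasurable
    exact h1.mul h2
  refine le_of_le_of_eq ?_ (lintegral_lintegral_swap hm).symm
  refine lintegral_mono fun z => ?_
  have hz : Measurable fun x : Plane => ‖f (x - A.γ z)‖ₑ :=
    ((measurable_coeFn f).comp (measurable_id.sub_const _)).enorm
  refine le_of_le_of_eq (mul_le_mul_right ?_ _) (lintegral_const_mul _ hz).symm
  rw [pairL1_indicator]
  refine le_of_eq (lintegral_congr_ae (ae_restrict_of_ae ?_))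
  filter_upwards [coeFn_trans (A.γ z) f] with x hx
  rw [hx]

/-- Cauchy-Schwarz after writing km as k^{1/2} times k^{1/2}m. -/
theorem sq_lintegral_mul_le {α : Type*} [MeasurableSpace α] {μ : Measure α} {k m : α → ℝ≥0∞}
    (hk : AEMeasurable k μ) (hm : AEMeasurable m μ) :
    (∫⁻ a, k a * m a ∂μ) ^ 2 ≤ (∫⁻ a, k a ∂μ) * ∫⁻ a, k a * m a ^ 2 ∂μ := by
  have hh := ENNReal.lintegral_mul_le_Lp_mul_Lq μ Real.HolderConjugate.two_two
    (hk.pow_const (1 / 2 : ℝ)) ((hk.pow_const (1 / 2 : ℝ)).mul hm)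
  have e0 : ∀ a, k a ^ (1 / 2 : ℝ) * k a ^ (1 / 2 : ℝ) = k a := fun a => by
    rw [← ENNReal.rpow_add_of_nonneg _ _ (by norm_num) (by norm_num)]; norm_num
  have e1 : ∀ a, (k a ^ (1 / 2 : ℝ)) ^ (2 : ℝ) = k a := fun a => by
    rw [← ENNReal.rpow_mul]; norm_num
  have e2 : ∀ a, (k a ^ (1 / 2 : ℝ) * m a) ^ (2 : ℝ) = k a * m a ^ 2 := fun a => by
    rw [ENNReal.mul_rpow_of_nonneg _ _ (by norm_num), e1, ← ENNReal.rpow_natCast]; norm_num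
  simp only [Pi.mul_apply, ← mul_assoc, e0, e1, e2] at hh
  refine (pow_le_pow_left' hh 2).trans (le_of_eq ?_)
  rw [mul_pow, ← ENNReal.rpow_natCast, ← ENNReal.rpow_natCast, ← ENNReal.rpow_mul,
    ← ENNReal.rpow_mul]
  norm_num

theorem TransMean.enorm_op_sq_le (A : TransMean) (f : L2x) :
    ∀ᵐ x, ‖A.op f x‖ₑ ^ 2 ≤
      ENNReal.ofReal A.mass * ∫⁻ s, ‖A.K s‖ₑ * ‖f (x - A.γ s)‖ₑ ^ 2 ∂A.ν := by
  filter_upwards [A.enorm_op_le f] with x hx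
  refine (pow_le_pow_left' hx 2).trans ?_
  rw [TransMean.mass, ofReal_integral_norm_eq_lintegral_enorm A.hK]
  exact sq_lintegral_mul_le A.hK.aestronglyMeasurable.enorm
    ((A.measurable_shift f).comp (measurable_const.prodMk measurable_id)).aemeasurable

theorem lintegral_eq_scale {N : ℝ} (hN : 0 < N) (x : Plane) {H : Plane → ℝ≥0∞}
    (hH : Measurable H) :
    ∫⁻ z, H z = ENNReal.ofReal (N ^ 2) * ∫⁻ y, H (N • (x - y)) := by
  have e1 : ∫⁻ y, H (N • (x - y)) = ∫⁻ u, H (N • u) :=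
    lintegral_sub_left_eq_self (fun u => H (N • u)) x
  have e2 : ∫⁻ u, H (N • u) = ∫⁻ z, H z ∂(Measure.map (fun u : Plane => N • u) volume) :=
    (lintegral_map hH (by fun_prop)).symm
  rw [e1, e2, Measure.map_addHaar_smul _ hN.ne', lintegral_smul_measure, finrank_euclideanSpace,
    Fintype.card_fin, smul_eq_mul, ← mul_assoc, ← ENNReal.ofReal_mul (by positivity),
    abs_of_pos (by positivity), mul_inv_cancel₀ (by positivity), ENNReal.ofReal_one, one_mul]

theorem ofReal_form_dens (j : Fin 2) {w : BoundedContinuousFunction ℝ ℝ} (hw : ∀ s, 0 ≤ w s)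
    (p q : L2x) :
    ENNReal.ofReal (form j w (dens p p) (dens q q)) =
      ∫⁻ x, ∫⁻ y, ‖p x‖ₑ ^ 2 * ‖q y‖ₑ ^ 2 * ENNReal.ofReal (w (x j - y j)) := by
  have hd : ∀ p : L2x, dens p p =ᵐ[volume] fun x => ‖p x‖ ^ 2 := fun p => by
    filter_upwards [coeFn_dens p p] with x hx
    rw [hx, real_inner_self_eq_norm_sq]
  have he : ∀ᵐ z : Plane × Plane ∂(volume.prod volume),
      dens p p z.1 * dens q q z.2 * w (z.1 j - z.2 j) =
        ‖p z.1‖ ^ 2 * ‖q z.2‖ ^ 2 * w (z.1 j - z.2 j) := by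
    filter_upwards [ae_prod_fst (hd p), ae_prod_snd (hd q)] with z h1 h2
    rw [h1, h2]
  have hi := (integrable_form j w (dens p p) (dens q q)).congr he
  rw [form_apply, integral_congr_ae he, ofReal_integral_eq_lintegral_ofReal hi
    (Eventually.of_forall fun z => mul_nonneg (by positivity) (hw _)),
    lintegral_prod _ hi.aestronglyMeasurable.aemeasurable.ennreal_ofReal]
  refine lintegral_congr fun x => lintegral_congr fun y => ?_
  rw [ENNReal.ofReal_mul (by positivity), ENNReal.ofReal_mul (by positivity),
    ENNReal.ofReal_pow (norm_nonneg _), ENNReal.ofReal_pow (norm_nonneg _), ofReal_norm,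
    ofReal_norm]

/-! ### The Cauchy weight -/

/-- A primitive of the Cauchy weight. -/
def cauchyPrim (N : ℝ) : BoundedContinuousFunction ℝ ℝ :=
  BoundedContinuousFunction.ofNormedAddCommGroup (fun s => Real.arctan (N * s)) (by fun_prop)
    (Real.pi / 2) fun s => by
      rw [Real.norm_eq_abs, abs_le]
      exact ⟨(Real.neg_pi_div_two_lt_arctan _).le, (Real.arctan_lt_pi_div_two _).le⟩

theorem continuous_cauchy (N : ℝ) : Continuous fun s : ℝ => N * (1 + (N * s) ^ 2)⁻¹ :=
  continuous_const.mul (Continuous.inv₀ (by fun_prop) fun s => by positivity)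

/-- The Cauchy weight `N / (1 + N²s²)`. -/
def cauchyWeight (N : ℝ) : BoundedContinuousFunction ℝ ℝ :=
  BoundedContinuousFunction.ofNormedAddCommGroup (fun s => N * (1 + (N * s) ^ 2)⁻¹)
    (continuous_cauchy N) |N| fun s => by
      rw [norm_mul, Real.norm_eq_abs, Real.norm_of_nonneg (by positivity)]
      refine mul_le_of_le_one_right (abs_nonneg N) (inv_le_one_of_one_le₀ ?_)
      nlinarith [sq_nonneg (N * s)]

theorem cauchyWeight_apply (N s : ℝ) : cauchyWeight N s = N * (1 + (N * s) ^ 2)⁻¹ := rfl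

/-- The bound does not depend on N. The weight has height N, but its primitive stays bounded, so the
virial estimate loses nothing. -/
theorem norm_cauchyPrim_le (N : ℝ) : ‖cauchyPrim N‖ ≤ Real.pi / 2 :=
  BoundedContinuousFunction.norm_ofNormedAddCommGroup_le _ (by positivity) _

theorem abs_arctan_taylor_le (x k : ℝ) :
    |Real.arctan (x + k) - Real.arctan x - k * (1 + x ^ 2)⁻¹| ≤ k ^ 2 := by
  have hd : ∀ u ∈ Set.uIcc 0 k,
      HasDerivWithinAt (fun u => Real.arctan (x + u) - u * (1 + x ^ 2)⁻¹)
        ((1 + (x + u) ^ 2)⁻¹ - (1 + x ^ 2)⁻¹) (Set.uIcc 0 k) u := fun u _ => by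
    have h1 : HasDerivAt (fun u => Real.arctan (x + u)) (1 / (1 + (x + u) ^ 2) * 1) u :=
      ((hasDerivAt_id u).const_add x).arctan
    have h2 := (hasDerivAt_id u).mul_const (1 + x ^ 2)⁻¹
    exact ((h1.sub h2).congr_deriv (by simp)).hasDerivWithinAt
  have hb : ∀ u ∈ Set.uIcc 0 k, ‖(1 + (x + u) ^ 2)⁻¹ - (1 + x ^ 2)⁻¹‖ ≤ |k| := fun u hu => by
    have hu' : |u| ≤ |k| := by
      have := Set.abs_sub_left_of_mem_uIcc hu
      simpa using this
    refine le_trans ?_ hu'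
    -- The remaining quotient is at most 1 in absolute value: 2x + u is the sum of x and x + u, and
    -- |x + y| ≤ (1 + x²)(1 + y²).
    have e : (1 + (x + u) ^ 2)⁻¹ - (1 + x ^ 2)⁻¹ =
        -u * ((2 * x + u) / ((1 + (x + u) ^ 2) * (1 + x ^ 2))) := by
      field_simp; ring
    rw [e, norm_mul, norm_neg, Real.norm_eq_abs]
    refine mul_le_of_le_one_right (abs_nonneg u) ?_
    rw [Real.norm_eq_abs, abs_div, abs_of_pos (a := (1 + (x + u) ^ 2) * (1 + x ^ 2))
      (by positivity), div_le_one (by positivity), abs_le]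
    constructor <;> nlinarith [sq_nonneg (x + u + 1), sq_nonneg (x + 1), sq_nonneg (x + u - 1),
      sq_nonneg (x - 1), mul_nonneg (sq_nonneg (x + u)) (sq_nonneg x)]
  have h := (convex_uIcc 0 k).norm_image_sub_le_of_norm_hasDerivWithin_le hd hb
    Set.left_mem_uIcc Set.right_mem_uIcc
  simp only [add_zero, zero_mul, sub_zero, Real.norm_eq_abs, abs_mul_abs_self] at h
  rw [← pow_two] at h
  rwa [sub_right_comm]

theorem isWeightDeriv_cauchy (N : ℝ) : IsWeightDeriv (cauchyPrim N) (cauchyWeight N) := by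
  refine ⟨N ^ 2, fun s h => ?_⟩
  have := abs_arctan_taylor_le (N * s) (N * h)
  refine le_of_eq_of_le (congrArg _ ?_) (this.trans_eq (mul_pow N h 2))
  change Real.arctan (N * (s + h)) - Real.arctan (N * s) - h * (N * (1 + (N * s) ^ 2)⁻¹) = _
  rw [mul_add]; ring

/-! ### A one-dimensional Bernstein estimate -/

/-- By Cauchy-Schwarz |Kq|² is at most the mass of K times an average of |q|² with density
N²|K(N·)|. Decay of K in the single variable z_j bounds that density by C N times the Cauchy weight,
so only one power of N is paid, as in one dimension. -/
theorem lintegral_enorm_mul_op_sq_le (K : SchwartzMap Plane ℂ) {C N : ℝ} (hC : 0 ≤ C)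
    (hN : 0 < N) (j : Fin 2) (hK : ∀ z : Plane, ‖K z‖ ≤ C * (1 + z j ^ 2)⁻¹) (p q : L2x) :
    ∫⁻ x, ‖p x * (schwartzMean K N⁻¹).op q x‖ₑ ^ 2 ≤
      ENNReal.ofReal ((schwartzMean K N⁻¹).mass * C * N) *
        ENNReal.ofReal (form j (cauchyWeight N) (dens p p) (dens q q)) := by
  have hw : ∀ s, 0 ≤ cauchyWeight N s := fun s => by
    rw [cauchyWeight_apply]; positivity
  have hmq := measurable_coeFn q
  have key : ∀ x, ∫⁻ z, ‖K z‖ₑ * ‖q (x - N⁻¹ • z)‖ₑ ^ 2 ≤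
      ENNReal.ofReal (C * N) * ∫⁻ y, ‖q y‖ₑ ^ 2 * ENNReal.ofReal (cauchyWeight N (x j - y j)) :=
    fun x => by
    have hH : Measurable fun z => ‖K z‖ₑ * ‖q (x - N⁻¹ • z)‖ₑ ^ 2 :=
      K.continuous.measurable.enorm.mul
        ((hmq.comp (by fun_prop : Measurable fun z => x - N⁻¹ • z)).enorm.pow_const 2)
    have hm2 : Measurable fun y : Plane =>
        ‖q y‖ₑ ^ 2 * ENNReal.ofReal (cauchyWeight N (x j - y j)) :=
      (hmq.enorm.pow_const 2).mul (((cauchyWeight N).continuous.comp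
        (by fun_prop : Continuous fun y : Plane => x j - y j)).measurable.ennreal_ofReal)
    rw [lintegral_eq_scale hN x hH, ← lintegral_const_mul _ hm2,
      ← lintegral_const_mul _ (show Measurable fun y : Plane =>
        ‖K (N • (x - y))‖ₑ * ‖q (x - N⁻¹ • N • (x - y))‖ₑ ^ 2 from
        hH.comp (by fun_prop : Measurable fun y : Plane => N • (x - y)))]
    refine lintegral_mono fun y => ?_
    have e1 : x - N⁻¹ • N • (x - y) = y := by
      rw [inv_smul_smul₀ hN.ne', sub_sub_cancel]
    simp only [e1]
    calc _ = ENNReal.ofReal (N ^ 2 * ‖K (N • (x - y))‖) * ‖q y‖ₑ ^ 2 := by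
          rw [ENNReal.ofReal_mul (by positivity), ofReal_norm, mul_assoc]
      _ ≤ ENNReal.ofReal (C * N * cauchyWeight N (x j - y j)) * ‖q y‖ₑ ^ 2 := by
          refine mul_le_mul_left (ENNReal.ofReal_le_ofReal ?_) _
          refine (mul_le_mul_of_nonneg_left (hK _) (sq_nonneg N)).trans (le_of_eq ?_)
          rw [cauchyWeight_apply]
          simp only [PiLp.smul_apply, PiLp.sub_apply, smul_eq_mul]
          ring
      _ = _ := by
          rw [ENNReal.ofReal_mul (by positivity)]; ring
  rw [ofReal_form_dens j hw, mul_assoc _ C N,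
    ENNReal.ofReal_mul (TransMean.mass_nonneg _), mul_assoc]
  have hm3 : Measurable fun x : Plane =>
      ∫⁻ y, ‖p x‖ₑ ^ 2 * ‖q y‖ₑ ^ 2 * ENNReal.ofReal (cauchyWeight N (x j - y j)) := by
    suffices h : Measurable fun z : Plane × Plane =>
        ‖p z.1‖ₑ ^ 2 * ‖q z.2‖ₑ ^ 2 * ENNReal.ofReal (cauchyWeight N (z.1 j - z.2 j)) from
      h.lintegral_prod_right'
    refine ((((measurable_coeFn p).comp measurable_fst).enorm.pow_const 2).mul
      ((hmq.comp measurable_snd).enorm.pow_const 2)).mul ?_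
    exact ((cauchyWeight N).continuous.comp
      (by fun_prop : Continuous fun z : Plane × Plane => z.1 j - z.2 j)).measurable.ennreal_ofReal
  rw [← lintegral_const_mul _ hm3, ← lintegral_const_mul _ (hm3.const_mul _)]
  refine lintegral_mono_ae ?_
  filter_upwards [(schwartzMean K N⁻¹).enorm_op_sq_le q] with x hx
  rw [enorm_mul, mul_pow]
  refine (mul_le_mul_right hx _).trans ?_
  rw [mul_left_comm]
  refine mul_le_mul_right ?_ _
  refine (mul_le_mul_right (key x) _).trans (le_of_eq ?_)
  rw [mul_left_comm]
  congr 1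
  rw [← lintegral_const_mul]
  · simp only [mul_assoc]
  · exact (hmq.enorm.pow_const 2).mul (((cauchyWeight N).continuous.comp
        (by fun_prop : Continuous fun y : Plane => x j - y j)).measurable.ennreal_ofReal)

/-! ### The `L²` norm of a product -/

/-- The square of the `L²` norm of a product of two `L²` functions. -/
def sqPair (p q : L2x) : ℝ≥0∞ := ∫⁻ x, ‖p x * q x‖ₑ ^ 2

/-- The map (p, q) ↦ ∫|pq|² is not continuous on L² × L². These truncated squares act continuously
on L¹ and increase to it, which makes `sqPair` measurable in time. -/
theorem lipschitz_truncSq (n : ℕ) :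
    LipschitzWith (2 * n : ℝ≥0) fun z : ℂ => (min ‖z‖ n) ^ 2 := by
  refine LipschitzWith.of_dist_le_mul fun z w => ?_
  have h1 : |min ‖z‖ (n : ℝ) - min ‖w‖ n| ≤ ‖z - w‖ :=
    (abs_min_sub_min_le_max _ _ _ _).trans (by
      rw [sub_self, abs_zero]
      exact max_le (abs_norm_sub_norm_le z w) (norm_nonneg _))
  have hz : 0 ≤ min ‖z‖ (n : ℝ) := le_min (norm_nonneg _) n.cast_nonneg
  have hw : 0 ≤ min ‖w‖ (n : ℝ) := le_min (norm_nonneg _) n.cast_nonneg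
  rw [Real.dist_eq, dist_eq_norm, sq_sub_sq, abs_mul, abs_of_nonneg (add_nonneg hz hw)]
  push_cast
  have hz' := min_le_right ‖z‖ (n : ℝ)
  have hw' := min_le_right ‖w‖ (n : ℝ)
  exact mul_le_mul (by linarith) h1 (abs_nonneg _) (by positivity)

theorem iSup_enorm_truncSq (z : ℂ) :
    ⨆ n : ℕ, ‖(min ‖z‖ (n : ℝ)) ^ 2‖ₑ = ‖z‖ₑ ^ 2 := by
  refine le_antisymm (iSup_le fun n => ?_) ?_
  · rw [← ofReal_norm, ← ofReal_norm, ← ENNReal.ofReal_pow (norm_nonneg _), norm_pow,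
      Real.norm_of_nonneg (le_min (norm_nonneg _) n.cast_nonneg)]
    exact ENNReal.ofReal_le_ofReal (pow_le_pow_left₀ (le_min (norm_nonneg _) n.cast_nonneg)
      (min_le_left _ _) 2)
  · obtain ⟨n, hn⟩ := exists_nat_ge ‖z‖
    refine le_iSup_of_le n (le_of_eq ?_)
    rw [min_eq_left hn, enorm_pow, enorm_norm]

theorem sqPair_eq_iSup (p q : L2x) :
    sqPair p q = ⨆ n : ℕ, ‖(lipschitz_truncSq n).compLp (by simp) (mulL p q)‖ₑ := by
  have e : ∀ n : ℕ, ‖(lipschitz_truncSq n).compLp (by simp) (mulL p q)‖ₑ =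
      ∫⁻ x, ‖(min ‖p x * q x‖ (n : ℝ)) ^ 2‖ₑ := fun n => by
    rw [Lp.enorm_def, eLpNorm_one_eq_lintegral_enorm]
    refine lintegral_congr_ae ?_
    filter_upwards [(lipschitz_truncSq n).coeFn_compLp (by simp) (mulL p q), coeFn_mulL p q]
      with x h1 h2
    rw [h1, Function.comp_apply, h2]
  have hm : Measurable fun x => p x * q x := (measurable_coeFn p).mul (measurable_coeFn q)
  simp only [e]
  rw [← lintegral_iSup]
  · simp only [iSup_enorm_truncSq, sqPair]
  · exact fun n => ((hm.norm.min measurable_const).pow_const 2).enorm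
  · intro m n hmn x
    have h0 : ∀ k : ℕ, 0 ≤ min ‖p x * q x‖ (k : ℝ) := fun k =>
      le_min (norm_nonneg _) k.cast_nonneg
    change ‖_‖ₑ ≤ ‖_‖ₑ
    rw [Real.enorm_eq_ofReal (sq_nonneg _), Real.enorm_eq_ofReal (sq_nonneg _)]
    exact ENNReal.ofReal_le_ofReal (pow_le_pow_left₀ (h0 m)
      (min_le_min_left _ (Nat.cast_le.2 hmn)) 2)

theorem aemeasurable_sqPair {μ : Measure ℝ} {f g : ℝ → L2x} (hf : AEStronglyMeasurable f μ)
    (hg : AEStronglyMeasurable g μ) : AEMeasurable (fun t => sqPair (f t) (g t)) μ := by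
  simp only [sqPair_eq_iSup]
  refine AEMeasurable.iSup fun n => ?_
  have hc : Continuous fun z : L2x × L2x =>
      ‖(lipschitz_truncSq n).compLp (by simp) (mulL z.1 z.2)‖ₑ :=
    continuous_enorm.comp (((lipschitz_truncSq n).continuous_compLp (by simp)).comp
      mulL.isBoundedBilinearMap.continuous)
  exact (hc.comp_aestronglyMeasurable (hf.prodMk hg)).aemeasurable

theorem sqPair_comm (p q : L2x) : sqPair p q = sqPair q p := by
  simp only [sqPair, mul_comm]

theorem sqPair_trans (z : Plane) (p q : L2x) : sqPair (trans z p) (trans z q) = sqPair p q := by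
  unfold sqPair
  rw [← lintegral_sub_right_eq_self (fun x => ‖p x * q x‖ₑ ^ 2) z]
  refine lintegral_congr_ae ?_
  filter_upwards [coeFn_trans z p, coeFn_trans z q] with x h1 h2
  rw [h1, h2]

/-- Cauchy-Schwarz for |p|² and |q|², that is, Hölder with two L⁴ norms. -/
theorem sq_sqPair_le (p q : L2x) : sqPair p q ^ 2 ≤ sqPair p p * sqPair q q := by
  have hp := (measurable_coeFn p).enorm
  have hq := (measurable_coeFn q).enorm
  have hh := ENNReal.lintegral_mul_le_Lp_mul_Lq volume Real.HolderConjugate.two_two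
    (hp.pow_const 2).aemeasurable (hq.pow_const 2).aemeasurable
  have e : ∀ a : ℝ≥0∞, (a ^ 2) ^ (2 : ℝ) = (a * a) ^ 2 := fun a => by
    rw [← pow_two, ENNReal.rpow_two]
  simp only [Pi.mul_apply, e, ← enorm_mul] at hh
  simp only [← mul_pow, ← enorm_mul] at hh
  refine (pow_le_pow_left' hh 2).trans (le_of_eq ?_)
  rw [mul_pow, ← ENNReal.rpow_natCast, ← ENNReal.rpow_natCast, ← ENNReal.rpow_mul,
    ← ENNReal.rpow_mul]
  norm_num [sqPair]

theorem sqPair_sum_le {ι : Type*} [Fintype ι] (p : ι → L2x) (q : L2x) :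
    sqPair (∑ i, p i) q ≤ Fintype.card ι * ∑ i, sqPair (p i) q := by
  have hm : ∀ i, Measurable fun x => ‖p i x * q x‖ₑ ^ 2 := fun i =>
    (((measurable_coeFn (p i)).mul (measurable_coeFn q)).enorm.pow_const 2)
  unfold sqPair
  rw [← lintegral_finsetSum _ fun i _ => hm i,
    ← lintegral_const_mul _ (Finset.measurable_fun_sum _ fun i _ => hm i)]
  refine lintegral_mono_ae ?_
  filter_upwards [Lp.coeFn_fun_finsetSum Finset.univ p] with x hx
  rw [hx, Finset.sum_mul]
  have h1 := ENNReal.rpow_sum_le_const_mul_sum_rpow Finset.univ (fun i => ‖p i x * q x‖ₑ)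
    (p := 2) (by norm_num)
  refine (pow_le_pow_left' (enorm_sum_le _ _) 2).trans ?_
  simp only [ENNReal.rpow_two] at h1
  refine h1.trans (le_of_eq ?_)
  norm_num

/-! ### Bilinear estimate on compact intervals -/

theorem form_dens_nonneg (j : Fin 2) {w : BoundedContinuousFunction ℝ ℝ} (hw : ∀ s, 0 ≤ w s)
    (p q : L2x) : 0 ≤ form j w (dens p p) (dens q q) := by
  rw [form_apply]
  refine integral_nonneg_of_ae ?_
  filter_upwards [ae_prod_fst (coeFn_dens p p), ae_prod_snd (coeFn_dens q q)] with z h1 h2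
  rw [h1, h2]
  exact mul_nonneg (mul_nonneg real_inner_self_nonneg real_inner_self_nonneg) (hw _)

theorem cauchyWeight_nonneg {N : ℝ} (hN : 0 ≤ N) (s : ℝ) : 0 ≤ cauchyWeight N s := by
  rw [cauchyWeight_apply]; positivity

theorem lintegral_sqPair_le_of_separated {S a b A B X Y c m δ D ν θ : ℝ} (hab : a ≤ b)
    {f N g M : ℝ → L2x} (hf : BandSolution S a b f N A X) (hg : BandSolution S a b g M B Y)
    (j : Fin 2) (hθ : θ * θ = 1) (hδ : 0 < δ) (hδ' : δ ≤ 4 * Real.pi * (c - m))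
    (hc : ∀ t ∈ Set.Icc a b, ∀ᵐ ξ, (𝓕 (f t) : L2x) ξ ≠ 0 → c ≤ θ * ξ j)
    (hm : ∀ t ∈ Set.Icc a b, ∀ᵐ ξ, (𝓕 (g t) : L2x) ξ ≠ 0 → θ * ξ j ≤ m)
    (K : SchwartzMap Plane ℂ) (hD : 0 ≤ D) (hν : 0 < ν)
    (hK : ∀ z : Plane, ‖K z‖ ≤ D * (1 + z j ^ 2)⁻¹)
    (hop : ∀ t ∈ Set.Icc a b, (schwartzMean K ν⁻¹).op (g t) = g t) :
    ∫⁻ t in Set.Icc a b, sqPair (f t) (g t) ≤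
      ENNReal.ofReal ((schwartzMean K ν⁻¹).mass * D * ν *
        (Real.pi * (A ^ 2 * B ^ 2 + X * B ^ 2 + A ^ 2 * Y) / δ)) := by
  have hX := hf.nonneg
  have hY := hg.nonneg
  have hθ' : |θ| = 1 := by
    have := abs_mul_abs_self θ
    nlinarith [abs_nonneg θ]
  have hmain := integral_form_le hab hδ hθ' hf hg (isWeightDeriv_cauchy ν) j
    (fun τ => poissonMean j (θ * c) τ (Real.exp (-(2 * Real.pi * (τ * c)))))
    (fun τ => poissonMean j (θ * m) τ (Real.exp (2 * Real.pi * (τ * m))))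
    (fun τ hτ t ht => poissonMean_op_eq_of_le (hf.band t ht) hθ hτ.le (hc t ht))
    (fun τ hτ t ht => poissonMean_op_eq_of_abs_le (hg.band t ht) hθ hτ.le (hm t ht))
    -- The squared masses multiply to e^{-4πτ(c-m)}, which is where the condition on δ comes from.
    (fun τ hτ => by
      rw [mass_poissonMean _ _ _ (Real.exp_pos _).le, mass_poissonMean _ _ _ (Real.exp_pos _).le,
        ← Real.exp_nat_mul, ← Real.exp_nat_mul, ← Real.exp_add, Real.exp_le_exp]
      push_cast
      nlinarith [mul_le_mul_of_nonneg_right hδ' hτ.le])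
  have hcont : ContinuousOn (fun t => form j (cauchyWeight ν) (dens (f t) (f t))
      (dens (g t) (g t))) (Set.Icc a b) := by
    have h1 := hf.prim_dens.continuousOn
    have h2 := hg.prim_dens.continuousOn
    exact (form j (cauchyWeight ν)).isBoundedBilinearMap.continuous.comp_continuousOn
      (h1.prodMk h2)
  have hle : ∀ t ∈ Set.Icc a b, sqPair (f t) (g t) ≤
      ENNReal.ofReal ((schwartzMean K ν⁻¹).mass * D * ν) *
        ENNReal.ofReal (form j (cauchyWeight ν) (dens (f t) (f t)) (dens (g t) (g t))) :=
    fun t ht => by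
      have := lintegral_enorm_mul_op_sq_le K hD hν j hK (f t) (g t)
      rwa [hop t ht] at this
  refine (setLIntegral_mono' measurableSet_Icc hle).trans ?_
  rw [lintegral_const_mul' _ _ ENNReal.ofReal_ne_top,
    ← ofReal_integral_eq_lintegral_ofReal hcont.integrableOn_Icc
      (Eventually.of_forall fun t => form_dens_nonneg j (cauchyWeight_nonneg hν.le) _ _),
    ENNReal.ofReal_mul (p := (schwartzMean K ν⁻¹).mass * D * ν)
      (mul_nonneg (mul_nonneg (TransMean.mass_nonneg _) hD) hν.le)]
  gcongr
  rw [integral_Icc_eq_integral_Ioc, ← intervalIntegral.integral_of_le hab]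
  refine hmain.trans ?_
  gcongr
  -- The factor 2‖W‖ is at most π.
  linarith [norm_cauchyPrim_le ν]

/-! ### Frequency localization -/

/-- The Fourier transform is supported in the annulus `r ≤ ‖ξ‖ ≤ R`. -/
def Spec (r R : ℝ) (f : L2x) : Prop := ∀ᵐ ξ, (𝓕 f : L2x) ξ ≠ 0 → r ≤ ‖ξ‖ ∧ ‖ξ‖ ≤ R

theorem Spec.band {r R : ℝ} {f : L2x} (h : Spec r R f) : Band R f := by
  filter_upwards [h] with ξ h1 h2
  by_contra h3
  exact absurd (h1 h3).2 (not_le.2 h2)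

theorem fourier_sum {ι : Type*} [Fintype ι] (f : ι → L2x) :
    (𝓕 (∑ i, f i) : L2x) = ∑ i, 𝓕 (f i) :=
  map_sum (Lp.fourierTransformₗᵢ Plane ℂ) f Finset.univ

theorem sum_op_eq_self {ι : Type*} [Fintype ι] (A : ι → TransMean) {f : L2x}
    (h : ∀ᵐ ξ, (𝓕 f : L2x) ξ ≠ 0 → ∑ i, (A i).symbol ξ = 1) : ∑ i, (A i).op f = f := by
  apply fourier_injective
  rw [fourier_sum]
  filter_upwards [h, Lp.coeFn_fun_finsetSum Finset.univ fun i => (𝓕 ((A i).op f) : L2x),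
    ae_all_iff.2 fun i => (A i).fourier_op f] with ξ h1 h2 h3
  rw [h2, Finset.sum_congr rfl fun i _ => h3 i, ← Finset.sum_mul]
  by_cases h0 : (𝓕 f : L2x) ξ = 0
  · rw [h0, mul_zero]
  · rw [h1 h0, one_mul]

theorem exists_schwartz_fourier_eq {ρ : Plane → ℂ} (hρ : ContDiff ℝ ∞ ρ)
    (hc : HasCompactSupport ρ) :
    ∃ K : SchwartzMap Plane ℂ, ∀ ξ, (𝓕 K : SchwartzMap Plane ℂ) ξ = ρ ξ :=
  ⟨𝓕⁻ (hc.toSchwartzMap hρ), fun ξ => by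
    rw [FourierTransform.fourier_fourierInv_eq, HasCompactSupport.toSchwartzMap_toFun]⟩

theorem exists_schwartz_decay (K : SchwartzMap Plane ℂ) :
    ∃ D : ℝ, 0 ≤ D ∧ ∀ (j : Fin 2) (z : Plane), ‖K z‖ ≤ D * (1 + z j ^ 2)⁻¹ := by
  obtain ⟨D₀, hD₀, h0⟩ := K.decay 0 0
  obtain ⟨D₂, hD₂, h2⟩ := K.decay 2 0
  refine ⟨D₀ + D₂, by positivity, fun j z => ?_⟩
  have h0' := h0 z
  have h2' := h2 z
  simp only [norm_iteratedFDeriv_zero, pow_zero, one_mul] at h0' h2'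
  rw [← div_eq_mul_inv, le_div_iff₀ (by positivity)]
  have : z j ^ 2 ≤ ‖z‖ ^ 2 := by
    rw [← sq_abs]; exact pow_le_pow_left₀ (abs_nonneg _) (abs_coord_le z j) 2
  nlinarith [mul_le_mul_of_nonneg_right this (norm_nonneg (K z))]

/-- The sign attached to a half-plane. -/
def halfSign (s : Bool) : ℝ := if s then 1 else -1

theorem halfSign_mul_self (s : Bool) : halfSign s * halfSign s = 1 := by
  cases s <;> simp [halfSign]

theorem abs_halfSign (s : Bool) : |halfSign s| = 1 := by
  cases s <;> simp [halfSign]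

/-- If both coordinates were at most r/2 in absolute value, the square of the norm would be at most
r²/2. -/
theorem exists_sector {r : ℝ} (hr : 0 < r) {ξ : Plane} (h : r ≤ ‖ξ‖) :
    ∃ i : Fin 2 × Bool, r / 2 < halfSign i.2 * ξ i.1 := by
  by_contra! hh
  have hj : ∀ j, ξ j ^ 2 ≤ (r / 2) ^ 2 := fun j => by
    have h1 := hh (j, true)
    have h2 := hh (j, false)
    simp only [halfSign, if_true, one_mul, Bool.false_eq_true, if_false] at h1 h2
    exact sq_le_sq' (by linarith) h1
  have hn : ‖ξ‖ ^ 2 = ξ 0 ^ 2 + ξ 1 ^ 2 := by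
    rw [EuclideanSpace.norm_sq_eq]; simp
  nlinarith [hj 0, hj 1]

theorem exists_sector_partition {r : ℝ} (hr : 0 < r) (R : ℝ) :
    ∃ ρ : Fin 2 × Bool → Plane → ℂ, (∀ i, ContDiff ℝ ∞ (ρ i)) ∧ (∀ i, HasCompactSupport (ρ i)) ∧
      (∀ i ξ, ρ i ξ ≠ 0 → r / 2 ≤ halfSign i.2 * ξ i.1) ∧
      ∀ ξ, r ≤ ‖ξ‖ → ‖ξ‖ ≤ R → ∑ i, ρ i ξ = 1 := by
  let U : Fin 2 × Bool → Set Plane := fun i => {ξ | r / 2 < halfSign i.2 * ξ i.1 ∧ ‖ξ‖ < R + 1}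
  have hU : ∀ i, IsOpen (U i) := fun i =>
    (isOpen_lt (f := fun _ : Plane => r / 2) (g := fun ξ : Plane => halfSign i.2 * ξ i.1)
      (by fun_prop) (by fun_prop)).and (isOpen_lt continuous_norm continuous_const)
  have hs : IsClosed {ξ : Plane | r ≤ ‖ξ‖ ∧ ‖ξ‖ ≤ R} :=
    (isClosed_le continuous_const continuous_norm).and
      (isClosed_le continuous_norm continuous_const)
  obtain ⟨φ, hφ⟩ := SmoothPartitionOfUnity.exists_isSubordinate
    (modelWithCornersSelf ℝ Plane) hs U hU fun ξ hξ => by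
      obtain ⟨i, hi⟩ := exists_sector hr hξ.1
      exact Set.mem_iUnion.2 ⟨i, hi, hξ.2.trans_lt (by linarith)⟩
  have hd : ∀ i, ContDiff ℝ ∞ (φ i) := fun i => contMDiff_iff_contDiff.1 (φ i).contMDiff
  have hc : ∀ i, HasCompactSupport (φ i) := fun i =>
    Metric.isCompact_of_isClosed_isBounded (isClosed_tsupport _)
      (Metric.isBounded_ball.subset ((hφ i).trans fun ξ hξ => by
        rw [mem_ball_zero_iff]; exact hξ.2 : tsupport (φ i) ⊆ Metric.ball 0 (R + 1)))
  refine ⟨fun i ξ => (φ i ξ : ℂ), fun i => Complex.ofRealCLM.contDiff.comp (hd i),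
    fun i => (hc i).comp_left (g := fun r : ℝ => (r : ℂ)) Complex.ofReal_zero,
    fun i ξ h => ?_, fun ξ h1 h2 => ?_⟩
  · have h' : φ i ξ ≠ 0 := fun h0 => h (by simp only [h0, Complex.ofReal_zero])
    exact (hφ i (subset_tsupport _ h')).1.le
  · have := φ.sum_eq_one (x := ξ) ⟨h1, h2⟩
    rw [finsum_eq_sum_of_fintype] at this
    simp only [← Complex.ofReal_sum, this, Complex.ofReal_one]

/-- The bilinear estimate for separated frequencies, on compact time intervals. -/
theorem exists_const_lintegral_sqPair_le {r R : ℝ} (hr : 0 < r) (hR : 0 < R) :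
    ∃ C : ℝ, 0 ≤ C ∧ ∀ {lam ν S a b A B X Y : ℝ} {f N g M : ℝ → L2x}, 0 < lam → 0 < ν →
      4 * R * ν ≤ r * lam → BandSolution S a b f N A X → BandSolution S a b g M B Y →
      (∀ t ∈ Set.Icc a b, Spec (r * lam) (R * lam) (f t)) →
      (∀ t ∈ Set.Icc a b, Band (R * ν) (g t)) →
      ∫⁻ t in Set.Icc a b, sqPair (f t) (g t) ≤
        ENNReal.ofReal (C * (ν / lam) * (A ^ 2 * B ^ 2 + X * B ^ 2 + A ^ 2 * Y)) := by
  obtain ⟨ρ, hρd, hρc, hρs, hρ1⟩ := exists_sector_partition hr R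
  choose K hK using fun i => exists_schwartz_fourier_eq (hρd i) (hρc i)
  -- The bump equals 1 on the ball of radius R, so its kernel at scale 1/ν reproduces every function
  -- with frequencies at most Rν.
  let χ : ContDiffBump (0 : Plane) := ⟨R, R + 1, hR, by linarith⟩
  obtain ⟨K₂, hK₂⟩ := exists_schwartz_fourier_eq (ρ := fun ξ => (χ ξ : ℂ))
    (Complex.ofRealCLM.contDiff.comp χ.contDiff)
    (χ.hasCompactSupport.comp_left (g := fun r : ℝ => (r : ℂ)) Complex.ofReal_zero)
  obtain ⟨D, hD, hDK⟩ := exists_schwartz_decay K₂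
  have hmass : ∀ (K : SchwartzMap Plane ℂ) (c : ℝ), (schwartzMean K c).mass = ∫ z, ‖K z‖ :=
    fun _ _ => rfl
  set m₂ := ∫ z, ‖K₂ z‖ with hm₂
  have hm₂0 : 0 ≤ m₂ := integral_nonneg fun _ => norm_nonneg _
  set m := fun i => ∫ z, ‖K i z‖ with hm
  -- The 4 is the number of sectors, from squaring a sum of four terms. The π of the Cauchy
  -- primitive cancels that of δ. Kernel masses do not depend on the dilation, so the constant does
  -- not depend on lam and ν.
  refine ⟨4 * ∑ i, m₂ * D * m i ^ 2 / r, by positivity, ?_⟩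
  intro lam ν S a b A B X Y f N g M hlam hν hsep hf hg hfs hgs
  have hX := hf.nonneg
  have hY := hg.nonneg
  set E := A ^ 2 * B ^ 2 + X * B ^ 2 + A ^ 2 * Y with hE
  have hE0 : 0 ≤ E := by positivity
  rcases lt_or_ge b a with hba | hab
  · rw [Set.Icc_eq_empty (not_le.2 hba), Measure.restrict_empty, lintegral_zero_measure]
    exact zero_le
  have hop : ∀ t ∈ Set.Icc a b, (schwartzMean K₂ ν⁻¹).op (g t) = g t := fun t ht => by
    have := sum_op_eq_self (fun _ : Unit => schwartzMean K₂ ν⁻¹) (f := g t) (by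
      filter_upwards [hgs t ht] with ξ h1 h2
      have h3 : ‖ξ‖ ≤ R * ν := not_lt.1 fun h => h2 (h1 h)
      rw [Fintype.sum_unique, symbol_schwartzMean, hK₂, χ.one_of_mem_closedBall,
        Complex.ofReal_one]
      rw [mem_closedBall_zero_iff, norm_smul, norm_inv, Real.norm_of_nonneg hν.le,
        inv_mul_le_iff₀ hν, mul_comm]
      exact h3)
    rwa [Fintype.sum_unique] at this
  have hsum : ∀ t ∈ Set.Icc a b, ∑ i, (schwartzMean (K i) lam⁻¹).op (f t) = f t := fun t ht =>
    sum_op_eq_self _ (by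
      filter_upwards [hfs t ht] with ξ h1 h2
      simp only [symbol_schwartzMean, hK]
      refine hρ1 _ ?_ ?_ <;> rw [norm_smul, norm_inv, Real.norm_of_nonneg hlam.le]
      · rw [le_inv_mul_iff₀ hlam, mul_comm]; exact (h1 h2).1
      · rw [inv_mul_le_iff₀ hlam, mul_comm]; exact (h1 h2).2)
  have hone : ∀ i, ∫⁻ t in Set.Icc a b, sqPair ((schwartzMean (K i) lam⁻¹).op (f t)) (g t) ≤
      ENNReal.ofReal (m₂ * D * m i ^ 2 / r * (ν / lam) * E) := fun i => by
    -- The separation hypothesis gives Rν ≤ r lam/4, so the gap c - m is at least r lam/4 and 4π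
    -- times it is at least δ = π r lam.
    have h := lintegral_sqPair_le_of_separated (c := r / 2 * lam) (m := R * ν)
      (δ := Real.pi * r * lam) hab (hf.op (schwartzMean (K i) lam⁻¹)) hg i.1
      (halfSign_mul_self i.2) (by positivity) (by nlinarith [Real.pi_pos]) (fun t ht => by
        filter_upwards [(schwartzMean (K i) lam⁻¹).fourier_op (f t)] with ξ h1 h2
        rw [h1, symbol_schwartzMean, hK] at h2
        have h3 := hρs i _ (left_ne_zero_of_mul h2)
        rw [PiLp.smul_apply, smul_eq_mul, mul_left_comm, le_inv_mul_iff₀ hlam, mul_comm] at h3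
        exact h3) (fun t ht => by
        filter_upwards [hgs t ht] with ξ h1 h2
        have h3 : ‖ξ‖ ≤ R * ν := not_lt.1 fun h => h2 (h1 h)
        refine (le_abs_self _).trans ?_
        rw [abs_mul, abs_halfSign, one_mul]
        exact (abs_coord_le ξ _).trans h3) K₂ hD hν (hDK i.1) hop
    refine h.trans (le_of_eq (congrArg _ ?_))
    rw [hmass, hmass, hE, hm₂]
    have := Real.pi_pos
    change _ = (∫ z, ‖K₂ z‖) * D * (∫ z, ‖K i z‖) ^ 2 / r * (ν / lam) * _
    field_simp
  have hmeas : ∀ i, AEMeasurable (fun t => sqPair ((schwartzMean (K i) lam⁻¹).op (f t)) (g t))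
      (volume.restrict (Set.Icc a b)) := fun i =>
    aemeasurable_sqPair (hf.op _).aestronglyMeasurable hg.aestronglyMeasurable
  calc ∫⁻ t in Set.Icc a b, sqPair (f t) (g t)
      ≤ ∫⁻ t in Set.Icc a b, 4 * ∑ i, sqPair ((schwartzMean (K i) lam⁻¹).op (f t)) (g t) :=
        setLIntegral_mono' measurableSet_Icc fun t ht => by
          have := sqPair_sum_le (fun i => (schwartzMean (K i) lam⁻¹).op (f t)) (g t)
          rw [hsum t ht] at this
          refine this.trans (le_of_eq ?_)
          simp
    _ = 4 * ∑ i, ∫⁻ t in Set.Icc a b, sqPair ((schwartzMean (K i) lam⁻¹).op (f t)) (g t) := by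
        rw [lintegral_const_mul' _ _ (by simp), lintegral_finsetSum' _ fun i _ => hmeas i]
    _ ≤ 4 * ∑ i, ENNReal.ofReal (m₂ * D * m i ^ 2 / r * (ν / lam) * E) := by
        gcongr with i
        exact hone i
    _ = _ := by
        rw [← ENNReal.ofReal_sum_of_nonneg fun i _ => by positivity,
          ← ENNReal.ofReal_ofNat 4, ← ENNReal.ofReal_mul (by norm_num)]
        congr 1
        rw [← Finset.sum_mul, ← Finset.sum_mul]
        ring

/-! ### Solutions on an interval -/

/-- The condition says that f is fixed by a bounded multiplier. Closedness transfers it from almost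
every time to every time of the continuous representative. -/
theorem isClosed_spec (r R : ℝ) : IsClosed {f : L2x | Spec r R f} := by
  let T : Set Plane := {ξ | r ≤ ‖ξ‖ ∧ ‖ξ‖ ≤ R}
  let m : Plane → ℂ := T.indicator 1
  have hs : MeasurableSet T :=
    (measurableSet_le measurable_const measurable_norm).inter
      (measurableSet_le measurable_norm measurable_const)
  have hm : MemLp m ⊤ (volume : Measure Plane) :=
    memLp_top_of_bound (measurable_one.indicator hs).aestronglyMeasurable 1
      (Eventually.of_forall fun ξ => (norm_indicator_le_norm_self _ _).trans (by simp))
  have e : {f : L2x | Spec r R f} = {f | mop m hm f = f} := by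
    ext f
    constructor
    · intro h
      apply fourier_injective
      filter_upwards [h, fourier_mop m hm f] with ξ h1 h2
      rw [h2]
      by_cases h0 : (𝓕 f : L2x) ξ = 0
      · rw [h0, mul_zero]
      · rw [show m ξ = 1 from Set.indicator_of_mem (show ξ ∈ T from h1 h0) 1, one_mul]
    · intro h
      have h' : mop m hm f = f := h
      have h2 := fourier_mop m hm f
      rw [h'] at h2
      filter_upwards [h2] with ξ h1 h3
      by_contra h4
      rw [show m ξ = 0 from Set.indicator_of_notMem (show ξ ∉ T from h4) 1, zero_mul] at h1
      exact h3 h1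
  rw [e]
  exact isClosed_eq (mop m hm).continuous continuous_id

theorem Spec.trans {r R : ℝ} {f : L2x} (h : Spec r R f) (z : Plane) : Spec r R (trans z f) := by
  filter_upwards [h, fourier_trans z f] with ξ h1 h2 h3
  exact h1 fun h0 => h3 (by rw [h2, h0, mul_zero])

theorem Band.mono {R S : ℝ} {f : L2x} (h : Band R f) (hRS : R ≤ S) : Band S f := by
  filter_upwards [h] with ξ h1 h2
  exact h1 (hRS.trans_lt h2)

theorem IsPrim.congr_ae {E : Type*} [NormedAddCommGroup E] [NormedSpace ℝ E] {f f' g' : ℝ → E}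
    {a b : ℝ} (h : IsPrim f f' a b) (hg : f' =ᵐ[volume.restrict (Set.Icc a b)] g') :
    IsPrim f g' a b := by
  refine ⟨h.int.congr hg, fun t ht => ?_⟩
  rw [h.eq t ht]
  congr 1
  refine intervalIntegral.integral_congr_ae ?_
  have h1 := (ae_restrict_iff' measurableSet_Icc).1 hg
  filter_upwards [h1] with s hs h2
  rw [Set.uIoc_of_le ht.1] at h2
  exact hs ⟨h2.1.le, h2.2.trans ht.2⟩

theorem mem_of_ae_mem {E : Type*} [PseudoMetricSpace E] {Z : Set E} (hZ : IsClosed Z)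
    {F : ℝ → E} {a b : ℝ} (hab : a < b) (hF : ContinuousOn F (Set.Icc a b))
    (h : ∀ᵐ t ∂volume.restrict (Set.Icc a b), F t ∈ Z) : ∀ t ∈ Set.Icc a b, F t ∈ Z := by
  have hne : Z.Nonempty := by
    have h0 : (volume.restrict (Set.Icc a b)) ≠ 0 := by
      rw [Ne, Measure.restrict_eq_zero, Real.volume_Icc, ENNReal.ofReal_eq_zero]
      linarith
    have := ae_neBot.2 h0
    obtain ⟨t, ht⟩ := h.exists
    exact ⟨_, ht⟩
  have h1 : (fun t => Metric.infDist (F t) Z) =ᵐ[volume.restrict (Set.Icc a b)] fun _ => 0 := by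
    filter_upwards [h] with t ht
    exact Metric.infDist_zero_of_mem ht
  intro t ht
  exact (hZ.mem_iff_infDist_zero hne).2 (Measure.eqOn_Icc_of_ae_eq volume hab.ne h1
    ((Metric.continuous_infDist_pt Z).comp_continuousOn hF) continuousOn_const ht)

/-- Translating the solution absorbs the shift y, so the estimate on compact intervals is only
needed without shift. -/
theorem BandSolution.trans {S a b A X : ℝ} {f N : ℝ → L2x} (h : BandSolution S a b f N A X)
    (z : Plane) :
    BandSolution S a b (fun t => UH.trans z (f t)) (fun t => UH.trans z (N t)) A X where
  prim := by
    have := h.prim.clm ((UH.trans z).toContinuousLinearMap.restrictScalars ℝ)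
    simp only [ContinuousLinearMap.coe_restrictScalars', LinearIsometry.coe_toContinuousLinearMap,
      map_smul, map_sub] at this
    simpa only [schr_trans] using this
  forcing := (UH.trans z).toContinuousLinearMap.integrable_comp h.forcing
  band t ht := band_trans z (h.band t ht)
  norm_le t ht := by rw [LinearIsometry.norm_map]; exact h.norm_le t ht
  nonneg := h.nonneg
  pair_le := by
    refine le_trans (iSup_mono fun y => le_of_eq (lintegral_congr fun t => ?_)) h.pair_le
    rw [← pairL1_trans z (UH.trans y (f t)), trans_trans, trans_trans, add_comm]

theorem lintegral_pairL1_trans (μ : Measure ℝ) (y : Plane) (f N : ℝ → L2x) :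
    ∫⁻ t, pairL1 (trans y (f t)) (N t) ∂μ =
      ∫⁻ t, (∫⁻ x, ‖f t (x - y) * N t x‖ₑ) ∂μ := by
  refine lintegral_congr fun t => ?_
  unfold pairL1
  refine lintegral_congr_ae ?_
  filter_upwards [coeFn_trans y (f t)] with x hx
  rw [hx]

theorem interaction_eq (I : Set ℝ) (f N : ℝ → L2x) :
    interaction I f N = supPair (volume.restrict I) f N :=
  iSup_congr fun y => (lintegral_pairL1_trans _ y f N).symm

/-- The bounds hold for almost every time; they pass to every time of the continuous representative
because each defines a closed subset of L². The clause on Z carries the frequency support over in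
the same way. -/
theorem exists_bandSolution {I : Set ℝ} (hI : I.OrdConnected) (hne : (interior I).Nonempty)
    {S A X : ℝ} {f N : ℝ → L2x} (h : IsUHForcing I f N) (hf : ∀ t, Band S (f t))
    (hA : ∀ᵐ t, t ∈ interior I → ‖f t‖ ≤ A) (hX : 0 ≤ X)
    (hint : supPair (volume.restrict (interior I)) f N ≤ ENNReal.ofReal X) :
    ∃ F : ℝ → L2x, (∀ᵐ t, t ∈ interior I → f t = F t) ∧
      ∀ a b, a < b → Set.Icc a b ⊆ interior I → BandSolution S a b F N A X ∧
        ∀ Z : Set L2x, IsClosed Z → (∀ t, f t ∈ Z) → ∀ t ∈ Set.Icc a b, F t ∈ Z := by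
  obtain ⟨t₀, ht₀⟩ := hne
  obtain ⟨F, hfF, hF⟩ := exists_primitive_of_isUHForcing hI ht₀ h hf
  refine ⟨F, hfF, fun a b hab hsub => ?_⟩
  have hae : ∀ {p : ℝ → Prop}, (∀ᵐ t, t ∈ interior I → p t) →
      ∀ᵐ t ∂volume.restrict (Set.Icc a b), p t := fun hp => by
    rw [ae_restrict_iff' measurableSet_Icc]
    filter_upwards [hp] with t ht h2 using ht (hsub h2)
  have hfF' := hae hfF
  have hp := hF a b hsub
  have hmem : ∀ Z : Set L2x, IsClosed Z → (∀ t, f t ∈ Z) → ∀ t ∈ Set.Icc a b, F t ∈ Z :=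
    fun Z hZ hfZ => mem_of_ae_mem hZ hab hp.continuousOn (by
      filter_upwards [hfF'] with t ht
      rw [← ht]; exact hfZ t)
  refine ⟨⟨hp.congr_ae ?_, h.locInt_forcing.integrableOn_compact_subset hsub isCompact_Icc,
    ?_, ?_, hX, le_trans (iSup_mono fun y => ?_) hint⟩, hmem⟩
  · filter_upwards [hfF'] with t ht
    rw [ht]
  · have hb : ∀ p : L2x, Band S p ↔ Spec 0 S p := fun p => by
      refine ⟨fun hp => ?_, Spec.band⟩
      filter_upwards [hp] with ξ h1 h2
      exact ⟨norm_nonneg _, not_lt.1 fun h3 => h2 (h1 h3)⟩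
    intro t ht
    exact (hb _).2 (hmem _ (isClosed_spec 0 S) (fun t => (hb _).1 (hf t)) t ht)
  · have hc : IsClosed {p : L2x | ‖p‖ ≤ A} := isClosed_le continuous_norm continuous_const
    refine mem_of_ae_mem hc hab hp.continuousOn ?_
    filter_upwards [hfF', hae hA] with t h1 h2
    rw [← h1]
    exact h2
  · calc _ = ∫⁻ t in Set.Icc a b, pairL1 (trans y (f t)) (N t) := by
          refine lintegral_congr_ae ?_
          filter_upwards [hfF'] with t ht
          rw [ht]
      _ ≤ _ := lintegral_mono_set hsub

/-! ### Exhaustion by compact intervals -/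

theorem lintegral_le_of_forall_Icc {Ω : Set ℝ} (hΩ : IsOpen Ω) (hc : Ω.OrdConnected)
    {h : ℝ → ℝ≥0∞} {B : ℝ≥0∞}
    (hB : ∀ a b, a < b → Set.Icc a b ⊆ Ω → ∫⁻ t in Set.Icc a b, h t ≤ B) :
    ∫⁻ t in Ω, h t ≤ B := by
  -- Rational endpoints give a countable directed family, so the integral over the union is the
  -- supremum of the integrals.
  let ι := {p : ℚ × ℚ // (p.1 : ℝ) < p.2 ∧ Set.Icc (p.1 : ℝ) p.2 ⊆ Ω}
  let s : ι → Set ℝ := fun p => Set.Icc (p.1.1 : ℝ) p.1.2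
  have hU : Ω = ⋃ p, s p := by
    refine Set.Subset.antisymm (fun x hx => ?_) (Set.iUnion_subset fun p => p.2.2)
    obtain ⟨ε, hε, hball⟩ := Metric.isOpen_iff.1 hΩ x hx
    obtain ⟨a, ha1, ha2⟩ := exists_rat_btwn (sub_lt_self x hε)
    obtain ⟨b, hb1, hb2⟩ := exists_rat_btwn (lt_add_of_pos_right x hε)
    refine Set.mem_iUnion.2 ⟨⟨(a, b), ha2.trans hb1, ?_⟩, ha2.le, hb1.le⟩
    refine Set.Subset.trans (fun y hy => ?_) hball
    rw [Metric.mem_ball, Real.dist_eq, abs_lt]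
    constructor <;> linarith [hy.1, hy.2]
  have hd : Directed (· ⊆ ·) s := fun p q => by
    have hp1 := p.2.2 (Set.left_mem_Icc.2 p.2.1.le)
    have hp2 := p.2.2 (Set.right_mem_Icc.2 p.2.1.le)
    have hq1 := q.2.2 (Set.left_mem_Icc.2 q.2.1.le)
    have hq2 := q.2.2 (Set.right_mem_Icc.2 q.2.1.le)
    have h1 : ((min p.1.1 q.1.1 : ℚ) : ℝ) ∈ Ω := by
      rcases min_choice p.1.1 q.1.1 with e | e <;> rw [e] <;> assumption
    have h2 : ((max p.1.2 q.1.2 : ℚ) : ℝ) ∈ Ω := by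
      rcases max_choice p.1.2 q.1.2 with e | e <;> rw [e] <;> assumption
    have hlt : ((min p.1.1 q.1.1 : ℚ) : ℝ) < ((max p.1.2 q.1.2 : ℚ) : ℝ) := by
      have : p.1.1 < p.1.2 := by exact_mod_cast p.2.1
      exact_mod_cast (min_le_left _ _).trans_lt (this.trans_le (le_max_left _ _))
    refine ⟨⟨(min p.1.1 q.1.1, max p.1.2 q.1.2), hlt, hc.out h1 h2⟩, ?_, ?_⟩
    · exact Set.Icc_subset_Icc (by exact_mod_cast min_le_left _ _)
        (by exact_mod_cast le_max_left _ _)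
    · exact Set.Icc_subset_Icc (by exact_mod_cast min_le_right _ _)
        (by exact_mod_cast le_max_right _ _)
  rw [hU, setLIntegral_iUnion_of_directed h hd]
  exact iSup_le fun p => hB _ _ p.2.1 p.2.2

theorem interior_ae_eq {I : Set ℝ} (hI : I.OrdConnected) : interior I =ᵐ[volume] I :=
  interior_ae_eq_of_null_frontier (hI.convex.addHaar_frontier volume)

/-- The bilinear estimate for separated frequencies, on arbitrary intervals. -/
theorem exists_const_lintegral_sqPair_interior_le {r R : ℝ} (hr : 0 < r) (hR : 0 < R) :
    ∃ C : ℝ, 0 ≤ C ∧ ∀ {lam ν A B X Y : ℝ} {I : Set ℝ} {f N g M : ℝ → L2x}, 0 < lam → 0 < ν →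
      4 * R * ν ≤ r * lam → I.OrdConnected → IsUHForcing I f N → IsUHForcing I g M →
      (∀ t, Spec (r * lam) (R * lam) (f t)) → (∀ t, Spec (r * ν) (R * ν) (g t)) →
      0 ≤ X → 0 ≤ Y →
      (∀ᵐ t, t ∈ interior I → ‖f t‖ ≤ A) → (∀ᵐ t, t ∈ interior I → ‖g t‖ ≤ B) →
      supPair (volume.restrict (interior I)) f N ≤ ENNReal.ofReal X →
      supPair (volume.restrict (interior I)) g M ≤ ENNReal.ofReal Y → ∀ y : Plane,
      ∫⁻ t in interior I, sqPair (trans y (f t)) (g t) ≤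
        ENNReal.ofReal (C * (ν / lam) * (A ^ 2 * B ^ 2 + X * B ^ 2 + A ^ 2 * Y)) := by
  obtain ⟨C, hC, hmain⟩ := exists_const_lintegral_sqPair_le hr hR
  refine ⟨C, hC, ?_⟩
  intro lam ν A B X Y I f N g M hlam hν hsep hI hf hg hfs hgs hX hY hA hB hfX hgY y
  rcases (interior I).eq_empty_or_nonempty with he | hne
  · rw [he, Measure.restrict_empty, lintegral_zero_measure]
    exact zero_le
  have hfb : ∀ t, Band (max (R * lam) (R * ν)) (f t) := fun t =>
    (hfs t).band.mono (le_max_left _ _)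
  have hgb : ∀ t, Band (max (R * lam) (R * ν)) (g t) := fun t =>
    (hgs t).band.mono (le_max_right _ _)
  obtain ⟨F, hfF, hF⟩ := exists_bandSolution hI hne hf hfb hA hX hfX
  obtain ⟨G, hgG, hG⟩ := exists_bandSolution hI hne hg hgb hB hY hgY
  refine lintegral_le_of_forall_Icc isOpen_interior hI.interior fun a b hab hsub => ?_
  obtain ⟨hFs, hFZ⟩ := hF a b hab hsub
  obtain ⟨hGs, hGZ⟩ := hG a b hab hsub
  refine le_trans (le_of_eq ?_) (hmain hlam hν hsep (hFs.trans y) hGs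
    (fun t ht => (hFZ _ (isClosed_spec _ _) hfs t ht).trans y)
    (fun t ht => (hGZ _ (isClosed_spec _ _) hgs t ht).band))
  refine lintegral_congr_ae ((ae_restrict_iff' measurableSet_Icc).2 ?_)
  filter_upwards [hfF, hgG] with t h1 h2 ht
  rw [h1 (hsub ht), h2 (hsub ht)]

/-! ### Bilinear estimates in terms of the functional `𝓓` -/

theorem restrict_interior_eq {I : Set ℝ} (hI : I.OrdConnected) :
    (volume.restrict (interior I) : Measure ℝ) = volume.restrict I :=
  Measure.restrict_congr_set (interior_ae_eq hI)

theorem supTranslatedL2_eq (I : Set ℝ) (f g : ℝ → L2x) :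
    supTranslatedL2 I f g =
      ⨆ y : Plane, (∫⁻ t in I, sqPair (trans y (f t)) (g t)) ^ (1 / 2 : ℝ) := by
  refine iSup_congr fun y => congrArg (· ^ (1 / 2 : ℝ)) (lintegral_congr fun t => ?_)
  refine lintegral_congr_ae ?_
  filter_upwards [coeFn_trans y (f t)] with x hx
  rw [hx]

theorem supTranslatedL2_comm (I : Set ℝ) (f g : ℝ → L2x) :
    supTranslatedL2 I f g = supTranslatedL2 I g f := by
  have : ∀ f g : ℝ → L2x, supTranslatedL2 I f g ≤ supTranslatedL2 I g f := fun f g => by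
    rw [supTranslatedL2_eq, supTranslatedL2_eq]
    refine iSup_le fun y => ?_
    refine le_trans (le_of_eq (congrArg (· ^ (1 / 2 : ℝ)) (lintegral_congr fun t => ?_)))
      (le_iSup (fun y => (∫⁻ t in I, sqPair (trans y (g t)) (f t)) ^ (1 / 2 : ℝ)) (-y))
    rw [← sqPair_trans (-y), trans_trans, neg_add_cancel, trans_zero, sqPair_comm]
  exact le_antisymm (this f g) (this g f)

theorem eLpNorm_le_dFunctional (I : Set ℝ) (f N : ℝ → L2x) :
    eLpNorm f ⊤ (volume.restrict I) ≤ dFunctional I f N :=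
  (le_max_left _ _).trans le_self_add

theorem lintegral_sqPair_self_le_dFunctional (I : Set ℝ) (f N : ℝ → L2x) :
    (∫⁻ t in I, sqPair (f t) (f t)) ^ (1 / 4 : ℝ) ≤ dFunctional I f N := by
  refine le_trans (le_of_eq ?_) ((le_max_right _ _).trans (le_self_add (a := strichartzNorm I f)))
  simp only [sqPair, ← pow_two, enorm_pow, ← pow_mul, Nat.reducePow]

theorem interaction_le_dFunctional (I : Set ℝ) (f N : ℝ → L2x) :
    interaction I f N ≤ dFunctional I f N ^ 2 := by
  have h : interaction I f N ^ (1 / 2 : ℝ) ≤ dFunctional I f N := le_add_self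
  refine le_trans (le_of_eq ?_) (pow_le_pow_left' h 2)
  rw [← ENNReal.rpow_natCast, ← ENNReal.rpow_mul]
  norm_num

theorem ae_enorm_le_dFunctional (I : Set ℝ) (f N : ℝ → L2x) :
    ∀ᵐ t ∂volume.restrict I, ‖f t‖ₑ ≤ dFunctional I f N := by
  filter_upwards [ae_le_eLpNormEssSup (f := f) (μ := volume.restrict I)] with t ht
  rw [← eLpNorm_exponent_top] at ht
  exact ht.trans (eLpNorm_le_dFunctional I f N)

theorem sqPair_zero_right (p : L2x) : sqPair p 0 = 0 := by
  unfold sqPair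
  refine (lintegral_congr_ae ?_).trans lintegral_zero
  filter_upwards [Lp.coeFn_zero ℂ 2 (volume : Measure Plane)] with x hx
  rw [hx]; simp

theorem supTranslatedL2_eq_zero_of_right {I : Set ℝ} {f g M : ℝ → L2x}
    (h : dFunctional I g M = 0) : supTranslatedL2 I f g = 0 := by
  rw [supTranslatedL2_eq, ENNReal.iSup_eq_zero]
  intro y
  rw [ENNReal.rpow_eq_zero_iff_of_pos (by norm_num)]
  refine (lintegral_congr_ae ?_).trans lintegral_zero
  filter_upwards [ae_enorm_le_dFunctional I g M] with t ht
  rw [h, le_zero_iff, enorm_eq_zero] at ht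
  rw [ht, sqPair_zero_right]

/-- Hölder in space and then in time, with translation invariance of the L⁴ norm. There is no gain,
but no separation of frequencies is required. -/
theorem supTranslatedL2_le_mul {I : Set ℝ} {f g N M : ℝ → L2x}
    (hf : AEStronglyMeasurable f (volume.restrict I))
    (hg : AEStronglyMeasurable g (volume.restrict I)) :
    supTranslatedL2 I f g ≤ dFunctional I f N * dFunctional I g M := by
  rw [supTranslatedL2_eq]
  refine iSup_le fun y => ?_
  have h1 : ∀ t, sqPair (trans y (f t)) (g t) ≤
      sqPair (f t) (f t) ^ (1 / 2 : ℝ) * sqPair (g t) (g t) ^ (1 / 2 : ℝ) := fun t => by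
    have := ENNReal.rpow_le_rpow (sq_sqPair_le (trans y (f t)) (g t))
      (show (0 : ℝ) ≤ 1 / 2 by norm_num)
    rwa [sqPair_trans, ENNReal.mul_rpow_of_nonneg _ _ (by norm_num), ← ENNReal.rpow_natCast,
      ← ENNReal.rpow_mul, show ((2 : ℕ) : ℝ) * (1 / 2) = 1 by norm_num, ENNReal.rpow_one] at this
  have hh := ENNReal.lintegral_mul_le_Lp_mul_Lq (volume.restrict I) Real.HolderConjugate.two_two
    ((aemeasurable_sqPair hf hf).pow_const (1 / 2 : ℝ))
    ((aemeasurable_sqPair hg hg).pow_const (1 / 2 : ℝ))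
  have e : ∀ a : ℝ≥0∞, (a ^ (1 / 2 : ℝ)) ^ (2 : ℝ) = a := fun a => by
    rw [← ENNReal.rpow_mul]; norm_num
  have e' : ∀ a : ℝ≥0∞, (a ^ (1 / 2 : ℝ)) ^ (1 / 2 : ℝ) = a ^ (1 / 4 : ℝ) := fun a => by
    rw [← ENNReal.rpow_mul]; norm_num
  simp only [Pi.mul_apply, e] at hh
  have h2 := ENNReal.rpow_le_rpow ((lintegral_mono h1).trans hh)
    (show (0 : ℝ) ≤ 1 / 2 by norm_num)
  rw [ENNReal.mul_rpow_of_nonneg _ _ (by norm_num), e', e'] at h2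
  exact h2.trans (mul_le_mul' (lintegral_sqPair_self_le_dFunctional I f N)
    (lintegral_sqPair_self_le_dFunctional I g M))

/-- Taking A² = X = 𝓓(f)² and B² = Y = 𝓓(g)² makes the three terms of the interaction bound equal,
whence the 3 in the constant. -/
theorem exists_const_supTranslatedL2_le {r R : ℝ} (hr : 0 < r) (hR : 0 < R) :
    ∃ C : ℝ, 0 ≤ C ∧ ∀ {lam ν : ℝ} {I : Set ℝ} {f N g M : ℝ → L2x}, 0 < lam → 0 < ν →
      4 * R * ν ≤ r * lam → I.OrdConnected → IsUHForcing I f N → IsUHForcing I g M →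
      (∀ t, Spec (r * lam) (R * lam) (f t)) → (∀ t, Spec (r * ν) (R * ν) (g t)) →
      dFunctional I f N ≠ ⊤ → dFunctional I g M ≠ ⊤ →
      supTranslatedL2 I f g ≤
        ENNReal.ofReal (C * √(ν / lam)) * dFunctional I f N * dFunctional I g M := by
  obtain ⟨C, hC, hmain⟩ := exists_const_lintegral_sqPair_interior_le hr hR
  refine ⟨√(3 * C), Real.sqrt_nonneg _, ?_⟩
  intro lam ν I f N g M hlam hν hsep hI hf hg hfs hgs hfD hgD
  set d := (dFunctional I f N).toReal with hd
  set e := (dFunctional I g M).toReal with he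
  have hd' : dFunctional I f N = ENNReal.ofReal d := (ENNReal.ofReal_toReal hfD).symm
  have he' : dFunctional I g M = ENNReal.ofReal e := (ENNReal.ofReal_toReal hgD).symm
  have hd0 : 0 ≤ d := ENNReal.toReal_nonneg
  have he0 : 0 ≤ e := ENNReal.toReal_nonneg
  have hnorm : ∀ {f N : ℝ → L2x} {d : ℝ}, 0 ≤ d → dFunctional I f N = ENNReal.ofReal d →
      ∀ᵐ t, t ∈ interior I → ‖f t‖ ≤ d := fun {f N d} hd0 hd => by
    have h := ae_enorm_le_dFunctional I f N
    rw [← restrict_interior_eq hI, ae_restrict_iff' isOpen_interior.measurableSet] at h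
    filter_upwards [h] with t ht h2
    have h3 := ht h2
    rwa [hd, ← ofReal_norm, ENNReal.ofReal_le_ofReal_iff hd0] at h3
  have hpair : ∀ {f N : ℝ → L2x} {d : ℝ}, 0 ≤ d → dFunctional I f N = ENNReal.ofReal d →
      supPair (volume.restrict (interior I)) f N ≤ ENNReal.ofReal (d ^ 2) :=
    fun {f N d} hd0 hd => by
      rw [restrict_interior_eq hI, ← interaction_eq, ENNReal.ofReal_pow hd0, ← hd]
      exact interaction_le_dFunctional I f N
  rw [supTranslatedL2_eq]
  refine iSup_le fun y => ?_
  have h := hmain hlam hν hsep hI hf hg hfs hgs (sq_nonneg d) (sq_nonneg e) (hnorm hd0 hd')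
    (hnorm he0 he') (hpair hd0 hd') (hpair he0 he') y
  rw [restrict_interior_eq hI] at h
  refine (ENNReal.rpow_le_rpow h (by norm_num)).trans (le_of_eq ?_)
  rw [hd', he', ENNReal.ofReal_rpow_of_nonneg (by positivity) (by norm_num),
    ← ENNReal.ofReal_mul (by positivity), ← ENNReal.ofReal_mul (by positivity),
    ← Real.sqrt_eq_rpow]
  congr 1
  rw [show C * (ν / lam) * (d ^ 2 * e ^ 2 + d ^ 2 * e ^ 2 + d ^ 2 * e ^ 2) =
    (3 * C) * (ν / lam) * (d * e) ^ 2 by ring, Real.sqrt_mul (by positivity),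
    Real.sqrt_mul (by positivity), Real.sqrt_sq (by positivity)]
  ring

/-! ### Frequency support of the Littlewood-Paley operators -/

theorem fourier_lpLow (χ : LPCutoff) (k : ℤ) (f : L2x) :
    (𝓕 (lpLow χ k f) : L2x) =ᵐ[volume] fun ξ => lowSymbol χ k ξ * (𝓕 f : L2x) ξ :=
  fourier_mop (lowSymbol χ k) (lowSymbol_memLp χ k) f

theorem fourier_lpProj (χ : LPCutoff) (k : ℤ) (f : L2x) :
    (𝓕 (lpProj χ k f) : L2x) =ᵐ[volume]
      fun ξ => (lowSymbol χ k ξ - lowSymbol χ (k - 1) ξ) * (𝓕 f : L2x) ξ := by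
  have e : (𝓕 (lpProj χ k f) : L2x) = 𝓕 (lpLow χ k f) - 𝓕 (lpLow χ (k - 1) f) :=
    (Lp.fourierTransformₗᵢ Plane ℂ).map_sub _ _
  rw [e]
  filter_upwards [Lp.coeFn_sub (𝓕 (lpLow χ k f) : L2x) (𝓕 (lpLow χ (k - 1) f)),
    fourier_lpLow χ k f, fourier_lpLow χ (k - 1) f] with ξ h1 h2 h3
  rw [h1, Pi.sub_apply, h2, h3, sub_mul]

theorem exists_spec_lpProj (χ : LPCutoff) :
    ∃ r R : ℝ, 0 < r ∧ 0 < R ∧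
      ∀ (k : ℤ) (f : L2x), Spec (r * (2 : ℝ) ^ k) (R * (2 : ℝ) ^ k) (lpProj χ k f) := by
  obtain ⟨ε, hε, hball⟩ := Metric.eventually_nhds_iff_ball.1 χ.eq_one_near_zero
  obtain ⟨R, hR0, hR⟩ := χ.compact_support.isCompact.isBounded.exists_pos_norm_le
  -- The symbol at level k - 1 is evaluated at twice the argument, so both symbols equal 1 only
  -- below ε/2.
  refine ⟨ε / 2, R, by positivity, hR0, fun k f => ?_⟩
  have hlow : ∀ s : ℝ, 0 ≤ s → s < ε → χ.toFun s = 1 := fun s hs h => hball s (by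
    rwa [mem_ball_zero_iff, Real.norm_of_nonneg hs])
  have hhigh : ∀ s : ℝ, R < s → χ.toFun s = 0 := fun s h => by
    by_contra h0
    have := hR s (subset_tsupport _ h0)
    exact absurd ((le_abs_self s).trans this) (not_le.2 h)
  have h2 : (2 : ℝ) ^ (-(k - 1)) = 2 * 2 ^ (-k) := by
    rw [neg_sub, sub_eq_add_neg, zpow_add₀ two_ne_zero, zpow_one]
  have h2k : (0 : ℝ) < 2 ^ k := by positivity
  filter_upwards [fourier_lpProj χ k f] with ξ h1 hξ
  rw [h1] at hξ
  have hne := left_ne_zero_of_mul hξ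
  have hs0 : 0 ≤ (2 : ℝ) ^ (-k) * ‖ξ‖ := by positivity
  constructor
  · by_contra h
    have h3 : (2 : ℝ) ^ (-k) * ‖ξ‖ < ε / 2 := by
      rw [zpow_neg, inv_mul_lt_iff₀ h2k, mul_comm]; exact not_le.1 h
    apply hne
    rw [lowSymbol, lowSymbol, h2, mul_assoc, hlow _ hs0 (by linarith),
      hlow _ (by positivity) (by linarith), sub_self]
  · by_contra h
    have h3 : R < (2 : ℝ) ^ (-k) * ‖ξ‖ := by
      rw [zpow_neg, lt_inv_mul_iff₀ h2k, mul_comm]; exact not_le.1 h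
    apply hne
    rw [lowSymbol, lowSymbol, h2, mul_assoc, hhigh _ h3, hhigh _ (by linarith), sub_self]

theorem aestronglyMeasurable_of_isUHForcing {I : Set ℝ} (hI : I.OrdConnected) {f N : ℝ → L2x}
    (h : IsUHForcing I f N) : AEStronglyMeasurable f (volume.restrict I) := by
  rw [← restrict_interior_eq hI]
  exact h.locInt.aestronglyMeasurable

theorem sqrt_two_zpow_div (k₁ k₂ : ℤ) (h : k₂ ≤ k₁) :
    √((2 : ℝ) ^ k₂ / (2 : ℝ) ^ k₁) = (2 : ℝ) ^ (-|(k₁ : ℝ) - k₂| / 2) := by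
  have h' : (k₂ : ℝ) ≤ k₁ := by exact_mod_cast h
  rw [Real.sqrt_eq_rpow, ← zpow_sub₀ two_ne_zero, ← Real.rpow_intCast, ← Real.rpow_mul two_pos.le,
    abs_of_nonneg (sub_nonneg.2 h')]
  congr 1
  push_cast
  ring

theorem exists_const_supTranslatedL2_lpProj_le (χ : LPCutoff) :
    ∃ C : ℝ, 0 < C ∧ ∀ {I : Set ℝ}, I.OrdConnected → ∀ {k₁ k₂ : ℤ}, k₂ ≤ k₁ →
      ∀ {u v N₁ N₂ : ℝ → L2x},
      IsUHForcing I (fun t => lpProj χ k₁ (u t)) N₁ →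
      IsUHForcing I (fun t => lpProj χ k₂ (v t)) N₂ →
      supTranslatedL2 I (fun t => lpProj χ k₁ (u t)) (fun t => lpProj χ k₂ (v t)) ≤
        ENNReal.ofReal C * ENNReal.ofReal ((2 : ℝ) ^ (-|(k₁ : ℝ) - k₂| / 2)) *
          dFunctional I (fun t => lpProj χ k₁ (u t)) N₁ *
          dFunctional I (fun t => lpProj χ k₂ (v t)) N₂ := by
  obtain ⟨r, R, hr, hR, hspec⟩ := exists_spec_lpProj χ
  obtain ⟨C, hC, hmain⟩ := exists_const_supTranslatedL2_le hr hR
  -- A gap of m octaves guarantees the separation 4R·2^{k₂} ≤ r·2^{k₁}.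
  obtain ⟨m, hm⟩ := pow_unbounded_of_one_lt (4 * R / r) one_lt_two
  rw [div_lt_iff₀ hr] at hm
  have hpow : (0 : ℝ) < 2 ^ ((m : ℝ) / 2) := Real.rpow_pos_of_pos two_pos _
  refine ⟨C + 2 ^ ((m : ℝ) / 2), by positivity, ?_⟩
  intro I hI k₁ k₂ hk u v N₁ N₂ hu hv
  set f := fun t => lpProj χ k₁ (u t) with hf
  set g := fun t => lpProj χ k₂ (v t) with hg
  have hCpos : 0 < C + 2 ^ ((m : ℝ) / 2) := by positivity
  have hqpos : (0 : ℝ) < 2 ^ (-|(k₁ : ℝ) - k₂| / 2) := Real.rpow_pos_of_pos two_pos _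
  set q : ℝ := 2 ^ (-|(k₁ : ℝ) - k₂| / 2) with hq
  rw [← ENNReal.ofReal_mul hCpos.le]
  have hc0 : ENNReal.ofReal ((C + 2 ^ ((m : ℝ) / 2)) * q) ≠ 0 := by
    rw [Ne, ENNReal.ofReal_eq_zero, not_le]; positivity
  -- Vanishing functionals are treated before infinite ones: as 0·∞ = 0 on the right, the left side
  -- must be shown to vanish, and it does since one factor is zero for almost every time.
  by_cases hf0 : dFunctional I f N₁ = 0
  · rw [supTranslatedL2_comm, supTranslatedL2_eq_zero_of_right hf0]
    exact zero_le
  by_cases hg0 : dFunctional I g N₂ = 0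
  · rw [supTranslatedL2_eq_zero_of_right hg0]
    exact zero_le
  by_cases hft : dFunctional I f N₁ = ⊤
  · rw [hft, ENNReal.mul_top hc0, ENNReal.top_mul hg0]
    exact le_top
  by_cases hgt : dFunctional I g N₂ = ⊤
  · rw [hgt, ENNReal.mul_top (mul_ne_zero hc0 hf0)]
    exact le_top
  rcases le_or_gt (k₂ + m) k₁ with hsep | hnear
  · refine (hmain (lam := 2 ^ k₁) (ν := 2 ^ k₂) (by positivity) (by positivity) ?_ hI hu hv
      (fun t => hspec k₁ (u t)) (fun t => hspec k₂ (v t)) hft hgt).trans ?_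
    · have h1 : (2 : ℝ) ^ (k₂ + m) ≤ 2 ^ k₁ := zpow_le_zpow_right₀ one_le_two hsep
      rw [zpow_add₀ two_ne_zero, zpow_natCast] at h1
      have h2 : (0 : ℝ) < 2 ^ k₂ := by positivity
      calc 4 * R * 2 ^ k₂ ≤ (2 ^ m * r) * 2 ^ k₂ := by gcongr
        _ = r * (2 ^ k₂ * 2 ^ m) := by ring
        _ ≤ _ := by gcongr
    · rw [sqrt_two_zpow_div _ _ hk, ← hq]
      gcongr
      linarith
  · refine (supTranslatedL2_le_mul (N := N₁) (M := N₂) (aestronglyMeasurable_of_isUHForcing hI hu)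
      (aestronglyMeasurable_of_isUHForcing hI hv)).trans ?_
    rw [mul_assoc]
    refine le_mul_of_one_le_left zero_le ?_
    rw [ENNReal.one_le_ofReal]
    -- For fewer than m octaves the decay factor q is at least 2^{-m/2}, which the second summand of
    -- the constant compensates.
    have h1 : 1 ≤ (2 : ℝ) ^ ((m : ℝ) / 2) * q := by
      rw [hq, ← Real.rpow_add two_pos]
      refine Real.one_le_rpow one_le_two ?_
      have h2 : (k₁ : ℝ) < k₂ + m := by exact_mod_cast hnear
      have h3 : (k₂ : ℝ) ≤ k₁ := by exact_mod_cast hk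
      rw [abs_of_nonneg (sub_nonneg.2 h3)]
      linarith
    nlinarith [mul_nonneg hC hqpos.le]

end UH

end

/-! ### Reduction to ordered frequencies -/

theorem proposition2p3 (χ : LPCutoff) :
    ∃ C : ℝ≥0, ∀ (I : Set ℝ), I.OrdConnected → ∀ (k₁ k₂ : ℤ) (u v N₁ N₂ : ℝ → L2x),
      IsUHForcing I (fun t => lpProj χ k₁ (u t)) N₁ →
      IsUHForcing I (fun t => lpProj χ k₂ (v t)) N₂ →
      supTranslatedL2 I (fun t => lpProj χ k₁ (u t)) (fun t => lpProj χ k₂ (v t)) ≤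
        C * ENNReal.ofReal ((2 : ℝ) ^ (-(|k₁ - k₂| : ℝ) / 2)) *
          dFunctional I (fun t => lpProj χ k₁ (u t)) N₁ *
          dFunctional I (fun t => lpProj χ k₂ (v t)) N₂ := by
  obtain ⟨C, -, hC⟩ := UH.exists_const_supTranslatedL2_lpProj_le χ
  refine ⟨C.toNNReal, fun I hI k₁ k₂ u v N₁ N₂ hu hv => ?_⟩
  -- The roles of u and v are exchanged by replacing y with -y in the supremum.
  rcases le_total k₂ k₁ with hk | hk
  · exact hC hI hk hu hv
  · have h := hC hI hk hv hu
    rw [UH.supTranslatedL2_comm, mul_right_comm, abs_sub_comm]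
    exact h
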